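/- Let $\Bbbk$ be a field of characteristic $0$. Complexes are $\mathbb Z$-graded cochain complexes over $\Bbbk$, $\otimes=\otimes_\Bbbk$, the Koszul sign rule is used throughout, $\tau(x\otimes y)=(-1)^{|x||y|}y\otimes x$, and $\imath,\jmath$ denote the unit isomorphisms $\Bbbk\otimes X\cong X$, $X\otimes\Bbbk\cong X$. Let $B$ be a commutative dg Hopf algebra with product $m_B$, coproduct $\Delta_B$, counit $\epsilon_B$ and antipode $\varsigma_B$, and let $A$ be a commutative dg algebra with product $m_A$ and unit $u_A$. A right dg-comodule over $B$ is a complex $M$ with a coassociative counital cochain map $\gamma^M:M\to M\otimes B$. A morphism of dg-comodules is a linear map $\psi$, of any degree, with $\gamma^{M'}\circ\psi=(\psi\otimes\mathbb I_B)\circ\gamma^M$. The unit comodule is $\Bbbk$ with $\gamma^\Bbbk=\imath_B^{-1}\circ u_B$, and $M\otimes_{m_B}M'$ is $M\otimes M'$ with coaction $(\mathbb I\otimes m_B)\circ(\mathbb I\otimes\tau\otimes\mathbb I)\circ(\gamma^M\otimes\gamma^{M'})$. For $M$ finite dimensional, $M^\vee=\mathrm{Hom}(M,\Bbbk)$ has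 the coaction $h\mapsto\imath_B\circ(h\otimes\varsigma_B)\circ\gamma^M$ followed by the isomorphism $\mathrm{Hom}(M,B)\cong M^\vee\otimes B$ under which $h\otimes b$ corresponds to $x\mapsto(-1)^{|b||x|}h(x)b$. Put $\mathrm{ev}_M(h\otimes x)=h(x)$ and $\mathrm{cv}_M(1)=\sum_i x_i\otimes e^i$ for dual bases $(x_i),(e^i)$; $M$ is regarded as the dual of $M^\vee$ through $\mathrm{ev}_{M^\vee}=\mathrm{ev}_M\circ\tau$ and $\mathrm{cv}_{M^\vee}=\tau\circ\mathrm{cv}_M$. Let $B^*$ be the dg-comodule $B$ with coaction $\tau\circ(\varsigma_B\otimes\mathbb I_B)\circ\Delta_B$. Let $\omega$ be the forgetful functor from dg-comodules to complexes and $\omega_f$ its restriction to finite dimensional dg-comodules. An element of degree $n$ of $\mathrm{End}(\omega\otimes A)$ is a family of right $A$-linear maps $\eta^M:M\otimes A\to M\otimes A$ of degree $n$, one for each dg-comodule $M$, with $(\psi\otimes\mathbb I_A)\circ\eta^M=(-1)^{|\psi|n}\eta^{M'}\circ(\psi\otimes\mathbb I_A)$ for all homogeneous morphisms $\psi:M\to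 M'$; $\mathrm{End}(\omega\otimes A)$ consists of the finite sums of such families. For $A$-linear $\varphi,\varphi'$ put $\varphi\otimes_{m_A}\varphi'=(\mathbb I\otimes m_A)\circ(\mathbb I\otimes\tau\otimes\mathbb I)\circ(\mathfrak q(\varphi)\otimes\varphi')$ with $\mathfrak q(\varphi)=\varphi\circ(\mathbb I\otimes u_A)\circ\jmath^{-1}$. Let $Z^0\mathrm{End}_\otimes(\omega\otimes A)$ be the set of all $\eta$ of degree $0$ such that every $\eta^M$ commutes with the differential, $\eta^\Bbbk=\mathbb I$ and $\eta^{M\otimes_{m_B}M'}=\eta^M\otimes_{m_A}\eta^{M'}$. Define $\mathrm{End}(\omega_f\otimes A)$ and $Z^0\mathrm{End}_\otimes(\omega_f\otimes A)$ in the same way over the finite dimensional dg-comodules. For $\xi\in\mathrm{End}(\omega_f\otimes A)$ let $S(\xi)^M=(\xi^{M^\vee})^\vee$, where for $\varphi:N\otimes A\to N\otimes A$ (omitting unit isomorphisms) $$\varphi^\vee=\big((\mathrm{ev}_N\otimes\mathbb I_A)\otimes_{m_A}\mathbb I_{N^\vee\otimes A}\big)\circ\big(\mathbb I_{N^\vee\otimes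 A}\otimes_{m_A}\varphi\otimes_{m_A}\mathbb I_{N^\vee\otimes A}\big)\circ\big(\mathbb I_{N^\vee\otimes A}\otimes_{m_A}(\mathrm{cv}_N\otimes\mathbb I_A)\big).$$ For $\eta\in\mathrm{End}(\omega\otimes A)$ let $$\varsigma(\eta)^M=(\jmath_M\otimes\mathbb I_A)\circ(\mathbb I_M\otimes\epsilon_B\otimes\mathbb I_A)\circ(\mathbb I_M\otimes\eta^{B^*})\circ(\gamma^M\otimes\mathbb I_A),$$ and let $\mathrm{res}_A\eta$ be the restriction of $\eta$ to the finite dimensional dg-comodules. For $\xi\in\mathrm{End}(\omega_f\otimes A)$ let $\varinjlim_A\xi$ be the family of maps on all $M\otimes A$ that restricts to $\xi^N$ on $N\otimes A$ for every finite dimensional dg-subcomodule $N$ of $M$. Then: 1. If $\xi\in\mathrm{End}(\omega_f\otimes A)$, then $S(\xi)\in\mathrm{End}(\omega_f\otimes A)$, and $S(\xi)$ has degree $n$ if $\xi$ has degree $n$. 2. If $\xi\in Z^0\mathrm{End}_\otimes(\omega_f\otimes A)$, then $S(\xi)\in Z^0\mathrm{End}_\otimes(\omega_f\otimes A)$. 3.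 $Z^0\mathrm{End}_\otimes(\omega_f\otimes A)$ is a group under composition, with unit the identity family, in which the inverse of $\xi$ is $S(\xi)$. 4. For every $\xi\in\mathrm{End}(\omega_f\otimes A)$ the family $\varinjlim_A\xi$ exists, is unique and lies in $\mathrm{End}(\omega\otimes A)$, and $\varinjlim_A:\mathrm{End}(\omega_f\otimes A)\to\mathrm{End}(\omega\otimes A)$ and $\mathrm{res}_A$ are inverse to each other; for every $\eta\in\mathrm{End}(\omega\otimes A)$, $$\varsigma(\eta)=\varinjlim\nolimits_A S(\mathrm{res}_A\,\eta).$$ In particular, if $\eta\in Z^0\mathrm{End}_\otimes(\omega\otimes A)$, then $\mathrm{res}_A\eta\in Z^0\mathrm{End}_\otimes(\omega_f\otimes A)$, and $\varsigma(\eta)\in Z^0\mathrm{End}_\otimes(\omega\otimes A)$ is the inverse of $\eta$ under composition. -/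

import Mathlib

open TensorProduct

universe u v

noncomputable section

namespace DG

/-- Cochain complexes over `k`: a `ℤ`-graded space `V = ⨁ gr i` with a differential of degree `1`. -/
class DGModule (k : Type*) (V : Type*) [Field k] [AddCommGroup V] [Module k V] where
  gr : ℤ → Submodule k V
  internal : DirectSum.IsInternal gr
  d : V →ₗ[k] V
  d_mem : ∀ {i : ℤ} {x : V}, x ∈ gr i → d x ∈ gr (i + 1)
  d_d : ∀ x : V, d (d x) = 0

section Basic

variable (k : Type*) [Field k]

/-- The component of degree `n`. -/
abbrev gr (V : Type*) [AddCommGroup V] [Module k V] [DGModule k V] (n : ℤ) : Submodule k V :=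
  DGModule.gr n

/-- The differential. -/
abbrev dif (V : Type*) [AddCommGroup V] [Module k V] [DGModule k V] : V →ₗ[k] V :=
  DGModule.d

variable {k}
variable {V W X Y Z : Type*} [AddCommGroup V] [Module k V] [DGModule k V]
  [AddCommGroup W] [Module k W] [DGModule k W] [AddCommGroup X] [Module k X] [DGModule k X]
  [AddCommGroup Y] [Module k Y] [DGModule k Y] [AddCommGroup Z] [Module k Z]

/-- `f` is homogeneous of degree `n`. -/
def HasDeg (n : ℤ) (f : V →ₗ[k] W) : Prop :=
  ∀ ⦃i : ℤ⦄ ⦃x : V⦄, x ∈ gr k V i → f x ∈ gr k W (i + n)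

variable (k V) in
/-- The decomposition into homogeneous components. -/
def decomp : (DirectSum ℤ fun i => gr k V i) ≃ₗ[k] V :=
  LinearEquiv.ofBijective (DirectSum.coeLinearMap (gr k V)) DGModule.internal

theorem decomp_lof (i : ℤ) (x : gr k V i) :
    decomp k V (DirectSum.lof k ℤ (fun i => gr k V i) i x) = x := by
  exact DirectSum.coeLinearMap_lof (gr k V) i x

theorem decomp_symm_of_mem {i : ℤ} {x : V} (hx : x ∈ gr k V i) :
    (decomp k V).symm x = DirectSum.lof k ℤ (fun i => gr k V i) i ⟨x, hx⟩ := by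
  rw [LinearEquiv.symm_apply_eq, decomp_lof]

variable (k V W) in
/-- The Koszul symmetry `x ⊗ y ↦ (-1)^(|x||y|) y ⊗ x`. -/
def tau : V ⊗[k] W ≃ₗ[k] W ⊗[k] V :=
  (TensorProduct.congr (decomp k V) (decomp k W)).symm ≪≫ₗ
    TensorProduct.gradedComm k (fun i => gr k V i) (fun i => gr k W i) ≪≫ₗ
    TensorProduct.congr (decomp k W) (decomp k V)

theorem tau_tmul {i j : ℤ} {x : V} {y : W} (hx : x ∈ gr k V i) (hy : y ∈ gr k W j) :
    tau k V W (x ⊗ₜ y) = (-1 : k) ^ (i * j) • (y ⊗ₜ[k] x) := by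
  simp only [tau, LinearEquiv.trans_apply, TensorProduct.congr_symm_tmul, decomp_symm_of_mem hx,
    decomp_symm_of_mem hy, TensorProduct.gradedComm_of_tmul_of]
  rw [Units.smul_def, ← Int.cast_smul_eq_zsmul k, map_smul, TensorProduct.congr_tmul, decomp_lof,
    decomp_lof, mul_comm]
  congr 1
  generalize i * j = n
  rcases Int.even_or_odd n with hn | hn
  · simp [hn.neg_one_zpow]
  · simp [hn.neg_one_zpow]

theorem gr_iSup : (⨆ i, gr k V i) = ⊤ :=
  (DGModule.internal (k := k) (V := V)).submodule_iSup_eq_top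

theorem homog_induction {p : V → Prop} (h0 : p 0) (h : ∀ i x, x ∈ gr k V i → p x)
    (hadd : ∀ x y, p x → p y → p (x + y)) (x : V) : p x := by
  have hx : x ∈ ⨆ i, gr k V i := by rw [gr_iSup]; trivial
  exact Submodule.iSup_induction _ (motive := p) hx h h0 hadd

theorem hom_ext {f g : V →ₗ[k] Z} (h : ∀ i x, x ∈ gr k V i → f x = g x) : f = g := by
  ext x
  refine homog_induction (k := k) (p := fun x => f x = g x) (by simp) h ?_ x
  intro x y hx hy
  simp [hx, hy]

theorem tensor_ext {f g : V ⊗[k] W →ₗ[k] Z}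
    (h : ∀ i j x y, x ∈ gr k V i → y ∈ gr k W j → f (x ⊗ₜ y) = g (x ⊗ₜ y)) : f = g := by
  apply TensorProduct.ext
  refine hom_ext fun i x hx => hom_ext fun j y hy => h i j x y hx hy

theorem tau_tau (t : V ⊗[k] W) : tau k W V (tau k V W t) = t := by
  have : (tau k W V).toLinearMap ∘ₗ (tau k V W).toLinearMap = LinearMap.id := by
    refine tensor_ext fun i j x y hx hy => ?_
    simp only [LinearMap.comp_apply, LinearEquiv.coe_coe, tau_tmul hx hy, map_smul,
      tau_tmul hy hx, smul_smul, LinearMap.id_apply]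
    rw [← zpow_add₀ (by simp), Even.neg_one_zpow ⟨i * j, by ring⟩, one_smul]
  exact LinearMap.congr_fun this t

/-- projection onto the component of degree `i` -/
def proj (i : ℤ) : V →ₗ[k] V :=
  (gr k V i).subtype ∘ₗ DirectSum.component k ℤ (fun i => gr k V i) i ∘ₗ
    (decomp k V).symm.toLinearMap

theorem proj_mem (i : ℤ) (x : V) : proj (k := k) i x ∈ gr k V i := by
  simp [proj]

theorem proj_same {i : ℤ} {x : V} (hx : x ∈ gr k V i) : proj (k := k) i x = x := by
  simp [proj, decomp_symm_of_mem hx, DirectSum.component.lof_self]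

theorem proj_ne {i j : ℤ} {x : V} (hx : x ∈ gr k V i) (h : i ≠ j) : proj (k := k) j x = 0 := by
  simp [proj, decomp_symm_of_mem hx, DirectSum.component.of, h]

theorem isInternal_of_proj {U : Type*} [AddCommGroup U] [Module k U] (G : ℤ → Submodule k U)
    (htop : (⨆ i, G i) = ⊤) (P : ℤ → U →ₗ[k] U) (h1 : ∀ n, ∀ x ∈ G n, P n x = x)
    (h2 : ∀ m n, m ≠ n → ∀ x ∈ G m, P n x = 0) : DirectSum.IsInternal G := by
  rw [DirectSum.isInternal_submodule_iff_iSupIndep_and_iSup_eq_top]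
  refine ⟨fun n => ?_, htop⟩
  rw [Submodule.disjoint_def]
  intro x hx hx'
  rw [← h1 n x hx]
  have : (⨆ (j : ℤ) (_ : j ≠ n), G j) ≤ LinearMap.ker (P n) :=
    iSup₂_le fun j hj y hy => h2 j n hj y hy
  exact this hx'

variable (k V W) in
/-- The total grading on a tensor product. -/
def tensorGr (n : ℤ) : Submodule k (V ⊗[k] W) :=
  ⨆ p : {p : ℤ × ℤ // p.1 + p.2 = n},
    Submodule.map₂ (TensorProduct.mk k V W) (gr k V p.1.1) (gr k W p.1.2)

theorem tmul_mem_tensorGr {i j : ℤ} {x : V} {y : W} (hx : x ∈ gr k V i) (hy : y ∈ gr k W j) :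
    x ⊗ₜ y ∈ tensorGr k V W (i + j) := by
  have := Submodule.apply_mem_map₂ (TensorProduct.mk k V W) hx hy
  exact Submodule.mem_iSup_of_mem (⟨(i, j), rfl⟩ : {p : ℤ × ℤ // p.1 + p.2 = i + j}) this

theorem tensorGr_le {n : ℤ} {S : Submodule k (V ⊗[k] W)}
    (h : ∀ i j x y, i + j = n → x ∈ gr k V i → y ∈ gr k W j → x ⊗ₜ y ∈ S) :
    tensorGr k V W n ≤ S := by
  refine iSup_le fun p => ?_
  rw [Submodule.map₂_le]
  exact fun x hx y hy => h _ _ x y p.2 hx hy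

variable (k V W) in
def tensorProj (n : ℤ) : V ⊗[k] W →ₗ[k] V ⊗[k] W :=
  TensorProduct.lift
    (DirectSum.toModule k ℤ (W →ₗ[k] V ⊗[k] W)
      (fun i => LinearMap.lcomp k (V ⊗[k] W) (proj (k := k) (V := W) (n - i)) ∘ₗ
        TensorProduct.mk k V W ∘ₗ (gr k V i).subtype) ∘ₗ (decomp k V).symm.toLinearMap)

theorem tensorProj_tmul {i n : ℤ} {x : V} (hx : x ∈ gr k V i) (y : W) :
    tensorProj k V W n (x ⊗ₜ y) = x ⊗ₜ proj (k := k) (n - i) y := by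
  simp [tensorProj, decomp_symm_of_mem hx]

theorem tensorGr_internal : DirectSum.IsInternal (tensorGr k V W) := by
  refine isInternal_of_proj _ ?_ (tensorProj k V W) ?_ ?_
  · rw [eq_top_iff]
    rintro t -
    induction t using TensorProduct.induction_on with
    | zero => exact zero_mem _
    | add s t hs ht => exact add_mem hs ht
    | tmul x y =>
      refine homog_induction (k := k) (p := fun x => x ⊗ₜ[k] y ∈ ⨆ i, tensorGr k V W i)
        (by simp) ?_ ?_ x
      · intro i x hx
        refine homog_induction (k := k) (p := fun y => x ⊗ₜ[k] y ∈ ⨆ i, tensorGr k V W i)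
          (by simp) ?_ ?_ y
        · intro j y hy
          exact Submodule.mem_iSup_of_mem _ (tmul_mem_tensorGr hx hy)
        · intro a b ha hb
          rw [tmul_add]; exact add_mem ha hb
      · intro a b ha hb
        rw [add_tmul]; exact add_mem ha hb
  · intro n x hx
    have : tensorGr k V W n ≤ LinearMap.eqLocus (tensorProj k V W n) LinearMap.id := by
      refine tensorGr_le fun i j x y hij hx hy => ?_
      rw [LinearMap.mem_eqLocus, tensorProj_tmul hx, proj_same]
      · rfl
      · rwa [← hij, add_sub_cancel_left]
    exact this hx
  · intro m n hmn x hx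
    have : tensorGr k V W m ≤ LinearMap.ker (tensorProj k V W n) := by
      refine tensorGr_le fun i j x y hij hx hy => ?_
      rw [LinearMap.mem_ker, tensorProj_tmul hx, proj_ne hy, tmul_zero]
      omega
    exact this hx

variable (X) in
/-- `𝕀_X ⊗ g` with the Koszul sign: `x ⊗ y ↦ (-1)^(|g||x|) x ⊗ g y` for homogeneous `g`, `x`. -/
def lten (g : V →ₗ[k] W) : X ⊗[k] V →ₗ[k] X ⊗[k] W :=
  (tau k W X).toLinearMap ∘ₗ g.rTensor X ∘ₗ (tau k X V).toLinearMap

theorem neg_one_zpow_eq {a b : ℤ} (h : Even (a - b)) : (-1 : k) ^ a = (-1 : k) ^ b := by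
  have : a = (a - b) + b := by ring
  rw [this, zpow_add₀ (by simp), h.neg_one_zpow, one_mul]

theorem lten_tmul {n i : ℤ} {g : V →ₗ[k] W} (hg : HasDeg n g) {x : X} (hx : x ∈ gr k X i) (y : V) :
    lten X g (x ⊗ₜ y) = (-1 : k) ^ (n * i) • (x ⊗ₜ g y) := by
  refine homog_induction (k := k) (p := fun y => lten X g (x ⊗ₜ y) = (-1 : k) ^ (n * i) • (x ⊗ₜ g y))
    (by simp) ?_ ?_ y
  · intro j y hy
    simp only [lten, LinearMap.comp_apply, LinearEquiv.coe_coe, tau_tmul hx hy, map_smul,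
      LinearMap.rTensor_tmul, tau_tmul (hg hy) hx, smul_smul]
    congr 1
    rw [← zpow_add₀ (by simp)]
    exact neg_one_zpow_eq ⟨i * j, by ring⟩
  · intro a b ha hb
    simp only [tmul_add, map_add, ha, hb, smul_add]

theorem dif_deg : HasDeg 1 (dif k V) := fun _ _ hx => DGModule.d_mem hx

variable (k V W) in
def tensorDif : V ⊗[k] W →ₗ[k] V ⊗[k] W :=
  (dif k V).rTensor W + lten V (dif k W)

theorem tensorDif_tmul {i : ℤ} {x : V} (hx : x ∈ gr k V i) (y : W) :
    tensorDif k V W (x ⊗ₜ y) = dif k V x ⊗ₜ y + (-1 : k) ^ i • (x ⊗ₜ dif k W y) := by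
  simp [tensorDif, lten_tmul dif_deg hx]

/-- The tensor product of complexes: `d (x ⊗ y) = d x ⊗ y + (-1)^|x| x ⊗ d y`. -/
instance instTensor : DGModule k (V ⊗[k] W) where
  gr := tensorGr k V W
  internal := tensorGr_internal
  d := tensorDif k V W
  d_mem := by
    intro n t ht
    have : tensorGr k V W n ≤ (tensorGr k V W (n + 1)).comap (tensorDif k V W) := by
      refine tensorGr_le fun i j x y hij hx hy => ?_
      rw [Submodule.mem_comap, tensorDif_tmul hx]
      refine add_mem ?_ (Submodule.smul_mem _ _ ?_)
      · have := tmul_mem_tensorGr (DGModule.d_mem hx) hy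
        rwa [show i + 1 + j = n + 1 by omega] at this
      · have := tmul_mem_tensorGr hx (DGModule.d_mem hy)
        rwa [show i + (j + 1) = n + 1 by omega] at this
    exact this ht
  d_d := by
    intro t
    have : tensorDif k V W ∘ₗ tensorDif k V W = 0 := by
      refine tensor_ext fun i j x y hx hy => ?_
      simp only [LinearMap.comp_apply, tensorDif_tmul hx, map_add, map_smul,
        tensorDif_tmul (DGModule.d_mem hx), DGModule.d_d, zero_tmul, tmul_zero, smul_zero, zero_add,
        add_zero, LinearMap.zero_apply]
      rw [zpow_add₀ (by simp)]
      simp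
    exact LinearMap.congr_fun this t

/-- The ground field, concentrated in degree `0`. -/
instance instSelf : DGModule k k where
  gr n := if n = 0 then ⊤ else ⊥
  internal := by
    refine isInternal_of_proj _ ?_ (fun n => if n = 0 then LinearMap.id else 0) ?_ ?_
    · rw [eq_top_iff]
      exact le_trans (by simp) (le_iSup (fun n : ℤ => if n = 0 then (⊤ : Submodule k k) else ⊥) 0)
    · intro n x hx
      by_cases h : n = 0 <;> simp_all
    · intro m n h x hx
      by_cases h' : n = 0 <;> simp_all
  d := 0
  d_mem := by simp
  d_d := by simp

end Basic

section Chain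

variable {k : Type*} [Field k]
variable {V W X Y Z V' W' : Type*} [AddCommGroup V] [Module k V] [DGModule k V]
  [AddCommGroup W] [Module k W] [DGModule k W] [AddCommGroup X] [Module k X] [DGModule k X]
  [AddCommGroup Y] [Module k Y] [DGModule k Y] [AddCommGroup Z] [Module k Z]
  [AddCommGroup V'] [Module k V'] [DGModule k V'] [AddCommGroup W'] [Module k W'] [DGModule k W']

/-- Cochain maps: homogeneous of degree `0` and commuting with the differentials. -/
structure IsChain (f : V →ₗ[k] W) : Prop where
  deg : HasDeg 0 f
  comm : ∀ x, f (dif k V x) = dif k W (f x)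

theorem mem_tensor {i j n : ℤ} {x : V} {y : W} (hx : x ∈ gr k V i) (hy : y ∈ gr k W j)
    (h : i + j = n) : x ⊗ₜ[k] y ∈ gr k (V ⊗[k] W) n :=
  h ▸ tmul_mem_tensorGr hx hy

theorem tensor_induction {n : ℤ} {p : V ⊗[k] W → Prop} (h0 : p 0)
    (hadd : ∀ s t, p s → p t → p (s + t))
    (hsmul : ∀ (c : k) t, p t → p (c • t))
    (h : ∀ i j x y, i + j = n → x ∈ gr k V i → y ∈ gr k W j → p (x ⊗ₜ y))
    {t : V ⊗[k] W} (ht : t ∈ gr k (V ⊗[k] W) n) : p t := by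
  let S : Submodule k (V ⊗[k] W) :=
    { carrier := {t | p t}, zero_mem' := h0, add_mem' := fun {a b} ha hb => hadd a b ha hb
      smul_mem' := fun c x hx => hsmul c x hx }
  have : tensorGr k V W n ≤ S := tensorGr_le h
  exact this ht

theorem dif_tmul {i : ℤ} {x : V} (hx : x ∈ gr k V i) (y : W) :
    dif k (V ⊗[k] W) (x ⊗ₜ y) = dif k V x ⊗ₜ y + (-1 : k) ^ i • (x ⊗ₜ dif k W y) :=
  tensorDif_tmul hx y

theorem HasDeg.zero_mem {f : V →ₗ[k] W} (hf : HasDeg 0 f) {i : ℤ} {x : V} (hx : x ∈ gr k V i) :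
    f x ∈ gr k W i := by
  simpa using hf hx

theorem hasDeg_tensor {f : V ⊗[k] W →ₗ[k] X} {n : ℤ}
    (h : ∀ i j x y, x ∈ gr k V i → y ∈ gr k W j → f (x ⊗ₜ y) ∈ gr k X (i + j + n)) :
    HasDeg n f := by
  intro m t ht
  refine tensor_induction (p := fun t => f t ∈ gr k X (m + n)) (by simp) ?_ ?_ ?_ ht
  · intro s t hs ht
    rw [map_add]; exact add_mem hs ht
  · intro c t ht
    rw [map_smul]; exact Submodule.smul_mem _ _ ht
  · intro i j x y hij hx hy
    rw [← hij]; exact h i j x y hx hy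

theorem IsChain.of_tensor {f : V ⊗[k] W →ₗ[k] X}
    (h : ∀ i j x y, x ∈ gr k V i → y ∈ gr k W j → f (x ⊗ₜ y) ∈ gr k X (i + j))
    (hd : ∀ i j x y, x ∈ gr k V i → y ∈ gr k W j →
      f (dif k V x ⊗ₜ y) + (-1 : k) ^ i • f (x ⊗ₜ dif k W y) = dif k X (f (x ⊗ₜ y))) :
    IsChain f where
  deg := hasDeg_tensor fun i j x y hx hy => by rw [add_zero]; exact h i j x y hx hy
  comm t := by
    have : f ∘ₗ dif k (V ⊗[k] W) = dif k X ∘ₗ f := by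
      refine tensor_ext fun i j x y hx hy => ?_
      simp only [LinearMap.comp_apply, dif_tmul hx, map_add, map_smul]
      exact hd i j x y hx hy
    exact LinearMap.congr_fun this t

theorem IsChain.id : IsChain (LinearMap.id : V →ₗ[k] V) :=
  ⟨fun i x hx => by simpa using hx, fun _ => rfl⟩

theorem IsChain.comp {g : W →ₗ[k] X} {f : V →ₗ[k] W} (hg : IsChain g) (hf : IsChain f) :
    IsChain (g ∘ₗ f) :=
  ⟨fun i x hx => by
    rw [add_zero]; exact hg.deg.zero_mem (hf.deg.zero_mem hx),
   fun x => by simp [hf.comm, hg.comm]⟩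

theorem IsChain.map {f : V →ₗ[k] V'} {g : W →ₗ[k] W'} (hf : IsChain f) (hg : IsChain g) :
    IsChain (TensorProduct.map f g) := by
  refine IsChain.of_tensor (fun i j x y hx hy => ?_) (fun i j x y hx hy => ?_)
  · rw [map_tmul]
    exact mem_tensor (hf.deg.zero_mem hx) (hg.deg.zero_mem hy) rfl
  · simp only [map_tmul, dif_tmul (hf.deg.zero_mem hx), hf.comm, hg.comm]

theorem IsChain.rTensor {f : V →ₗ[k] V'} (hf : IsChain f) : IsChain (f.rTensor W) :=
  hf.map IsChain.id

theorem IsChain.lTensor {f : V →ₗ[k] V'} (hf : IsChain f) : IsChain (f.lTensor W) :=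
  IsChain.id.map hf

theorem IsChain.symm {e : V ≃ₗ[k] W} (he : IsChain e.toLinearMap) : IsChain e.symm.toLinearMap where
  deg := by
    intro i y hy
    rw [add_zero]
    have hP : ∀ j, proj (k := k) j (e (e.symm y)) = e (proj (k := k) j (e.symm y)) := by
      intro j
      generalize e.symm y = x
      refine homog_induction (k := k)
        (p := fun x => proj (k := k) j (e x) = e (proj (k := k) j x)) (by simp) ?_ ?_ x
      · intro i x hx
        have hex : e x ∈ gr k W i := he.deg.zero_mem hx
        by_cases h : i = j
        · subst h; rw [proj_same hx, proj_same hex]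
        · rw [proj_ne hx h, proj_ne hex h, map_zero]
      · intro a b ha hb
        simp [ha, hb]
    have := hP i
    rw [e.apply_symm_apply, proj_same hy] at this
    have h2 : e.symm y = proj (k := k) i (e.symm y) := by
      apply e.injective; rw [← this, e.apply_symm_apply]
    show e.symm y ∈ _
    rw [h2]
    exact proj_mem _ _
  comm x := by
    apply e.injective
    have := he.comm (e.symm x)
    simp only [LinearEquiv.coe_coe, LinearEquiv.apply_symm_apply] at this ⊢
    rw [this]

theorem IsChain.tau : IsChain (DG.tau k V W).toLinearMap := by
  refine IsChain.of_tensor (fun i j x y hx hy => ?_) (fun i j x y hx hy => ?_)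
  · rw [LinearEquiv.coe_coe, tau_tmul hx hy]
    exact Submodule.smul_mem _ _ (mem_tensor hy hx (add_comm _ _))
  · simp only [LinearEquiv.coe_coe, tau_tmul hx hy, tau_tmul (DGModule.d_mem hx) hy,
      tau_tmul hx (DGModule.d_mem hy), map_smul, dif_tmul hy, smul_add, smul_smul,
      ← zpow_add₀ (show (-1 : k) ≠ 0 by simp)]
    rw [add_comm]
    congr 2
    · exact neg_one_zpow_eq ⟨i, by ring⟩
    · congr 1; ring

theorem IsChain.assoc : IsChain (TensorProduct.assoc k V W X).toLinearMap := by
  refine ⟨?_, ?_⟩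
  · refine hasDeg_tensor fun i j t z ht hz => ?_
    refine tensor_induction (p := fun t => (TensorProduct.assoc k V W X).toLinearMap (t ⊗ₜ z) ∈
      gr k (V ⊗[k] (W ⊗[k] X)) (i + j + 0)) (by simp) ?_ ?_ ?_ ht
    · intro s t hs ht
      rw [add_tmul, map_add]; exact add_mem hs ht
    · intro c t ht
      rw [← smul_tmul', map_smul]; exact Submodule.smul_mem _ _ ht
    · intro a b x y hab hx hy
      simp only [LinearEquiv.coe_coe, assoc_tmul]
      exact mem_tensor hx (mem_tensor hy hz rfl) (by omega)
  · intro t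
    have : (TensorProduct.assoc k V W X).toLinearMap ∘ₗ dif k ((V ⊗[k] W) ⊗[k] X) =
        dif k (V ⊗[k] (W ⊗[k] X)) ∘ₗ (TensorProduct.assoc k V W X).toLinearMap := by
      apply TensorProduct.ext
      refine tensor_ext fun i j x y hx hy => LinearMap.ext fun z => ?_
      simp only [LinearMap.compr₂ₛₗ_apply, TensorProduct.mk_apply, LinearMap.comp_apply,
        LinearEquiv.coe_coe, assoc_tmul, dif_tmul hx, dif_tmul (mem_tensor hx hy rfl),
        dif_tmul hy, add_tmul, tmul_add, map_add, map_smul, smul_add, ← smul_tmul', tmul_smul,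
        smul_smul, ← zpow_add₀ (show (-1 : k) ≠ 0 by simp)]
      abel
    exact LinearMap.congr_fun this t

theorem one_mem_gr : (1 : k) ∈ gr k k 0 := by
  show (1 : k) ∈ (if (0 : ℤ) = 0 then (⊤ : Submodule k k) else ⊥)
  simp

theorem mem_gr_self_zero (c : k) : c ∈ gr k k 0 := by
  show c ∈ (if (0 : ℤ) = 0 then (⊤ : Submodule k k) else ⊥)
  simp

theorem eq_zero_of_mem_gr_self {i : ℤ} (hi : i ≠ 0) {c : k} (h : c ∈ gr k k i) : c = 0 := by
  have h' : c ∈ (if i = 0 then (⊤ : Submodule k k) else ⊥) := h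
  simpa [hi] using h'

theorem dif_self (c : k) : dif k k c = 0 := rfl

theorem tau_natural {f : V →ₗ[k] V'} {g : W →ₗ[k] W'} (hf : HasDeg 0 f) (hg : HasDeg 0 g)
    (t : V ⊗[k] W) : tau k V' W' (TensorProduct.map f g t) = TensorProduct.map g f (tau k V W t) := by
  have : (tau k V' W').toLinearMap ∘ₗ TensorProduct.map f g =
      TensorProduct.map g f ∘ₗ (tau k V W).toLinearMap := by
    refine tensor_ext fun i j x y hx hy => ?_
    simp [tau_tmul hx hy, tau_tmul (hf.zero_mem hx) (hg.zero_mem hy)]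
  exact LinearMap.congr_fun this t

variable (k V W X Y) in
/-- `𝕀 ⊗ τ ⊗ 𝕀`. -/
def swapMid : (V ⊗[k] W) ⊗[k] (X ⊗[k] Y) →ₗ[k] (V ⊗[k] X) ⊗[k] (W ⊗[k] Y) :=
  (TensorProduct.assoc k V X (W ⊗[k] Y)).symm.toLinearMap ∘ₗ
    LinearMap.lTensor V ((TensorProduct.assoc k X W Y).toLinearMap ∘ₗ
      LinearMap.rTensor Y (tau k W X).toLinearMap ∘ₗ
      (TensorProduct.assoc k W X Y).symm.toLinearMap) ∘ₗ
    (TensorProduct.assoc k V W (X ⊗[k] Y)).toLinearMap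

theorem swapMid_tmul {i j : ℤ} (v : V) {w : W} {x : X} (y : Y) (hw : w ∈ gr k W i)
    (hx : x ∈ gr k X j) :
    swapMid k V W X Y ((v ⊗ₜ w) ⊗ₜ (x ⊗ₜ y)) =
      (-1 : k) ^ (i * j) • ((v ⊗ₜ x) ⊗ₜ[k] (w ⊗ₜ[k] y)) := by
  simp [swapMid, tau_tmul hw hx, ← smul_tmul', tmul_smul]

theorem IsChain.swapMid : IsChain (DG.swapMid k V W X Y) := by
  unfold DG.swapMid
  exact IsChain.assoc.symm.comp ((IsChain.assoc.comp
    (IsChain.tau.rTensor.comp IsChain.assoc.symm)).lTensor.comp IsChain.assoc)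

end Chain

/-- Commutative dg algebras: the unit is `Algebra.linearMap`, the product is `LinearMap.mul'`. -/
class CDGAlgebra (k : Type*) (A : Type*) [Field k] [Ring A] [Algebra k A] [DGModule k A] :
    Prop where
  one_mem : (1 : A) ∈ gr k A 0
  mul_mem : ∀ {i j : ℤ} {x y : A}, x ∈ gr k A i → y ∈ gr k A j → x * y ∈ gr k A (i + j)
  dif_one : dif k A 1 = 0
  dif_mul : ∀ {i : ℤ} {x : A} (y : A), x ∈ gr k A i →
    dif k A (x * y) = dif k A x * y + (-1 : k) ^ i • (x * dif k A y)
  mul_comm : ∀ {i j : ℤ} {x y : A}, x ∈ gr k A i → y ∈ gr k A j →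
    x * y = (-1 : k) ^ (i * j) • (y * x)

section Alg

variable (k : Type*) [Field k] (A : Type*) [Ring A] [Algebra k A] [DGModule k A]

/-- The product `(m ⊗ m) ∘ (𝕀 ⊗ τ ⊗ 𝕀)` of the algebra `A ⊗ A`. -/
def mulTensor : (A ⊗[k] A) ⊗[k] (A ⊗[k] A) →ₗ[k] A ⊗[k] A :=
  TensorProduct.map (LinearMap.mul' k A) (LinearMap.mul' k A) ∘ₗ swapMid k A A A A

/-- `(𝕀 ⊗ m) ∘ (𝕀 ⊗ τ ⊗ 𝕀) : V ⊗ A ⊗ W ⊗ A → V ⊗ W ⊗ A`. -/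
def mulSwap (V W : Type*) [AddCommGroup V] [Module k V] [DGModule k V]
    [AddCommGroup W] [Module k W] [DGModule k W] :
    (V ⊗[k] A) ⊗[k] (W ⊗[k] A) →ₗ[k] (V ⊗[k] W) ⊗[k] A :=
  LinearMap.lTensor (V ⊗[k] W) (LinearMap.mul' k A) ∘ₗ swapMid k V A W A

end Alg

/-- Commutative dg Hopf algebras; the counit and coproduct are those of `Coalgebra k B`. -/
class CDGHopfAlgebra (k : Type*) (B : Type*) [Field k] [Ring B] [Algebra k B] [DGModule k B]
    [Coalgebra k B] extends CDGAlgebra k B where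
  counit_chain : IsChain (Coalgebra.counit (R := k) (A := B))
  comul_chain : IsChain (Coalgebra.comul (R := k) (A := B))
  counit_one : Coalgebra.counit (R := k) (1 : B) = 1
  counit_mul : ∀ x y : B, Coalgebra.counit (R := k) (x * y) =
    Coalgebra.counit (R := k) x * Coalgebra.counit (R := k) y
  comul_one : Coalgebra.comul (R := k) (1 : B) = 1 ⊗ₜ 1
  comul_mul : ∀ x y : B, Coalgebra.comul (R := k) (x * y) =
    mulTensor k B (Coalgebra.comul (R := k) x ⊗ₜ Coalgebra.comul (R := k) y)
  antipode : B →ₗ[k] B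
  antipode_chain : IsChain antipode
  mul_antipode_left : ∀ x : B,
    LinearMap.mul' k B (antipode.rTensor B (Coalgebra.comul (R := k) x)) =
      algebraMap k B (Coalgebra.counit (R := k) x)
  mul_antipode_right : ∀ x : B,
    LinearMap.mul' k B (antipode.lTensor B (Coalgebra.comul (R := k) x)) =
      algebraMap k B (Coalgebra.counit (R := k) x)

section Conv

variable {k : Type*} [Field k] {C D : Type*} [AddCommGroup C] [Module k C] [Coalgebra k C]
  [AddCommGroup D] [Module k D]

/-- Uniqueness of inverses for the convolution product. -/
theorem conv_unique (m : D ⊗[k] D →ₗ[k] D) (e : D)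
    (hassoc : ∀ x y z, m (m (x ⊗ₜ y) ⊗ₜ z) = m (x ⊗ₜ m (y ⊗ₜ z)))
    (hl : ∀ x, m (e ⊗ₜ x) = x) (hr : ∀ x, m (x ⊗ₜ e) = x) (L P R : C →ₗ[k] D)
    (hLP : ∀ c, m (TensorProduct.map L P (Coalgebra.comul (R := k) c)) =
      Coalgebra.counit (R := k) c • e)
    (hPR : ∀ c, m (TensorProduct.map P R (Coalgebra.comul (R := k) c)) =
      Coalgebra.counit (R := k) c • e) : L = R := by
  have hLP' : m ∘ₗ TensorProduct.map L P ∘ₗ Coalgebra.comul =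
      (LinearMap.toSpanSingleton k D e) ∘ₗ Coalgebra.counit := by
    ext c; simp [hLP]
  have hPR' : m ∘ₗ TensorProduct.map P R ∘ₗ Coalgebra.comul =
      (LinearMap.toSpanSingleton k D e) ∘ₗ Coalgebra.counit := by
    ext c; simp [hPR]
  have key : m ∘ₗ TensorProduct.map L (m ∘ₗ TensorProduct.map P R) ∘ₗ
      (TensorProduct.assoc k C C C).toLinearMap =
      m ∘ₗ TensorProduct.map (m ∘ₗ TensorProduct.map L P) R := by
    ext x y z
    simp [hassoc]
  ext c
  have h1 : m (TensorProduct.map L (m ∘ₗ TensorProduct.map P R ∘ₗ Coalgebra.comul)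
      (Coalgebra.comul (R := k) c)) =
      m (TensorProduct.map (m ∘ₗ TensorProduct.map L P ∘ₗ Coalgebra.comul) R
      (Coalgebra.comul (R := k) c)) := by
    have h2 := LinearMap.congr_fun key
      ((Coalgebra.comul (R := k) (A := C)).rTensor C (Coalgebra.comul (R := k) c))
    simp only [LinearMap.comp_apply, LinearEquiv.coe_coe, Coalgebra.coassoc_apply] at h2
    rw [LinearMap.lTensor, ← LinearMap.comp_apply (TensorProduct.map L _) (TensorProduct.map _ _),
      ← TensorProduct.map_comp, LinearMap.rTensor,
      ← LinearMap.comp_apply (TensorProduct.map _ R) (TensorProduct.map _ _),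
      ← TensorProduct.map_comp] at h2
    simpa only [LinearMap.comp_assoc, LinearMap.comp_id] using h2
  rw [hPR', hLP'] at h1
  have h3 : m ∘ₗ TensorProduct.map L (LinearMap.toSpanSingleton k D e ∘ₗ
      Coalgebra.counit (R := k) (A := C)) = L ∘ₗ (TensorProduct.rid k C).toLinearMap ∘ₗ
        LinearMap.lTensor C (Coalgebra.counit (R := k) (A := C)) := by
    ext x y
    simp [hr]
  have h4 : m ∘ₗ TensorProduct.map (LinearMap.toSpanSingleton k D e ∘ₗ
      Coalgebra.counit (R := k) (A := C)) R = R ∘ₗ (TensorProduct.lid k C).toLinearMap ∘ₗ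
        LinearMap.rTensor C (Coalgebra.counit (R := k) (A := C)) := by
    ext x y
    simp [← smul_tmul', hl]
  have h5 := LinearMap.congr_fun h3 (Coalgebra.comul (R := k) c)
  have h6 := LinearMap.congr_fun h4 (Coalgebra.comul (R := k) c)
  simp only [LinearMap.comp_apply] at h5 h6
  rw [h5, h6] at h1
  simpa using h1

end Conv

section Hopf

variable {k : Type*} [Field k] {A : Type*} [Ring A] [Algebra k A] [DGModule k A] [CDGAlgebra k A]

theorem mulTensor_tmul {i j : ℤ} (a : A) {b c : A} (d : A) (hb : b ∈ gr k A i)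
    (hc : c ∈ gr k A j) :
    mulTensor k A ((a ⊗ₜ b) ⊗ₜ (c ⊗ₜ d)) = (-1 : k) ^ (i * j) • ((a * c) ⊗ₜ[k] (b * d)) := by
  simp [mulTensor, swapMid_tmul a d hb hc]

theorem tensor_induction' {V W : Type*} [AddCommGroup V] [Module k V] [DGModule k V]
    [AddCommGroup W] [Module k W] [DGModule k W] {p : V ⊗[k] W → Prop} (h0 : p 0)
    (hadd : ∀ s t, p s → p t → p (s + t))
    (h : ∀ i j x y, x ∈ gr k V i → y ∈ gr k W j → p (x ⊗ₜ y)) (t : V ⊗[k] W) : p t := by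
  induction t using TensorProduct.induction_on with
  | zero => exact h0
  | add s t hs ht => exact hadd s t hs ht
  | tmul x y =>
    refine homog_induction (k := k) (p := fun x => p (x ⊗ₜ y)) (by simpa using h0) ?_ ?_ x
    · intro i x hx
      refine homog_induction (k := k) (p := fun y => p (x ⊗ₜ y)) (by simpa using h0) ?_ ?_ y
      · intro j y hy
        exact h i j x y hx hy
      · intro a b ha hb
        rw [tmul_add]; exact hadd _ _ ha hb
    · intro a b ha hb
      rw [add_tmul]; exact hadd _ _ ha hb

theorem mulTensor_assoc (x y z : A ⊗[k] A) :
    mulTensor k A (mulTensor k A (x ⊗ₜ y) ⊗ₜ z) = mulTensor k A (x ⊗ₜ mulTensor k A (y ⊗ₜ z)) := by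
  refine tensor_induction' (k := k) (p := fun x => mulTensor k A (mulTensor k A (x ⊗ₜ y) ⊗ₜ z) =
    mulTensor k A (x ⊗ₜ mulTensor k A (y ⊗ₜ z))) (by simp)
    (fun s t hs ht => by simp only [add_tmul, map_add, hs, ht]) ?_ x
  intro i₁ i₂ x₁ x₂ hx₁ hx₂
  refine tensor_induction' (k := k) (p := fun y =>
    mulTensor k A (mulTensor k A ((x₁ ⊗ₜ x₂) ⊗ₜ y) ⊗ₜ z) =
    mulTensor k A ((x₁ ⊗ₜ x₂) ⊗ₜ mulTensor k A (y ⊗ₜ z))) (by simp)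
    (fun s t hs ht => by simp only [add_tmul, tmul_add, map_add, hs, ht]) ?_ y
  intro j₁ j₂ y₁ y₂ hy₁ hy₂
  refine tensor_induction' (k := k) (p := fun z =>
    mulTensor k A (mulTensor k A ((x₁ ⊗ₜ x₂) ⊗ₜ (y₁ ⊗ₜ y₂)) ⊗ₜ z) =
    mulTensor k A ((x₁ ⊗ₜ x₂) ⊗ₜ mulTensor k A ((y₁ ⊗ₜ y₂) ⊗ₜ z))) (by simp)
    (fun s t hs ht => by simp only [tmul_add, map_add, hs, ht]) ?_ z
  intro l₁ l₂ z₁ z₂ hz₁ hz₂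
  rw [mulTensor_tmul _ _ hx₂ hy₁, mulTensor_tmul _ _ hy₂ hz₁, ← smul_tmul', map_smul,
    mulTensor_tmul _ _ (CDGAlgebra.mul_mem hx₂ hy₂) hz₁, tmul_smul, map_smul,
    mulTensor_tmul _ _ hx₂ (CDGAlgebra.mul_mem hy₁ hz₁), smul_smul, smul_smul,
    ← zpow_add₀ (by simp), ← zpow_add₀ (by simp), mul_assoc, mul_assoc]
  congr 2; ring

theorem mulTensor_one_left (x : A ⊗[k] A) : mulTensor k A ((1 ⊗ₜ 1) ⊗ₜ x) = x := by
  refine tensor_induction' (k := k) (p := fun x => mulTensor k A ((1 ⊗ₜ 1) ⊗ₜ x) = x) (by simp)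
    (fun s t hs ht => by simp only [tmul_add, map_add, hs, ht]) ?_ x
  intro i j x y hx hy
  rw [mulTensor_tmul _ _ CDGAlgebra.one_mem hx]
  simp

theorem mulTensor_one_right (x : A ⊗[k] A) : mulTensor k A (x ⊗ₜ (1 ⊗ₜ 1)) = x := by
  refine tensor_induction' (k := k) (p := fun x => mulTensor k A (x ⊗ₜ (1 ⊗ₜ 1)) = x) (by simp)
    (fun s t hs ht => by simp only [add_tmul, map_add, hs, ht]) ?_ x
  intro i j x y hx hy
  rw [mulTensor_tmul _ _ hy CDGAlgebra.one_mem]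
  simp

theorem IsChain.mul' : IsChain (LinearMap.mul' k A) := by
  refine IsChain.of_tensor (fun i j x y hx hy => ?_) (fun i j x y hx hy => ?_)
  · simpa using CDGAlgebra.mul_mem hx hy
  · simp [CDGAlgebra.dif_mul y hx]

theorem IsChain.mulSwap {V W : Type*} [AddCommGroup V] [Module k V] [DGModule k V]
    [AddCommGroup W] [Module k W] [DGModule k W] : IsChain (DG.mulSwap k A V W) :=
  IsChain.mul'.lTensor.comp IsChain.swapMid

theorem mulSwap_tmul {V W : Type*} [AddCommGroup V] [Module k V] [DGModule k V]
    [AddCommGroup W] [Module k W] [DGModule k W] {i j : ℤ} (v : V) {a : A} {w : W} (b : A)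
    (ha : a ∈ gr k A i) (hw : w ∈ gr k W j) :
    mulSwap k A V W ((v ⊗ₜ a) ⊗ₜ (w ⊗ₜ b)) =
      (-1 : k) ^ (i * j) • ((v ⊗ₜ w) ⊗ₜ[k] (a * b)) := by
  simp [mulSwap, swapMid_tmul v b ha hw]

variable {B : Type*} [Ring B] [Algebra k B] [DGModule k B] [Coalgebra k B] [CDGHopfAlgebra k B]

variable (k B) in
abbrev antipode : B →ₗ[k] B := CDGHopfAlgebra.antipode

theorem antipode_chain : IsChain (antipode k B) := CDGHopfAlgebra.antipode_chain

theorem counit_antipode (b : B) :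
    Coalgebra.counit (R := k) (antipode k B b) = Coalgebra.counit (R := k) b := by
  have h := congrArg (Coalgebra.counit (R := k)) (CDGHopfAlgebra.mul_antipode_left (k := k) b)
  rw [Algebra.algebraMap_eq_smul_one, map_smul, CDGHopfAlgebra.counit_one, smul_eq_mul,
    mul_one] at h
  have h1 : Coalgebra.counit (R := k) (A := B) ∘ₗ LinearMap.mul' k B ∘ₗ
      (antipode k B).rTensor B = Coalgebra.counit (R := k) (A := B) ∘ₗ antipode k B ∘ₗ
        (TensorProduct.rid k B).toLinearMap ∘ₗ LinearMap.lTensor B Coalgebra.counit := by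
    ext x y
    simp [CDGHopfAlgebra.counit_mul, mul_comm]
  have h2 := LinearMap.congr_fun h1 (Coalgebra.comul (R := k) b)
  simp only [LinearMap.comp_apply, Coalgebra.lTensor_counit_comul] at h2
  rw [← h, h2]
  simp

theorem antipode_comul (b : B) :
    Coalgebra.comul (R := k) (antipode k B b) =
      tau k B B (TensorProduct.map (antipode k B) (antipode k B) (Coalgebra.comul (R := k) b)) := by
  have key := conv_unique (C := B) (mulTensor k B) (1 ⊗ₜ 1) mulTensor_assoc mulTensor_one_left
    mulTensor_one_right (Coalgebra.comul (R := k) ∘ₗ antipode k B) (Coalgebra.comul (R := k))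
    ((tau k B B).toLinearMap ∘ₗ TensorProduct.map (antipode k B) (antipode k B) ∘ₗ
      Coalgebra.comul (R := k)) ?_ ?_
  · exact LinearMap.congr_fun key b
  · intro c
    have h1 : mulTensor k B ∘ₗ TensorProduct.map (Coalgebra.comul (R := k) ∘ₗ antipode k B)
        (Coalgebra.comul (R := k)) = Coalgebra.comul (R := k) ∘ₗ LinearMap.mul' k B ∘ₗ
          (antipode k B).rTensor B := by
      ext x y
      simp [CDGHopfAlgebra.comul_mul]
    have h2 := LinearMap.congr_fun h1 (Coalgebra.comul (R := k) c)
    simp only [LinearMap.comp_apply, CDGHopfAlgebra.mul_antipode_left] at h2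
    rw [h2, Algebra.algebraMap_eq_smul_one, map_smul, CDGHopfAlgebra.comul_one]
  · intro c
    let G : B ⊗[k] (B ⊗[k] B) →ₗ[k] B ⊗[k] B :=
      (LinearMap.mul' k B).rTensor B ∘ₗ (TensorProduct.assoc k B B B).symm.toLinearMap ∘ₗ
        LinearMap.lTensor B ((tau k B B).toLinearMap ∘ₗ LinearMap.lTensor B (antipode k B))
    let N : B ⊗[k] B →ₗ[k] B := LinearMap.mul' k B ∘ₗ (antipode k B).lTensor B
    have hF : mulTensor k B ∘ₗ LinearMap.lTensor (B ⊗[k] B)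
        ((tau k B B).toLinearMap ∘ₗ TensorProduct.map (antipode k B) (antipode k B)) ∘ₗ
        (TensorProduct.assoc k B B (B ⊗[k] B)).symm.toLinearMap ∘ₗ
        LinearMap.lTensor B (TensorProduct.assoc k B B B).toLinearMap =
        G ∘ₗ LinearMap.lTensor B (N.rTensor B) := by
      apply TensorProduct.ext
      refine hom_ext fun i a ha => ?_
      apply TensorProduct.ext
      refine tensor_ext fun j l b c hb hc => hom_ext fun m d hd => ?_
      have hc' := antipode_chain.deg.zero_mem hc
      have hd' := antipode_chain.deg.zero_mem hd
      simp only [LinearMap.compr₂ₛₗ_apply, TensorProduct.mk_apply, LinearMap.comp_apply,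
        LinearEquiv.coe_coe, assoc_tmul, LinearMap.lTensor_tmul, LinearMap.rTensor_tmul,
        assoc_symm_tmul, map_tmul, tau_tmul hc' hd', tmul_smul, map_smul,
        mulTensor_tmul _ _ hb hd', G, N, LinearMap.mul'_apply,
        tau_tmul (CDGAlgebra.mul_mem hb hc') hd', smul_smul, ← zpow_add₀ (show (-1 : k) ≠ 0 by simp)]
      congr 2; ring
    have hD : TensorProduct.map (Coalgebra.comul (R := k)) (Coalgebra.comul (R := k))
        (Coalgebra.comul (R := k) c) = (TensorProduct.assoc k B B (B ⊗[k] B)).symm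
          (LinearMap.lTensor B (TensorProduct.assoc k B B B).toLinearMap
          (LinearMap.lTensor B (LinearMap.rTensor B (Coalgebra.comul (R := k)) ∘ₗ
            Coalgebra.comul (R := k)) (Coalgebra.comul (R := k) c))) := by
      rw [← LinearMap.comp_apply (LinearMap.lTensor B _) (LinearMap.lTensor B _),
        ← LinearMap.lTensor_comp, Coalgebra.coassoc, LinearMap.lTensor_comp, LinearMap.comp_apply,
        ← Coalgebra.coassoc_apply]
      generalize Coalgebra.comul (R := k) c = t
      induction t using TensorProduct.induction_on with
      | zero => simp
      | add s t hs ht => simp only [map_add, hs, ht]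
      | tmul x y =>
        simp only [map_tmul, LinearMap.rTensor_tmul]
        generalize Coalgebra.comul (R := k) x = s
        induction s using TensorProduct.induction_on with
        | zero => simp
        | add s t hs ht => simp only [map_add, add_tmul, hs, ht]
        | tmul x y => simp
    have hsplit : ∀ t : B ⊗[k] B, mulTensor k B (TensorProduct.map (Coalgebra.comul (R := k))
        ((tau k B B).toLinearMap ∘ₗ TensorProduct.map (antipode k B) (antipode k B) ∘ₗ
        Coalgebra.comul (R := k)) t) = mulTensor k B (LinearMap.lTensor (B ⊗[k] B)
        ((tau k B B).toLinearMap ∘ₗ TensorProduct.map (antipode k B) (antipode k B))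
        (TensorProduct.map (Coalgebra.comul (R := k)) (Coalgebra.comul (R := k)) t)) := by
      intro t
      induction t using TensorProduct.induction_on with
      | zero => simp
      | add s t hs ht => simp only [map_add, hs, ht]
      | tmul x y => simp
    rw [hsplit, hD]
    have h3 := LinearMap.congr_fun hF (LinearMap.lTensor B (LinearMap.rTensor B
      (Coalgebra.comul (R := k)) ∘ₗ Coalgebra.comul (R := k)) (Coalgebra.comul (R := k) c))
    simp only [LinearMap.comp_apply, LinearEquiv.coe_coe] at h3
    rw [h3, ← LinearMap.comp_apply (LinearMap.lTensor B _) (LinearMap.lTensor B _),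
      ← LinearMap.lTensor_comp, ← LinearMap.comp_assoc, ← LinearMap.rTensor_comp]
    have h4 : (LinearMap.rTensor B (N ∘ₗ Coalgebra.comul (R := k)) ∘ₗ Coalgebra.comul (R := k)) =
        TensorProduct.mk k B B 1 := by
      have : N ∘ₗ Coalgebra.comul (R := k) = Algebra.linearMap k B ∘ₗ Coalgebra.counit := by
        ext x
        exact CDGHopfAlgebra.mul_antipode_right x
      rw [this, LinearMap.rTensor_comp, LinearMap.comp_assoc]
      ext x
      simp
    rw [h4]
    have h5 : G ∘ₗ LinearMap.lTensor B (TensorProduct.mk k B B 1) =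
        (TensorProduct.mk k B B).flip 1 ∘ₗ N := by
      refine tensor_ext fun i j x y hx hy => ?_
      simp [G, N, tau_tmul CDGAlgebra.one_mem (antipode_chain.deg.zero_mem hy)]
    have h6 := LinearMap.congr_fun h5 (Coalgebra.comul (R := k) c)
    simp only [LinearMap.comp_apply, N, CDGHopfAlgebra.mul_antipode_right] at h6
    rw [h6]
    simp [Algebra.algebraMap_eq_smul_one]

end Hopf

section Dual

variable {k : Type*} [Field k]
variable {M : Type*} [AddCommGroup M] [Module k M] [DGModule k M]
variable {U U' : Type*} [AddCommGroup U] [Module k U] [DGModule k U]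
  [AddCommGroup U'] [Module k U'] [DGModule k U']

variable (k M) in
/-- The sign operator `x ↦ (-1)^|x| x`. -/
def parity : M →ₗ[k] M :=
  DirectSum.toModule k ℤ M (fun i => (-1 : k) ^ i • (gr k M i).subtype) ∘ₗ
    (decomp k M).symm.toLinearMap

theorem parity_of_mem {i : ℤ} {x : M} (hx : x ∈ gr k M i) : parity k M x = (-1 : k) ^ i • x := by
  simp [parity, decomp_symm_of_mem hx]

variable (k M) in
/-- The degree `n` part of the graded dual: functionals vanishing outside of degree `-n`. -/
def dualGr (n : ℤ) : Submodule k (Module.Dual k M) where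
  carrier := {h | ∀ i x, x ∈ gr k M i → i + n ≠ 0 → h x = 0}
  zero_mem' := by simp
  add_mem' := by
    intro f g hf hg i x hx hi
    simp [hf i x hx hi, hg i x hx hi]
  smul_mem' := by
    intro c f hf i x hx hi
    simp [hf i x hx hi]

theorem dualGr_comp_proj (h : Module.Dual k M) (n : ℤ) :
    h ∘ₗ proj (k := k) (-n) ∈ dualGr k M n := by
  intro i x hx hi
  rw [LinearMap.comp_apply, proj_ne hx (by omega), map_zero]

theorem dualGr_internal [Module.Finite k M] : DirectSum.IsInternal (dualGr k M) := by
  refine isInternal_of_proj _ ?_ (fun n => LinearMap.lcomp k k (proj (k := k) (V := M) (-n))) ?_ ?_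
  · rw [eq_top_iff]
    rintro h -
    have hfin : {i | gr k M i ≠ ⊥}.Finite :=
      WellFoundedGT.finite_ne_bot_of_iSupIndep
        (DGModule.internal (k := k) (V := M)).submodule_iSupIndep
    have hs : h = ∑ i ∈ hfin.toFinset, h ∘ₗ proj (k := k) i := by
      refine hom_ext fun i x hx => ?_
      rw [LinearMap.sum_apply]
      by_cases hi : gr k M i = ⊥
      · have : x = 0 := by simpa [hi] using hx
        simp [this]
      · rw [Finset.sum_eq_single i]
        · rw [LinearMap.comp_apply, proj_same hx]
        · intro j _ hj
          rw [LinearMap.comp_apply, proj_ne hx (Ne.symm hj), map_zero]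
        · intro h'
          exact absurd (hfin.mem_toFinset.mpr hi) h'
    rw [hs]
    refine sum_mem fun i _ => Submodule.mem_iSup_of_mem (-i) ?_
    have := dualGr_comp_proj h (-i)
    rwa [neg_neg] at this
  · intro n h hh
    refine hom_ext fun i x hx => ?_
    rw [LinearMap.lcomp_apply]
    by_cases hi : i = -n
    · subst hi; rw [proj_same hx]
    · rw [proj_ne hx hi, map_zero, hh i x hx (by omega)]
  · intro m n hmn h hh
    refine hom_ext fun i x hx => ?_
    rw [LinearMap.lcomp_apply, LinearMap.zero_apply]
    by_cases hi : i = -n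
    · subst hi; rw [proj_same hx, hh _ x hx (by omega)]
    · rw [proj_ne hx hi, map_zero]

/-- The dual complex `Hom(M, k)`: `(d h)(x) = (-1)^|x| h (d x)`, i.e. `d h = -(-1)^|h| h ∘ d`. -/
instance instDual [Module.Finite k M] : DGModule k (Module.Dual k M) where
  gr := dualGr k M
  internal := dualGr_internal
  d := LinearMap.lcomp k k (dif k M ∘ₗ parity k M)
  d_mem := by
    intro n h hh i x hx hi
    simp only [LinearMap.lcomp_apply, LinearMap.comp_apply, parity_of_mem hx, map_smul]
    rw [hh _ _ (DGModule.d_mem hx) (by omega), smul_zero]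
  d_d := by
    intro h
    refine hom_ext fun i x hx => ?_
    simp [parity_of_mem hx, parity_of_mem (DGModule.d_mem hx), DGModule.d_d]

variable [Module.Finite k M]

theorem dif_dual {h : Module.Dual k M} {i : ℤ} {x : M} (hx : x ∈ gr k M i) :
    dif k (Module.Dual k M) h x = (-1 : k) ^ i • h (dif k M x) := by
  show (LinearMap.lcomp k k (dif k M ∘ₗ parity k M)) h x = _
  simp [parity_of_mem hx]

theorem dif_dual_eq {n : ℤ} {h : Module.Dual k M} (hh : h ∈ gr k (Module.Dual k M) n) :
    dif k (Module.Dual k M) h = -((-1 : k) ^ n • h ∘ₗ dif k M) := by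
  refine hom_ext fun i x hx => ?_
  rw [dif_dual hx]
  by_cases hi : i + 1 + n = 0
  · simp only [LinearMap.neg_apply, LinearMap.smul_apply, LinearMap.comp_apply]
    rw [neg_one_zpow_eq (a := i) (b := n + 1) ⟨-n - 1, by omega⟩, zpow_add₀ (by simp)]
    simp
  · have : h (dif k M x) = 0 := hh _ _ (DGModule.d_mem hx) hi
    simp [this]

theorem dual_eval_zero {n i : ℤ} {h : Module.Dual k M} (hh : h ∈ gr k (Module.Dual k M) n) {x : M}
    (hx : x ∈ gr k M i) (hi : i + n ≠ 0) : h x = 0 := hh i x hx hi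

variable (k M U) in
/-- The isomorphism `Hom(M, U) ≅ M^∨ ⊗ U` of graded spaces, under which `h ⊗ u` corresponds to
`x ↦ (-1)^(|u||x|) h(x) u`. -/
def homDual : (M →ₗ[k] U) ≃ₗ[k] Module.Dual k M ⊗[k] U :=
  (dualTensorHomEquiv k M U).symm ≪≫ₗ TensorProduct.comm k (Module.Dual k M) U ≪≫ₗ
    tau k U (Module.Dual k M)

variable (k M U) in
/-- The inverse of `homDual`. -/
def pair : Module.Dual k M ⊗[k] U →ₗ[k] (M →ₗ[k] U) := (homDual k M U).symm.toLinearMap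

theorem tau_symm_apply {V W : Type*} [AddCommGroup V] [Module k V] [DGModule k V]
    [AddCommGroup W] [Module k W] [DGModule k W] (t : W ⊗[k] V) :
    (tau k V W).symm t = tau k W V t := by
  rw [LinearEquiv.symm_apply_eq, tau_tau]

theorem pair_tmul {i j : ℤ} {h : Module.Dual k M} {b : U} (hh : h ∈ gr k (Module.Dual k M) i)
    (hb : b ∈ gr k U j) (x : M) :
    pair k M U (h ⊗ₜ b) x = (-1 : k) ^ (i * j) • h x • b := by
  simp only [pair, homDual, LinearEquiv.coe_coe, LinearEquiv.trans_symm, LinearEquiv.trans_apply,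
    LinearEquiv.symm_symm]
  rw [tau_symm_apply, tau_tmul hh hb, map_smul, TensorProduct.comm_symm_tmul, map_smul,
    LinearMap.smul_apply]
  rfl

theorem pair_lTensor {f : U →ₗ[k] U'} (hf : HasDeg 0 f) (t : Module.Dual k M ⊗[k] U) (x : M) :
    pair k M U' (f.lTensor _ t) x = f (pair k M U t x) := by
  refine tensor_induction' (k := k) (p := fun t => pair k M U' (f.lTensor _ t) x =
    f (pair k M U t x)) (by simp) (fun s t hs ht => by simp [hs, ht]) ?_ t
  intro i j h b hh hb
  rw [LinearMap.lTensor_tmul, pair_tmul hh (hf.zero_mem hb), pair_tmul hh hb, map_smul, map_smul]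

theorem pair_proj (t : Module.Dual k M ⊗[k] U) (m : ℤ) {i : ℤ} {x : M} (hx : x ∈ gr k M i) :
    pair k M U (proj (k := k) m t) x = proj (k := k) (i + m) (pair k M U t x) := by
  refine tensor_induction' (k := k) (p := fun t => pair k M U (proj (k := k) m t) x =
    proj (k := k) (i + m) (pair k M U t x)) (by simp) (fun s t hs ht => by simp [hs, ht]) ?_ t
  intro a j h b hh hb
  rw [pair_tmul hh hb, map_smul, map_smul]
  by_cases hm : a + j = m
  · rw [proj_same (mem_tensor hh hb hm), pair_tmul hh hb]
    by_cases hi : i + a = 0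
    · rw [show i + m = j by omega, proj_same hb]
    · simp [dual_eval_zero hh hx hi]
  · rw [proj_ne (mem_tensor hh hb rfl) hm]
    by_cases hi : i + a = 0
    · rw [proj_ne hb (show j ≠ i + m by omega)]; simp
    · simp [dual_eval_zero hh hx hi]

theorem mem_of_proj {V : Type*} [AddCommGroup V] [Module k V] [DGModule k V] {n : ℤ} {x : V}
    (h : ∀ m, m ≠ n → proj (k := k) m x = 0) : x ∈ gr k V n := by
  have h2 : (decomp k V).symm x = DirectSum.lof k ℤ (fun i => gr k V i) n
      ((decomp k V).symm x n) := by
    refine DFinsupp.ext fun m => ?_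
    by_cases hm : m = n
    · subst hm
      exact (DirectSum.component.lof_self (R := k) (M := fun i => gr k V i) m _).symm
    · have h1 : (decomp k V).symm x m = 0 := Subtype.ext (h m hm)
      rw [h1]
      exact ((DirectSum.component.of (R := k) (M := fun i => gr k V i) m n _).trans
        (dif_neg (Ne.symm hm))).symm
  rw [← (decomp k V).apply_symm_apply x, h2, decomp_lof]
  exact Subtype.mem _

theorem homDual_mem {n : ℤ} {l : M →ₗ[k] U} (hl : HasDeg n l) :
    homDual k M U l ∈ gr k (Module.Dual k M ⊗[k] U) n := by
  refine mem_of_proj fun m hm => ?_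
  apply (homDual k M U).symm.injective
  rw [map_zero]
  refine hom_ext fun i x hx => ?_
  have h := pair_proj (homDual k M U l) m hx
  simp only [pair, LinearEquiv.coe_coe, LinearEquiv.symm_apply_apply] at h
  rw [h, LinearMap.zero_apply, proj_ne (hl hx) (by omega)]

theorem pair_dif {n : ℤ} {t : Module.Dual k M ⊗[k] U} (ht : t ∈ gr k _ n) (x : M) :
    pair k M U (dif k _ t) x =
      dif k U (pair k M U t x) - (-1 : k) ^ n • pair k M U t (dif k M x) := by
  refine tensor_induction (p := fun t => pair k M U (dif k _ t) x =
      dif k U (pair k M U t x) - (-1 : k) ^ n • pair k M U t (dif k M x)) (by simp) ?_ ?_ ?_ ht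
  · intro s t hs ht
    simp only [map_add, LinearMap.add_apply, hs, ht, smul_add]; abel
  · intro c t ht
    simp only [map_smul, LinearMap.smul_apply, ht, smul_sub]
    rw [smul_comm]
  · intro i j h b hij hh hb
    rw [dif_tmul hh, map_add, LinearMap.add_apply, pair_tmul (DGModule.d_mem hh) hb, map_smul,
      LinearMap.smul_apply, pair_tmul hh (DGModule.d_mem hb), pair_tmul hh hb, pair_tmul hh hb,
      dif_dual_eq hh]
    simp only [LinearMap.neg_apply, LinearMap.smul_apply, LinearMap.comp_apply, map_smul,
      neg_smul, smul_neg, smul_smul, smul_eq_mul]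
    rw [add_comm, sub_eq_add_neg, ← mul_assoc, ← mul_assoc, ← mul_assoc,
      ← zpow_add₀ (show (-1 : k) ≠ 0 by simp), ← zpow_add₀ (show (-1 : k) ≠ 0 by simp),
      ← zpow_add₀ (show (-1 : k) ≠ 0 by simp), neg_one_zpow_eq (a := i + i * (j + 1)) (b := i * j)
        ⟨i, by ring⟩, neg_one_zpow_eq (a := (i + 1) * j + i) (b := n + i * j) ⟨0, by rw [← hij]; ring⟩]

end Dual

/-- Right dg-comodules over `B`. -/
structure DGComodule (k B : Type u) [Field k] [Ring B] [Algebra k B] [DGModule k B]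
    [Coalgebra k B] where
  carrier : Type u
  [addCommGroup : AddCommGroup carrier]
  [module : Module k carrier]
  [dgModule : DGModule k carrier]
  coact : carrier →ₗ[k] carrier ⊗[k] B
  coact_chain : IsChain coact
  coassoc : ∀ x, TensorProduct.assoc k carrier B B (coact.rTensor B (coact x)) =
    (Coalgebra.comul (R := k) (A := B)).lTensor carrier (coact x)
  counit : ∀ x, (Coalgebra.counit (R := k) (A := B)).lTensor carrier (coact x) = x ⊗ₜ 1

attribute [instance] DGComodule.addCommGroup DGComodule.module DGComodule.dgModule

namespace DGComodule

variable {k B : Type u} [Field k] [Ring B] [Algebra k B] [DGModule k B] [Coalgebra k B]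

instance : CoeSort (DGComodule k B) (Type u) := ⟨DGComodule.carrier⟩

variable [CDGHopfAlgebra k B]

variable (k B) in
/-- The unit comodule `k`, with coaction `1 ↦ 1 ⊗ 1`. -/
abbrev unit : DGComodule k B where
  carrier := k
  coact := (TensorProduct.lid k B).symm.toLinearMap ∘ₗ Algebra.linearMap k B
  coact_chain := by
    refine ⟨fun i x hx => ?_, fun x => ?_⟩
    · by_cases hi : i = 0
      · subst hi
        simp only [LinearMap.comp_apply, LinearEquiv.coe_coe, TensorProduct.lid_symm_apply,
          Algebra.linearMap_apply, Algebra.algebraMap_eq_smul_one]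
        exact mem_tensor one_mem_gr (Submodule.smul_mem _ _ CDGAlgebra.one_mem) (by simp)
      · rw [eq_zero_of_mem_gr_self hi hx, map_zero]; exact zero_mem _
    · simp only [LinearMap.comp_apply, LinearEquiv.coe_coe, TensorProduct.lid_symm_apply,
          Algebra.linearMap_apply, Algebra.algebraMap_eq_smul_one, dif_self, dif_tmul one_mem_gr,
          map_smul, CDGAlgebra.dif_one]
      simp
  coassoc x := by
    simp [Algebra.algebraMap_eq_smul_one, CDGHopfAlgebra.comul_one]
  counit x := by
    simp [Algebra.algebraMap_eq_smul_one, CDGHopfAlgebra.counit_one]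
    rw [smul_tmul', smul_eq_mul, mul_one]

/-- The coaction `(𝕀 ⊗ m) ∘ (𝕀 ⊗ τ ⊗ 𝕀) ∘ (γ ⊗ γ)` on a tensor product. -/
def tensorCoact (M N : DGComodule k B) : M ⊗[k] N →ₗ[k] (M ⊗[k] N) ⊗[k] B :=
  mulSwap k B M N ∘ₗ TensorProduct.map M.coact N.coact

theorem tensor_coassoc_aux (M N : DGComodule k B) (t : (M ⊗[k] B) ⊗[k] (N ⊗[k] B)) :
    TensorProduct.assoc k (M ⊗[k] N) B B
      ((tensorCoact M N).rTensor B (mulSwap k B M N t)) =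
    (mulTensor k B).lTensor (M ⊗[k] N) (swapMid k M (B ⊗[k] B) N (B ⊗[k] B)
      (TensorProduct.map ((TensorProduct.assoc k M B B).toLinearMap ∘ₗ M.coact.rTensor B)
        ((TensorProduct.assoc k N B B).toLinearMap ∘ₗ N.coact.rTensor B) t)) := by
  suffices key : (TensorProduct.assoc k (M ⊗[k] N) B B).toLinearMap ∘ₗ
      (tensorCoact M N).rTensor B ∘ₗ mulSwap k B M N =
      (mulTensor k B).lTensor (M ⊗[k] N) ∘ₗ swapMid k M (B ⊗[k] B) N (B ⊗[k] B) ∘ₗ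
      TensorProduct.map ((TensorProduct.assoc k M B B).toLinearMap ∘ₗ M.coact.rTensor B)
        ((TensorProduct.assoc k N B B).toLinearMap ∘ₗ N.coact.rTensor B) from
    LinearMap.congr_fun key t
  apply TensorProduct.ext
  refine tensor_ext fun i b m β hm hβ => tensor_ext fun j c n γ hn hγ => ?_
  simp only [LinearMap.compr₂ₛₗ_apply, TensorProduct.mk_apply, LinearMap.comp_apply,
    LinearEquiv.coe_coe, mulSwap_tmul _ _ hβ hn, map_smul, LinearMap.rTensor_tmul, map_tmul,
    tensorCoact]
  have hγn : N.coact n ∈ gr k (N ⊗[k] B) j := N.coact_chain.deg.zero_mem hn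
  generalize M.coact m = s
  generalize N.coact n = t at hγn
  refine tensor_induction' (k := k) (p := fun s => (-1 : k) ^ (b * j) •
    TensorProduct.assoc k (M ⊗[k] N) B B (mulSwap k B M N (s ⊗ₜ t) ⊗ₜ (β * γ)) =
    (mulTensor k B).lTensor (M ⊗[k] N) (swapMid k M (B ⊗[k] B) N (B ⊗[k] B)
      (TensorProduct.assoc k M B B (s ⊗ₜ β) ⊗ₜ TensorProduct.assoc k N B B (t ⊗ₜ γ))))
      (by simp) (fun x y hx hy => by simp only [add_tmul, map_add, smul_add, hx, hy]) ?_ s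
  intro i' a m' x hm' hx
  refine tensor_induction (p := fun t => (-1 : k) ^ (b * j) •
    TensorProduct.assoc k (M ⊗[k] N) B B (mulSwap k B M N ((m' ⊗ₜ x) ⊗ₜ t) ⊗ₜ (β * γ)) =
    (mulTensor k B).lTensor (M ⊗[k] N) (swapMid k M (B ⊗[k] B) N (B ⊗[k] B)
      (TensorProduct.assoc k M B B ((m' ⊗ₜ x) ⊗ₜ β) ⊗ₜ TensorProduct.assoc k N B B (t ⊗ₜ γ))))
      (by simp) (fun x y hx hy => by simp only [add_tmul, tmul_add, map_add, smul_add, hx, hy]) ?_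
      ?_ hγn
  · intro c t ht
    simp only [← smul_tmul', tmul_smul, map_smul]
    rw [smul_comm, ht]
  · intro j' e n' y hje hn' hy
    rw [mulSwap_tmul _ _ hx hn', ← smul_tmul', map_smul, assoc_tmul, assoc_tmul, assoc_tmul,
      swapMid_tmul _ _ (mem_tensor hx hβ rfl) hn', map_smul, LinearMap.lTensor_tmul,
      mulTensor_tmul _ _ hβ hy, tmul_smul, smul_smul, smul_smul, ← zpow_add₀ (by simp),
      ← zpow_add₀ (by simp), ← hje]
    congr 2; ring

theorem tensor_comul_aux (M N : DGComodule k B) (t : (M ⊗[k] B) ⊗[k] (N ⊗[k] B)) :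
    (Coalgebra.comul (R := k) (A := B)).lTensor (M ⊗[k] N) (mulSwap k B M N t) =
    (mulTensor k B).lTensor (M ⊗[k] N) (swapMid k M (B ⊗[k] B) N (B ⊗[k] B)
      (TensorProduct.map ((Coalgebra.comul (R := k) (A := B)).lTensor M)
        ((Coalgebra.comul (R := k) (A := B)).lTensor N) t)) := by
  suffices key : (Coalgebra.comul (R := k) (A := B)).lTensor (M ⊗[k] N) ∘ₗ mulSwap k B M N =
      (mulTensor k B).lTensor (M ⊗[k] N) ∘ₗ swapMid k M (B ⊗[k] B) N (B ⊗[k] B) ∘ₗ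
      TensorProduct.map ((Coalgebra.comul (R := k) (A := B)).lTensor M)
        ((Coalgebra.comul (R := k) (A := B)).lTensor N) from LinearMap.congr_fun key t
  apply TensorProduct.ext
  refine tensor_ext fun i b m β hm hβ => tensor_ext fun j c n γ hn hγ => ?_
  simp only [LinearMap.compr₂ₛₗ_apply, TensorProduct.mk_apply, LinearMap.comp_apply,
    mulSwap_tmul _ _ hβ hn, map_smul, map_tmul, LinearMap.lTensor_tmul,
    swapMid_tmul _ _ ((CDGHopfAlgebra.comul_chain (k := k) (B := B)).deg.zero_mem hβ) hn,
    CDGHopfAlgebra.comul_mul]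

theorem tensor_counit_aux (M N : DGComodule k B) (t : (M ⊗[k] B) ⊗[k] (N ⊗[k] B)) :
    (Coalgebra.counit (R := k) (A := B)).lTensor (M ⊗[k] N) (mulSwap k B M N t) =
      (TensorProduct.rid k (M ⊗[k] N)).symm (TensorProduct.map
        ((TensorProduct.rid k M).toLinearMap ∘ₗ (Coalgebra.counit (R := k) (A := B)).lTensor M)
        ((TensorProduct.rid k N).toLinearMap ∘ₗ (Coalgebra.counit (R := k) (A := B)).lTensor N)
        t) := by
  suffices key : (Coalgebra.counit (R := k) (A := B)).lTensor (M ⊗[k] N) ∘ₗ mulSwap k B M N =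
      (TensorProduct.rid k (M ⊗[k] N)).symm.toLinearMap ∘ₗ (TensorProduct.map
        ((TensorProduct.rid k M).toLinearMap ∘ₗ (Coalgebra.counit (R := k) (A := B)).lTensor M)
        ((TensorProduct.rid k N).toLinearMap ∘ₗ
          (Coalgebra.counit (R := k) (A := B)).lTensor N)) from LinearMap.congr_fun key t
  apply TensorProduct.ext
  refine tensor_ext fun i b m β hm hβ => tensor_ext fun j c n γ hn hγ => ?_
  simp only [LinearMap.compr₂ₛₗ_apply, TensorProduct.mk_apply, LinearMap.comp_apply,
    mulSwap_tmul _ _ hβ hn, map_smul, map_tmul, LinearMap.lTensor_tmul, LinearEquiv.coe_coe,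
    TensorProduct.rid_tmul, TensorProduct.rid_symm_apply, CDGHopfAlgebra.counit_mul]
  by_cases hb : b = 0
  · subst hb
    simp only [zero_mul, zpow_zero, one_smul, ← smul_tmul', tmul_smul, smul_smul]
    rw [← mul_one (_ * _), ← smul_eq_mul, tmul_smul]
    simp only [mul_comm]
  · have : Coalgebra.counit (R := k) β = 0 := eq_zero_of_mem_gr_self hb
      ((CDGHopfAlgebra.counit_chain (k := k) (B := B)).deg.zero_mem hβ)
    simp [this]

/-- The tensor product of dg-comodules. -/
abbrev tensor (M N : DGComodule k B) : DGComodule k B where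
  carrier := M ⊗[k] N
  coact := tensorCoact M N
  coact_chain := IsChain.mulSwap.comp (M.coact_chain.map N.coact_chain)
  coassoc t := by
    have h1 : tensorCoact M N t = mulSwap k B M N (TensorProduct.map M.coact N.coact t) := rfl
    rw [h1, tensor_coassoc_aux, tensor_comul_aux]
    congr 2
    clear h1
    induction t using TensorProduct.induction_on with
    | zero => simp
    | add s t hs ht => simp only [map_add, hs, ht]
    | tmul x y =>
      simp only [map_tmul, LinearMap.comp_apply, LinearEquiv.coe_coe, M.coassoc, N.coassoc]
  counit t := by
    have h1 : tensorCoact M N t = mulSwap k B M N (TensorProduct.map M.coact N.coact t) := rfl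
    rw [h1, tensor_counit_aux]
    rw [TensorProduct.rid_symm_apply]
    congr 1
    clear h1
    induction t using TensorProduct.induction_on with
    | zero => simp
    | add s t hs ht => simp only [map_add, hs, ht]
    | tmul x y =>
      simp only [map_tmul, LinearMap.comp_apply, LinearEquiv.coe_coe, M.counit, N.counit,
        TensorProduct.rid_tmul, one_smul]

variable (k B) in
/-- The coaction `τ ∘ (ς ⊗ 𝕀) ∘ Δ` of the comodule `B^*`. -/
def starCoact : B →ₗ[k] B ⊗[k] B :=
  (tau k B B).toLinearMap ∘ₗ (antipode k B).rTensor B ∘ₗ Coalgebra.comul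

variable (k B) in
/-- The dg-comodule `B^*`: the complex `B` with the coaction `τ ∘ (ς ⊗ 𝕀) ∘ Δ`. -/
abbrev star : DGComodule k B where
  carrier := B
  coact := starCoact k B
  coact_chain := IsChain.tau.comp (antipode_chain.rTensor.comp CDGHopfAlgebra.comul_chain)
  coassoc x := by
    let K : B ⊗[k] (B ⊗[k] B) →ₗ[k] B ⊗[k] (B ⊗[k] B) :=
      (TensorProduct.assoc k B B B).toLinearMap ∘ₗ
        ((tau k B B).toLinearMap ∘ₗ (antipode k B).rTensor B).rTensor B ∘ₗ
        (tau k B (B ⊗[k] B)).toLinearMap ∘ₗ (antipode k B).rTensor (B ⊗[k] B)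
    have hK : K ∘ₗ (TensorProduct.assoc k B B B).toLinearMap =
        (tau k (B ⊗[k] B) B).toLinearMap ∘ₗ ((tau k B B).toLinearMap ∘ₗ
          TensorProduct.map (antipode k B) (antipode k B)).rTensor B := by
      apply TensorProduct.ext
      refine tensor_ext fun i j a b ha hb => hom_ext fun l c hc => ?_
      have ha' := antipode_chain.deg.zero_mem ha
      have hb' := antipode_chain.deg.zero_mem hb
      simp only [LinearMap.compr₂ₛₗ_apply, TensorProduct.mk_apply, LinearMap.comp_apply, K,
        LinearEquiv.coe_coe, assoc_tmul, LinearMap.rTensor_tmul, map_tmul, tau_tmul ha' hb',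
        tau_tmul ha' (mem_tensor hb hc rfl), map_smul, tau_tmul hb' hc, ← smul_tmul',
        tau_tmul (mem_tensor hb' ha' rfl) hc, smul_smul, ← zpow_add₀ (show (-1 : k) ≠ 0 by simp)]
      congr 2; ring
    have hL : ∀ t : B ⊗[k] B, (TensorProduct.assoc k B B B) ((starCoact k B).rTensor B
        (tau k B B ((antipode k B).rTensor B t))) =
        K ((Coalgebra.comul (R := k) (A := B)).lTensor B t) := by
      intro t
      have h1 := tau_natural (IsChain.id (V := B) (k := k)).deg
        (CDGHopfAlgebra.comul_chain (k := k) (B := B)).deg ((antipode k B).rTensor B t)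
      simp only [K, LinearMap.comp_apply, LinearEquiv.coe_coe]
      have h2 : (antipode k B).rTensor (B ⊗[k] B) ((Coalgebra.comul (R := k) (A := B)).lTensor B t) =
          TensorProduct.map LinearMap.id (Coalgebra.comul (R := k) (A := B))
            ((antipode k B).rTensor B t) := by
        rw [← LinearMap.comp_apply, LinearMap.rTensor_comp_lTensor, ← LinearMap.lTensor,
          ← LinearMap.comp_apply (LinearMap.lTensor _ _), LinearMap.lTensor_comp_rTensor]
      rw [h2, h1]
      congr 1
      have h3 : starCoact k B = ((tau k B B).toLinearMap ∘ₗ (antipode k B).rTensor B) ∘ₗ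
        Coalgebra.comul := rfl
      rw [h3, LinearMap.rTensor_comp, LinearMap.comp_apply]
      rfl
    have hR : ∀ t : B ⊗[k] B, (Coalgebra.comul (R := k) (A := B)).lTensor B
        (tau k B B ((antipode k B).rTensor B t)) =
        tau k (B ⊗[k] B) B (((tau k B B).toLinearMap ∘ₗ
          TensorProduct.map (antipode k B) (antipode k B)).rTensor B
            ((Coalgebra.comul (R := k) (A := B)).rTensor B t)) := by
      intro t
      have h1 := tau_natural (CDGHopfAlgebra.comul_chain (k := k) (B := B)).deg
        (IsChain.id (V := B) (k := k)).deg ((antipode k B).rTensor B t)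
      rw [LinearMap.lTensor, ← h1, ← LinearMap.rTensor, ← LinearMap.comp_apply,
        ← LinearMap.rTensor_comp, ← LinearMap.comp_apply (LinearMap.rTensor _ _),
        ← LinearMap.rTensor_comp]
      congr 3
      ext b
      simp [antipode_comul]
    have h0 : starCoact k B x = tau k B B ((antipode k B).rTensor B
      (Coalgebra.comul (R := k) x)) := rfl
    rw [h0, hL, hR, ← Coalgebra.coassoc_apply]
    exact LinearMap.congr_fun hK _
  counit x := by
    have h0 : starCoact k B x = tau k B B ((antipode k B).rTensor B
      (Coalgebra.comul (R := k) x)) := rfl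
    have h1 := tau_natural (CDGHopfAlgebra.counit_chain (k := k) (B := B)).deg
        (IsChain.id (V := B) (k := k)).deg ((antipode k B).rTensor B (Coalgebra.comul (R := k) x))
    rw [h0, LinearMap.lTensor, ← h1, ← LinearMap.rTensor, ← LinearMap.comp_apply
      (LinearMap.rTensor _ _), ← LinearMap.rTensor_comp]
    have h2 : Coalgebra.counit (R := k) (A := B) ∘ₗ antipode k B = Coalgebra.counit := by
      ext b; exact counit_antipode b
    rw [h2, Coalgebra.rTensor_counit_comul]
    refine homog_induction (k := k) (p := fun x : B => tau k k B (1 ⊗ₜ x) = x ⊗ₜ 1) (by simp) ?_ ?_ x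
    · intro i x hx
      rw [tau_tmul one_mem_gr hx]; simp
    · intro a b ha hb
      rw [tmul_add, map_add, ha, hb, add_tmul]

/-- The linear map `ι ∘ (h ⊗ ς) ∘ γ : M → B`. -/
def dualBar (M : DGComodule k B) : Module.Dual k M →ₗ[k] (M →ₗ[k] B) where
  toFun h := (TensorProduct.lid k B).toLinearMap ∘ₗ TensorProduct.map h (antipode k B) ∘ₗ M.coact
  map_add' f g := by
    ext x; simp [TensorProduct.map_add_left]
  map_smul' c f := by
    ext x; simp [TensorProduct.map_smul_left]

theorem dualBar_apply (M : DGComodule k B) (h : Module.Dual k M) (x : M) :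
    dualBar M h x = TensorProduct.lid k B (TensorProduct.map h (antipode k B) (M.coact x)) := rfl

/-- The coaction on the dual: `h ↦ ι ∘ (h ⊗ ς) ∘ γ` followed by `Hom(M, B) ≅ M^∨ ⊗ B`. -/
def dualCoact (M : DGComodule k B) [Module.Finite k M] :
    Module.Dual k M →ₗ[k] Module.Dual k M ⊗[k] B :=
  (homDual k M B).toLinearMap ∘ₗ dualBar M

theorem pair_dualCoact (M : DGComodule k B) [Module.Finite k M] (h : Module.Dual k M) :
    pair k M B (dualCoact M h) = dualBar M h := by
  simp [pair, dualCoact]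

theorem dual_deg_aux (M : DGComodule k B) [Module.Finite k M] {n : ℤ} {h : Module.Dual k M}
    (hh : h ∈ gr k (Module.Dual k M) n) : HasDeg n (dualBar M h) := by
  intro i x hx
  rw [dualBar_apply]
  refine tensor_induction (p := fun t => TensorProduct.lid k B
    (TensorProduct.map h (antipode k B) t) ∈ gr k B (i + n)) (by simp)
    (fun s t hs ht => by simpa using add_mem hs ht)
    (fun c t ht => by simpa using Submodule.smul_mem _ c ht) ?_ (M.coact_chain.deg.zero_mem hx)
  intro a b y β hab hy hβ
  rw [map_tmul, lid_tmul]
  by_cases ha : a + n = 0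
  · refine Submodule.smul_mem _ _ ?_
    rw [show i + n = b by omega]
    exact antipode_chain.deg.zero_mem hβ
  · simp [dual_eval_zero hh hy ha]

theorem dual_dif_aux (M : DGComodule k B) [Module.Finite k M] {n : ℤ} {h : Module.Dual k M}
    (hh : h ∈ gr k (Module.Dual k M) n) (x : M) :
    dualBar M (dif k _ h) x =
      dif k B (dualBar M h x) - (-1 : k) ^ n • dualBar M h (dif k M x) := by
  simp only [dualBar_apply]
  rw [M.coact_chain.comm]
  refine tensor_induction' (k := k) (p := fun t => TensorProduct.lid k B
    (TensorProduct.map (dif k _ h) (antipode k B) t) = dif k B (TensorProduct.lid k B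
    (TensorProduct.map h (antipode k B) t)) - (-1 : k) ^ n • TensorProduct.lid k B
    (TensorProduct.map h (antipode k B) (dif k _ t))) (by simp)
    (fun s t hs ht => by simp only [map_add, hs, ht, smul_add]; abel) ?_ (M.coact x)
  intro a b y β hy hβ
  simp only [map_tmul, lid_tmul, dif_tmul hy, map_add, map_smul, antipode_chain.comm]
  rw [show dif k (M →ₗ[k] k) h = _ from dif_dual_eq hh]
  by_cases ha : a + n = 0
  · simp only [LinearMap.neg_apply, LinearMap.smul_apply, LinearMap.comp_apply, smul_add,
      smul_smul, smul_eq_mul]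
    rw [← mul_assoc, ← zpow_add₀ (show (-1 : k) ≠ 0 by simp), show n + a = 0 by omega]
    simp
  · simp [dual_eval_zero hh hy ha, smul_smul]

theorem dual_coassoc_aux (M : DGComodule k B) [Module.Finite k M] (t : Module.Dual k M ⊗[k] B)
    {i : ℤ} {x : M} (hx : x ∈ gr k M i) :
    pair k M (B ⊗[k] B) (TensorProduct.assoc k _ B B ((dualCoact M).rTensor B t)) x =
      tau k B B (TensorProduct.map (pair k M B t) (antipode k B) (M.coact x)) := by
  refine tensor_induction' (k := k) (p := fun t =>
    pair k M (B ⊗[k] B) (TensorProduct.assoc k _ B B ((dualCoact M).rTensor B t)) x =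
      tau k B B (TensorProduct.map (pair k M B t) (antipode k B) (M.coact x))) (by simp)
    (fun s t hs ht => by
      simp only [map_add, LinearMap.add_apply, hs, ht, TensorProduct.map_add_left]) ?_ t
  intro a b e β he hβ
  have h1 : ∀ s : Module.Dual k M ⊗[k] B,
      pair k M (B ⊗[k] B) (TensorProduct.assoc k _ B B (s ⊗ₜ β)) x =
        (-1 : k) ^ (i * b) • (pair k M B s x ⊗ₜ β) := by
    intro s
    refine tensor_induction' (k := k) (p := fun s =>
      pair k M (B ⊗[k] B) (TensorProduct.assoc k _ B B (s ⊗ₜ β)) x =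
        (-1 : k) ^ (i * b) • (pair k M B s x ⊗ₜ β)) (by simp)
      (fun s t hs ht => by
        simp only [add_tmul, map_add, LinearMap.add_apply, hs, ht, smul_add]) ?_ s
    intro a' c e' γ he' hγ
    rw [assoc_tmul, pair_tmul he' (mem_tensor hγ hβ rfl), pair_tmul he' hγ]
    by_cases hi : i + a' = 0
    · simp only [← smul_tmul', smul_smul]
      congr 1
      rw [← mul_assoc, ← zpow_add₀ (by simp), neg_one_zpow_eq]
      refine ⟨a' * b, ?_⟩
      rw [show i = -a' by omega]; ring
    · simp [dual_eval_zero he' hx hi]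
  rw [LinearMap.rTensor_tmul, h1, pair_dualCoact, dualBar_apply]
  refine tensor_induction (p := fun s => (-1 : k) ^ (i * b) • (TensorProduct.lid k B
    (TensorProduct.map e (antipode k B) s) ⊗ₜ[k] β) =
    tau k B B (TensorProduct.map (pair k M B (e ⊗ₜ β)) (antipode k B) s)) (by simp)
    (fun s t hs ht => by simp only [map_add, add_tmul, smul_add, hs, ht])
    (fun c t ht => by simp only [map_smul, ← smul_tmul', ← ht]; rw [smul_comm]) ?_
    (M.coact_chain.deg.zero_mem hx)
  intro i' c y γ hic hy hγ
  rw [map_tmul, map_tmul, lid_tmul, pair_tmul he hβ]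
  by_cases hi : i' + a = 0
  · simp only [← smul_tmul', map_smul, tau_tmul hβ (antipode_chain.deg.zero_mem hγ), smul_smul]
    congr 1
    rw [mul_comm _ (e y), mul_comm _ (e y), mul_assoc, ← zpow_add₀ (by simp)]
    congr 1
    apply neg_one_zpow_eq
    refine ⟨- a * b, ?_⟩
    rw [← hic, show i' = -a by omega]; ring
  · simp [dual_eval_zero he hy hi]

theorem pair_injective {M U : Type*} [AddCommGroup M] [Module k M] [DGModule k M]
    [AddCommGroup U] [Module k U] [DGModule k U] [Module.Finite k M] :
    Function.Injective (pair k M U) := (homDual k M U).symm.injective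

/-- The dual `M^∨` of a finite dimensional dg-comodule. -/
abbrev dual (M : DGComodule k B) [Module.Finite k M] : DGComodule k B where
  carrier := Module.Dual k M
  coact := dualCoact M
  coact_chain := by
    refine ⟨fun n h hh => ?_, fun h => ?_⟩
    · rw [add_zero]; exact homDual_mem (dual_deg_aux M hh)
    · refine homog_induction (k := k) (p := fun h => dualCoact M (dif k _ h) =
        dif k _ (dualCoact M h)) (by simp) ?_ (fun a b ha hb => by simp only [map_add, ha, hb]) h
      intro n h hh
      apply pair_injective
      ext x
      have h1 := pair_dif (U := B) (homDual_mem (dual_deg_aux M hh)) x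
      have h2 := pair_dualCoact M h
      rw [pair_dualCoact, dual_dif_aux M hh]
      rw [← h2]
      exact h1.symm
  coassoc h := by
    apply pair_injective
    refine hom_ext fun i x hx => ?_
    rw [dual_coassoc_aux M _ hx, pair_dualCoact,
      pair_lTensor (CDGHopfAlgebra.comul_chain (k := k) (B := B)).deg, pair_dualCoact,
      dualBar_apply]
    have h1 : Coalgebra.comul (R := k) ∘ₗ (TensorProduct.lid k B).toLinearMap ∘ₗ
        TensorProduct.map h (antipode k B) = (tau k B B).toLinearMap ∘ₗ
        TensorProduct.map (antipode k B) (antipode k B) ∘ₗ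
        (TensorProduct.lid k (B ⊗[k] B)).toLinearMap ∘ₗ
        TensorProduct.map h (Coalgebra.comul (R := k) (A := B)) := by
      ext y β
      simp [antipode_comul]
    have h2 := LinearMap.congr_fun h1 (M.coact x)
    simp only [LinearMap.comp_apply, LinearEquiv.coe_coe] at h2
    rw [h2]
    congr 1
    have h3 : TensorProduct.map h (Coalgebra.comul (R := k) (A := B)) (M.coact x) =
        h.rTensor (B ⊗[k] B) ((Coalgebra.comul (R := k) (A := B)).lTensor M (M.coact x)) := by
      exact (LinearMap.congr_fun (LinearMap.rTensor_comp_lTensor (M := M) _ _) _).symm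
    rw [h3, ← M.coassoc]
    generalize M.coact x = s
    induction s using TensorProduct.induction_on with
    | zero => simp
    | add s t hs ht => simp only [map_add, hs, ht]
    | tmul y β =>
      rw [map_tmul, LinearMap.rTensor_tmul, dualBar_apply]
      generalize M.coact y = s
      induction s using TensorProduct.induction_on with
      | zero => simp
      | add s t hs ht => simp only [map_add, add_tmul, hs, ht]
      | tmul z γ => simp [← smul_tmul']
  counit h := by
    apply pair_injective
    ext x
    rw [pair_lTensor (CDGHopfAlgebra.counit_chain (k := k) (B := B)).deg, pair_dualCoact,
      dualBar_apply]
    have h1 : Coalgebra.counit (R := k) ∘ₗ (TensorProduct.lid k B).toLinearMap ∘ₗ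
        TensorProduct.map h (antipode k B) = h ∘ₗ (TensorProduct.rid k M).toLinearMap ∘ₗ
        (Coalgebra.counit (R := k) (A := B)).lTensor M := by
      ext y β
      simp [counit_antipode, mul_comm]
    have h2 := LinearMap.congr_fun h1 (M.coact x)
    simp only [LinearMap.comp_apply, LinearEquiv.coe_coe, M.counit, TensorProduct.rid_tmul,
      one_smul] at h2
    rw [h2]
    refine homog_induction (k := k) (p := fun h => h x = pair k M k (h ⊗ₜ 1) x) (by simp) ?_
      (fun a b ha hb => by simp only [add_tmul, map_add, LinearMap.add_apply, ha, hb]) h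
    intro n h hh
    rw [pair_tmul hh one_mem_gr]
    simp

end DGComodule

section TensorOverA

variable {k : Type*} [Field k]
variable {M N M' N' Y : Type*} [AddCommGroup M] [Module k M] [DGModule k M]
  [AddCommGroup N] [Module k N] [DGModule k N] [AddCommGroup M'] [Module k M'] [DGModule k M']
  [AddCommGroup N'] [Module k N'] [DGModule k N'] [AddCommGroup Y] [Module k Y] [DGModule k Y]
variable {A : Type*} [Ring A] [Algebra k A] [DGModule k A]

/-- `φ ∘ (𝕀 ⊗ m) = (𝕀 ⊗ m) ∘ (φ ⊗ 𝕀)`: linearity over `A` of a map between free right modules. -/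
def IsALinear (φ : M ⊗[k] A →ₗ[k] N ⊗[k] A) : Prop :=
  φ ∘ₗ (LinearMap.mul' k A).lTensor M ∘ₗ (TensorProduct.assoc k M A A).toLinearMap =
    (LinearMap.mul' k A).lTensor N ∘ₗ (TensorProduct.assoc k N A A).toLinearMap ∘ₗ φ.rTensor A

/-- The restriction `φ ∘ (𝕀 ⊗ u) ∘ ȷ⁻¹` along the unit of `A`, i.e. `x ↦ φ (x ⊗ 1)`. -/
def qmap (φ : M ⊗[k] A →ₗ[k] N ⊗[k] A) : M →ₗ[k] N ⊗[k] A :=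
  φ ∘ₗ (Algebra.linearMap k A).lTensor M ∘ₗ (TensorProduct.rid k M).symm.toLinearMap

/-- The tensor product over `A` of maps between free right modules, where the tensor product of
`M ⊗ A` and `M' ⊗ A` over `A` is `(M ⊗ M') ⊗ A`:
`(𝕀 ⊗ m) ∘ (𝕀 ⊗ τ ⊗ 𝕀) ∘ (q φ ⊗ φ')`. -/
def tensorA (φ : M ⊗[k] A →ₗ[k] N ⊗[k] A) (φ' : M' ⊗[k] A →ₗ[k] N' ⊗[k] A) :
    (M ⊗[k] M') ⊗[k] A →ₗ[k] (N ⊗[k] N') ⊗[k] A :=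
  mulSwap k A N N' ∘ₗ (qmap φ).rTensor (N' ⊗[k] A) ∘ₗ lten M φ' ∘ₗ
    (TensorProduct.assoc k M M' A).toLinearMap

/-- The dual of `φ` with respect to `ev : Y ⊗ M → k` and `cv : k → M ⊗ Y`, that is
`(ω(ev) ⊗ 𝕀) ∘ (𝕀 ⊗ φ ⊗ 𝕀) ∘ (𝕀 ⊗ ω(cv))` where `ω` is `- ⊗ A` and tensor products are over `A`. -/
def dualEnd (ev : Y ⊗[k] M →ₗ[k] k) (cv : k →ₗ[k] M ⊗[k] Y) (φ : M ⊗[k] A →ₗ[k] M ⊗[k] A) :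
    Y ⊗[k] A →ₗ[k] Y ⊗[k] A :=
  (TensorProduct.lid k Y).toLinearMap.rTensor A ∘ₗ
    tensorA (ev.rTensor A) (LinearMap.id : Y ⊗[k] A →ₗ[k] Y ⊗[k] A) ∘ₗ
    (TensorProduct.assoc k Y M Y).symm.toLinearMap.rTensor A ∘ₗ
    tensorA (LinearMap.id : Y ⊗[k] A →ₗ[k] Y ⊗[k] A)
      (tensorA φ (LinearMap.id : Y ⊗[k] A →ₗ[k] Y ⊗[k] A)) ∘ₗ
    tensorA (LinearMap.id : Y ⊗[k] A →ₗ[k] Y ⊗[k] A) (cv.rTensor A) ∘ₗ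
    (TensorProduct.rid k Y).symm.toLinearMap.rTensor A

end TensorOverA

section Comodules

variable (k B : Type u) [Field k] [Ring B] [Algebra k B] [DGModule k B] [Coalgebra k B]

/-- Finite dimensional right dg-comodules. -/
structure FDComodule where
  toDGComodule : DGComodule k B
  [finite : Module.Finite k toDGComodule]

attribute [instance] FDComodule.finite

variable {k B}

/-- Morphisms of comodules: linear maps, of arbitrary degree, compatible with the coactions. -/
def IsComodHom {M N : DGComodule k B} (ψ : M →ₗ[k] N) : Prop :=
  N.coact ∘ₗ ψ = ψ.rTensor B ∘ₗ M.coact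

variable [CDGHopfAlgebra k B]

variable (k B) in
/-- The unit comodule `k`. -/
abbrev FDComodule.unit : FDComodule k B where
  toDGComodule := DGComodule.unit k B
  finite := inferInstanceAs (Module.Finite k k)

/-- The tensor product of finite dimensional comodules. -/
abbrev FDComodule.tensor (M N : FDComodule k B) : FDComodule k B where
  toDGComodule := M.toDGComodule.tensor N.toDGComodule
  finite := inferInstanceAs (Module.Finite k (M.toDGComodule ⊗[k] N.toDGComodule))

/-- The dual of a finite dimensional comodule. -/
abbrev FDComodule.dual (M : FDComodule k B) : FDComodule k B where
  toDGComodule := M.toDGComodule.dual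
  finite := inferInstanceAs (Module.Finite k (Module.Dual k M.toDGComodule))

end Comodules

section Nat

variable (k B : Type u) [Field k] [Ring B] [Algebra k B] [DGModule k B] [Coalgebra k B]
variable (A : Type v) [Ring A] [Algebra k A] [DGModule k A]

/-- Families of `k`-linear endomorphisms of `M ⊗ A`, for all dg-comodules `M`. -/
abbrev Fam : Type (max (u + 1) v) := ∀ M : DGComodule k B, Module.End k (M ⊗[k] A)

/-- Families of `k`-linear endomorphisms of `M ⊗ A`, for all finite dimensional `M`. -/
abbrev FamF : Type (max (u + 1) v) :=
  ∀ M : FDComodule k B, Module.End k (M.toDGComodule ⊗[k] A)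

/-- Natural endomorphisms of degree `n` of `ω ⊗ A`, with the Koszul sign. -/
def NatEnd (n : ℤ) : Submodule k (Fam k B A) where
  carrier := {η | (∀ M, HasDeg n (η M)) ∧ (∀ M, IsALinear (η M)) ∧
    ∀ (M N : DGComodule k B) (m : ℤ) (ψ : M →ₗ[k] N), HasDeg m ψ → IsComodHom ψ →
      ψ.rTensor A ∘ₗ η M = (-1 : k) ^ (m * n) • (η N ∘ₗ ψ.rTensor A)}
  zero_mem' := ⟨fun M i x _ => by simp, fun M => by simp [IsALinear], by simp⟩
  add_mem' := by
    rintro η η' ⟨h1, h2, h3⟩ ⟨h1', h2', h3'⟩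
    refine ⟨fun M i x hx => add_mem (h1 M hx) (h1' M hx), fun M => ?_, fun M N m ψ hψ hc => ?_⟩
    · have := h2 M
      have h' := h2' M
      simp only [IsALinear, Pi.add_apply, LinearMap.add_comp, LinearMap.rTensor_add,
        LinearMap.comp_add] at this h' ⊢
      rw [this, h']
    · simp only [Pi.add_apply, LinearMap.comp_add, LinearMap.add_comp, smul_add, h3 M N m ψ hψ hc,
        h3' M N m ψ hψ hc]
  smul_mem' := by
    rintro c η ⟨h1, h2, h3⟩
    refine ⟨fun M i x hx => Submodule.smul_mem _ c (h1 M hx), fun M => ?_, fun M N m ψ hψ hc => ?_⟩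
    · have := h2 M
      simp only [IsALinear, Pi.smul_apply, LinearMap.smul_comp, LinearMap.rTensor_smul,
        LinearMap.comp_smul] at this ⊢
      rw [this]
    · simp only [Pi.smul_apply, LinearMap.comp_smul, LinearMap.smul_comp, h3 M N m ψ hψ hc]
      rw [smul_comm]

/-- Natural endomorphisms of degree `n` of `ω_f ⊗ A`, with the Koszul sign. -/
def NatEndF (n : ℤ) : Submodule k (FamF k B A) where
  carrier := {ξ | (∀ M, HasDeg n (ξ M)) ∧ (∀ M, IsALinear (ξ M)) ∧
    ∀ (M N : FDComodule k B) (m : ℤ) (ψ : M.toDGComodule →ₗ[k] N.toDGComodule),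
      HasDeg m ψ → IsComodHom ψ →
      ψ.rTensor A ∘ₗ ξ M = (-1 : k) ^ (m * n) • (ξ N ∘ₗ ψ.rTensor A)}
  zero_mem' := ⟨fun M i x _ => by simp, fun M => by simp [IsALinear], by simp⟩
  add_mem' := by
    rintro η η' ⟨h1, h2, h3⟩ ⟨h1', h2', h3'⟩
    refine ⟨fun M i x hx => add_mem (h1 M hx) (h1' M hx), fun M => ?_, fun M N m ψ hψ hc => ?_⟩
    · have := h2 M
      have h' := h2' M
      simp only [IsALinear, Pi.add_apply, LinearMap.add_comp, LinearMap.rTensor_add,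
        LinearMap.comp_add] at this h' ⊢
      rw [this, h']
    · simp only [Pi.add_apply, LinearMap.comp_add, LinearMap.add_comp, smul_add, h3 M N m ψ hψ hc,
        h3' M N m ψ hψ hc]
  smul_mem' := by
    rintro c η ⟨h1, h2, h3⟩
    refine ⟨fun M i x hx => Submodule.smul_mem _ c (h1 M hx), fun M => ?_, fun M N m ψ hψ hc => ?_⟩
    · have := h2 M
      simp only [IsALinear, Pi.smul_apply, LinearMap.smul_comp, LinearMap.rTensor_smul,
        LinearMap.comp_smul] at this ⊢
      rw [this]
    · simp only [Pi.smul_apply, LinearMap.comp_smul, LinearMap.smul_comp, h3 M N m ψ hψ hc]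
      rw [smul_comm]

/-- `End(ω ⊗ A)`: sums of homogeneous natural endomorphisms. -/
def EndFunctor : Submodule k (Fam k B A) := ⨆ n, NatEnd k B A n

/-- `End(ω_f ⊗ A)`: sums of homogeneous natural endomorphisms. -/
def EndFunctorF : Submodule k (FamF k B A) := ⨆ n, NatEndF k B A n

variable {k B A}

/-- The restriction of a family to the finite dimensional comodules. -/
def res (η : Fam k B A) : FamF k B A := fun M => η M.toDGComodule

/-- `ζ` extends `ξ` from finite dimensional comodules to all comodules: for each embedding
`ι : N → M` of a finite dimensional subcomodule, `ζ^M ∘ (ι ⊗ 𝕀) = (ι ⊗ 𝕀) ∘ ξ^N`. -/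
def IsColimExtension (ξ : FamF k B A) (ζ : Fam k B A) : Prop :=
  ∀ (M : DGComodule k B) (N : FDComodule k B) (ι : N.toDGComodule →ₗ[k] M),
    Function.Injective ι → IsChain ι → IsComodHom ι →
      ζ M ∘ₗ ι.rTensor A = ι.rTensor A ∘ₗ ξ N

/-- The colimit of `ξ` along the finite dimensional subcomodules: the family extending `ξ`. -/
def limA (ξ : FamF k B A) : Fam k B A := Classical.epsilon (IsColimExtension ξ)

variable [CDGHopfAlgebra k B]

variable (k B A) in
/-- `Z⁰End_⊗(ω ⊗ A)`. -/
def Z0EndTensor : Set (Fam k B A) :=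
  {η | η ∈ NatEnd k B A 0 ∧
    (∀ M : DGComodule k B, dif k (M ⊗[k] A) ∘ₗ η M - η M ∘ₗ dif k (M ⊗[k] A) = 0) ∧
    η (DGComodule.unit k B) = LinearMap.id ∧
    ∀ M N : DGComodule k B, η (M.tensor N) = tensorA (η M) (η N)}

variable (k B A) in
/-- `Z⁰End_⊗(ω_f ⊗ A)`. -/
def Z0EndTensorF : Set (FamF k B A) :=
  {ξ | ξ ∈ NatEndF k B A 0 ∧
    (∀ M : FDComodule k B,
      dif k (M.toDGComodule ⊗[k] A) ∘ₗ ξ M - ξ M ∘ₗ dif k (M.toDGComodule ⊗[k] A) = 0) ∧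
    ξ (FDComodule.unit k B) = LinearMap.id ∧
    ∀ M N : FDComodule k B, ξ (M.tensor N) = tensorA (ξ M) (ξ N)}

/-- `S(ξ)^M = (ξ^{M^∨})^∨`, where `M` is the dual of `M^∨` through `ev ∘ τ` and `τ ∘ cv`. -/
def S (ξ : FamF k B A) : FamF k B A := fun M =>
  dualEnd (contractLeft k M.toDGComodule ∘ₗ
      (tau k M.toDGComodule (Module.Dual k M.toDGComodule)).toLinearMap)
    ((tau k M.toDGComodule (Module.Dual k M.toDGComodule)).toLinearMap ∘ₗ
      coevaluation k M.toDGComodule)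
    (ξ M.dual)

/-- `ς(η)^M = (ȷ ⊗ 𝕀) ∘ (𝕀 ⊗ ε ⊗ 𝕀) ∘ (𝕀 ⊗ η^{B^*}) ∘ (γ ⊗ 𝕀)`. -/
def sigma (η : Fam k B A) : Fam k B A := fun M =>
  (TensorProduct.rid k M).toLinearMap.rTensor A ∘ₗ
    ((Coalgebra.counit (R := k) (A := B)).lTensor M).rTensor A ∘ₗ
    (TensorProduct.assoc k M B A).symm.toLinearMap ∘ₗ
    lten M (η (DGComodule.star k B)) ∘ₗ
    (TensorProduct.assoc k M B A).toLinearMap ∘ₗ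
    M.coact.rTensor A

end Nat

end DG

end

set_option linter.unusedSectionVars false

noncomputable section

namespace DG

/-! ### Koszul signs of `lten` and free right modules over `A` -/

section RightMul

variable {k : Type*} [Field k]
variable {V W X Y : Type*} [AddCommGroup V] [Module k V] [DGModule k V]
  [AddCommGroup W] [Module k W] [DGModule k W] [AddCommGroup X] [Module k X] [DGModule k X]
  [AddCommGroup Y] [Module k Y] [DGModule k Y]

/-! The theorem is a reconstruction statement: homogeneous natural endomorphisms, over all
dg-comodules or over the finite dimensional ones, are the families `convEnd f`, `x ⊗ a ↦ ∑ ± x₀ ⊗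
f(x₁) a`, for homogeneous linear maps `f : B → A`. Once this is known, every operation in the
theorem is a simple operation on `f`.

A linear map gives a family by `convEnd_mem_natEnd`. Conversely, `exists_eq_res_convEnd` recovers
`f` from a family `ξ` on finite dimensional comodules. By the local finiteness of dg-comodules
(`exists_subcomodule`), the regular comodule `B` is the union of its finite dimensional
dg-subcomodules `N`; the maps `x ↦ (ε ⊗ 𝕀) ξ^N (x ⊗ 1)` agree on overlaps and glue to `f`. A
homogeneous functional `e` on `M` yields the comodule morphism `x ↦ e(x₀) x₁` from `M` to `B`, whose
composite with `ε` is `e`; naturality along these morphisms forces `ξ^M` to be given by `f`. Local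
finiteness also makes the extension from finite dimensional comodules to all comodules unique, and
`convEnd f` provides it.

In these terms both antipodes are precomposition with the antipode of `B`: `sigma_convEnd` for `ς`,
because `(ε ⊗ 𝕀)` applied to the coaction of `B^*` gives the antipode, and `S_res_convEnd` for `S`,
because the antipode is built into the coaction of `M^∨`. This gives the stability of `S` and the
formula relating `ς` to `S`, first for homogeneous families and then for sums by additivity.

For a tensor-compatible `η = convEnd f` of degree `0`, naturality along the product `B ⊗ B → B`
makes `f` multiplicative and the unit comodule gives `f 1 = 1`. Composition of families is
convolution of linear maps (`convEnd_comp`), so `f ∘ antipode` gives the two-sided inverse. An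
inverse of a tensor-compatible family commuting with the differentials has the same two properties
for formal reasons (`Z0EndTensor.of_inverse`). -/

theorem lten_add (f g : V →ₗ[k] W) : lten X (f + g) = lten X f + lten X g := by
  simp only [lten, LinearMap.rTensor_add, LinearMap.add_comp, LinearMap.comp_add]

theorem lten_eq_lTensor {f : V →ₗ[k] W} (hf : HasDeg 0 f) : lten X f = f.lTensor X :=
  tensor_ext fun i j x y hx _ => by simp [lten_tmul hf hx]

theorem hasDeg_lten {f : V →ₗ[k] W} {n : ℤ} (hf : HasDeg n f) : HasDeg n (lten X f) :=
  hasDeg_tensor fun i j x y hx hy => by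
    rw [lten_tmul hf hx]
    exact Submodule.smul_mem _ _ (mem_tensor hx (hf hy) (by ring))

/-- Source of the Koszul sign in the naturality condition: `ψ` raises the degree of the left factor
by `m`, so the sign that `f` acquires on passing it changes by `(-1)^(m n)`. -/
theorem rTensor_lten {f : V →ₗ[k] W} {n m : ℤ} (hf : HasDeg n f) {ψ : X →ₗ[k] Y}
    (hψ : HasDeg m ψ) (t : X ⊗[k] V) :
    ψ.rTensor W (lten X f t) = (-1 : k) ^ (m * n) • lten Y f (ψ.rTensor V t) := by
  refine tensor_induction' (k := k) (p := fun t => ψ.rTensor W (lten X f t) =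
    (-1 : k) ^ (m * n) • lten Y f (ψ.rTensor V t)) (by simp)
    (fun s t hs ht => by simp only [map_add, smul_add, hs, ht]) ?_ t
  intro i j x y hx hy
  rw [lten_tmul hf hx, map_smul, LinearMap.rTensor_tmul, LinearMap.rTensor_tmul,
    lten_tmul hf (hψ hx), smul_smul, ← zpow_add₀ (by simp)]
  congr 1
  exact neg_one_zpow_eq ⟨-(m * n), by ring⟩

variable {A : Type*} [Ring A] [Algebra k A] [DGModule k A]

omit [DGModule k V] [DGModule k A] in
variable (k V) in
/-- Right multiplication by `a` on the free right module `V ⊗ A`. -/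
def rmul (a : A) : V ⊗[k] A →ₗ[k] V ⊗[k] A := (LinearMap.mulRight k a).lTensor V

omit [DGModule k V] [DGModule k A] in
@[simp] theorem rmul_tmul (a b : A) (x : V) : rmul k V a (x ⊗ₜ b) = x ⊗ₜ (b * a) := by
  simp [rmul]

omit [DGModule k V] [DGModule k A] in
theorem rmul_one (t : V ⊗[k] A) : rmul k V 1 t = t := by
  simp [rmul]

omit [DGModule k V] [DGModule k A] in
theorem rmul_rmul (a b : A) (t : V ⊗[k] A) : rmul k V a (rmul k V b t) = rmul k V (b * a) t := by
  simp only [rmul, ← LinearMap.comp_apply, ← LinearMap.lTensor_comp]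
  congr 2
  ext x
  simp [mul_assoc]

omit [DGModule k V] [DGModule k W] [DGModule k A] in
theorem rTensor_rmul (ψ : V →ₗ[k] W) (a : A) (t : V ⊗[k] A) :
    ψ.rTensor A (rmul k V a t) = rmul k W a (ψ.rTensor A t) := by
  simp only [rmul, ← LinearMap.comp_apply, LinearMap.rTensor_comp_lTensor,
    LinearMap.lTensor_comp_rTensor]

theorem rmul_mem [CDGAlgebra k A] {i j : ℤ} {a : A} (ha : a ∈ gr k A i) {t : V ⊗[k] A}
    (ht : t ∈ gr k (V ⊗[k] A) j) : rmul k V a t ∈ gr k (V ⊗[k] A) (j + i) := by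
  refine tensor_induction (p := fun t => rmul k V a t ∈ gr k (V ⊗[k] A) (j + i)) (by simp)
    (fun s t hs ht => by rw [map_add]; exact add_mem hs ht)
    (fun c t ht => by rw [map_smul]; exact Submodule.smul_mem _ _ ht) ?_ ht
  intro p q x b hpq hx hb
  rw [rmul_tmul]
  exact mem_tensor hx (CDGAlgebra.mul_mem hb ha) (by omega)

omit [DGModule k A] in
-- Elementwise form of the diagrammatic definition, in which linearity is used from here on.
theorem isALinear_iff {φ : V ⊗[k] A →ₗ[k] W ⊗[k] A} :
    IsALinear φ ↔ ∀ a t, φ (rmul k V a t) = rmul k W a (φ t) := by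
  have h1 : ∀ a t, (LinearMap.mul' k A).lTensor V (TensorProduct.assoc k V A A (t ⊗ₜ a)) =
      rmul k V a t := by
    intro a t
    induction t using TensorProduct.induction_on with
    | zero => simp
    | add s t hs ht => simp only [add_tmul, map_add, hs, ht]
    | tmul x y => simp
  have h2 : ∀ a t, (LinearMap.mul' k A).lTensor W (TensorProduct.assoc k W A A (t ⊗ₜ a)) =
      rmul k W a t := by
    intro a t
    induction t using TensorProduct.induction_on with
    | zero => simp
    | add s t hs ht => simp only [add_tmul, map_add, hs, ht]
    | tmul x y => simp
  constructor
  · intro h a t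
    have := LinearMap.congr_fun h (t ⊗ₜ a)
    simpa [h1, h2] using this
  · intro h
    apply TensorProduct.ext'
    intro t a
    simp [h1, h2, h]

omit [DGModule k A] in
-- The elements `x ⊗ 1` generate the free right module `V ⊗ A`.
theorem IsALinear.ext {φ φ' : V ⊗[k] A →ₗ[k] W ⊗[k] A} (h : IsALinear φ) (h' : IsALinear φ')
    (he : ∀ x, φ (x ⊗ₜ 1) = φ' (x ⊗ₜ 1)) : φ = φ' := by
  apply TensorProduct.ext'
  intro x a
  have : x ⊗ₜ[k] a = rmul k V a (x ⊗ₜ 1) := by simp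
  rw [this, isALinear_iff.1 h, isALinear_iff.1 h', he]

omit [DGModule k A] in
theorem IsALinear.comp {φ : W ⊗[k] A →ₗ[k] X ⊗[k] A} {φ' : V ⊗[k] A →ₗ[k] W ⊗[k] A}
    (h : IsALinear φ) (h' : IsALinear φ') : IsALinear (φ ∘ₗ φ') := by
  rw [isALinear_iff] at *
  intro a t
  simp [h, h']

omit [DGModule k A] in
omit [DGModule k A] in
theorem isALinear_id : IsALinear (LinearMap.id : V ⊗[k] A →ₗ[k] V ⊗[k] A) :=
  isALinear_iff.2 fun _ _ => rfl

omit [DGModule k A] in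
@[simp] theorem qmap_apply (φ : V ⊗[k] A →ₗ[k] W ⊗[k] A) (x : V) : qmap φ x = φ (x ⊗ₜ 1) := by
  simp [qmap]

end RightMul

/-! ### The family attached to a linear map `B → A` -/

section ConvEnd

variable {k B : Type u} [Field k] [Ring B] [Algebra k B] [DGModule k B] [Coalgebra k B]
variable {A : Type v} [Ring A] [Algebra k A] [DGModule k A]

/-- The family of endomorphisms `x ⊗ a ↦ ∑ (-1)^(|f||x₀|) x₀ ⊗ f(x₁) a` attached to a linear map
`f : B → A`. -/
def convEnd (f : B →ₗ[k] A) : Fam k B A := fun M =>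
  (LinearMap.mul' k A).lTensor M ∘ₗ (TensorProduct.assoc k M A A).toLinearMap ∘ₗ
    (lten M f ∘ₗ M.coact).rTensor A

theorem convEnd_tmul (f : B →ₗ[k] A) (M : DGComodule k B) (x : M) (a : A) :
    convEnd f M (x ⊗ₜ a) = rmul k M a (lten M f (M.coact x)) := by
  simp only [convEnd, LinearMap.comp_apply, LinearMap.rTensor_tmul, LinearEquiv.coe_coe]
  generalize lten M f (M.coact x) = t
  induction t using TensorProduct.induction_on with
  | zero => simp
  | add s t hs ht => simp only [add_tmul, map_add, hs, ht]
  | tmul x y => simp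

theorem isALinear_convEnd (f : B →ₗ[k] A) (M : DGComodule k B) : IsALinear (convEnd f M) := by
  rw [isALinear_iff]
  intro a t
  induction t using TensorProduct.induction_on with
  | zero => simp
  | add s t hs ht => simp only [map_add, hs, ht]
  | tmul x b => rw [rmul_tmul, convEnd_tmul, convEnd_tmul, rmul_rmul]

/-- A comodule morphism commutes with the coactions, so only the sign of exchanging `ψ` and `f`
remains. Compatibility of `ψ` with the differentials plays no role. -/
theorem convEnd_natural {f : B →ₗ[k] A} {n m : ℤ} (hf : HasDeg n f) {M N : DGComodule k B}
    {ψ : M →ₗ[k] N} (hψ : HasDeg m ψ) (hc : IsComodHom ψ) :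
    ψ.rTensor A ∘ₗ convEnd f M = (-1 : k) ^ (m * n) • (convEnd f N ∘ₗ ψ.rTensor A) := by
  apply TensorProduct.ext'
  intro x a
  have h := LinearMap.congr_fun hc x
  simp only [LinearMap.comp_apply] at h
  simp only [LinearMap.comp_apply, LinearMap.smul_apply, convEnd_tmul, LinearMap.rTensor_tmul,
    rTensor_rmul, rTensor_lten hf hψ, map_smul, h]

theorem convEnd_mem_natEnd [CDGAlgebra k A] {f : B →ₗ[k] A} {n : ℤ} (hf : HasDeg n f) :
    convEnd f ∈ NatEnd k B A n := by
  refine ⟨fun M => hasDeg_tensor fun i j x a hx ha => ?_, isALinear_convEnd f,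
    fun M N m ψ hψ hc => convEnd_natural hf hψ hc⟩
  rw [convEnd_tmul]
  have := rmul_mem ha (hasDeg_lten (X := M) hf (M.coact_chain.deg.zero_mem hx))
  rwa [show i + j + n = i + n + j by ring]

/-- Convolution of linear maps `B → A`. -/
def conv (f g : B →ₗ[k] A) : B →ₗ[k] A :=
  LinearMap.mul' k A ∘ₗ TensorProduct.map f g ∘ₗ Coalgebra.comul

/-- By coassociativity, acting by `g` and then by `f` sends `x ⊗ 1` to `∑ x₀ ⊗ f(x₁) g(x₂)`. Degree
`0` removes all signs, which is enough for the group statement. -/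
theorem convEnd_comp {f g : B →ₗ[k] A} (hf : HasDeg 0 f) (hg : HasDeg 0 g)
    (hfg : HasDeg 0 (conv f g)) (M : DGComodule k B) :
    convEnd f M ∘ₗ convEnd g M = convEnd (conv f g) M := by
  refine ((isALinear_convEnd f M).comp (isALinear_convEnd g M)).ext (isALinear_convEnd _ M) ?_
  intro x
  simp only [LinearMap.comp_apply, convEnd_tmul, rmul_one, lten_eq_lTensor hg,
    lten_eq_lTensor hfg]
  rw [conv, ← LinearMap.comp_assoc, LinearMap.lTensor_comp, LinearMap.comp_apply, ← M.coassoc]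
  generalize M.coact x = t
  induction t using TensorProduct.induction_on with
  | zero => simp
  | add s t hs ht => simp only [map_add, hs, ht]
  | tmul y b =>
    rw [LinearMap.lTensor_tmul, LinearMap.rTensor_tmul, convEnd_tmul, lten_eq_lTensor hf]
    generalize M.coact y = t
    induction t using TensorProduct.induction_on with
    | zero => simp
    | add s t hs ht => simp only [add_tmul, map_add, hs, ht]
    | tmul z c => simp

/-- The unit of the convolution algebra acts as the identity, by the counit axiom of `M`. -/
theorem convEnd_counit {f : B →ₗ[k] A} (hf : HasDeg 0 f)
    (h : f = Algebra.linearMap k A ∘ₗ Coalgebra.counit) (M : DGComodule k B) :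
    convEnd f M = LinearMap.id := by
  refine (isALinear_convEnd f M).ext isALinear_id fun x => ?_
  rw [convEnd_tmul, rmul_one, lten_eq_lTensor hf, h, LinearMap.lTensor_comp, LinearMap.comp_apply,
    M.counit]
  simp

theorem res_mem_natEndF {η : Fam k B A} {n : ℤ} (hη : η ∈ NatEnd k B A n) :
    res η ∈ NatEndF k B A n :=
  ⟨fun M => hη.1 M.toDGComodule, fun M => hη.2.1 M.toDGComodule,
    fun M N m ψ hψ hc => hη.2.2 M.toDGComodule N.toDGComodule m ψ hψ hc⟩

theorem isColimExtension_res {η : Fam k B A} {n : ℤ} (hη : η ∈ NatEnd k B A n) :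
    IsColimExtension (res η) η := by
  intro M N ι _ hc hι
  have := hη.2.2 N.toDGComodule M 0 ι hc.deg hι
  rw [zero_mul, zpow_zero, one_smul] at this
  exact this.symm

end ConvEnd

/-! ### Contraction of `V ⊗ U` against functionals on `U` -/

section Contract

variable {k : Type*} [Field k] {V U : Type*} [AddCommGroup V] [Module k V]
  [AddCommGroup U] [Module k U]

variable (k V U) in
/-- The contraction `h ⊗ (x ⊗ b) ↦ h(b) x`. -/
def contract : V ⊗[k] U →ₗ[k] Module.Dual k U →ₗ[k] V :=
  LinearMap.flip ((LinearMap.llcomp k (V ⊗[k] U) (V ⊗[k] k) V (TensorProduct.rid k V).toLinearMap) ∘ₗ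
    LinearMap.lTensorHom V)

@[simp] theorem contract_tmul (x : V) (b : U) (h : Module.Dual k U) :
    contract k V U (x ⊗ₜ b) h = h b • x := by
  simp [contract]

theorem rTensor_contract {V' : Type*} [AddCommGroup V'] [Module k V'] (f : V →ₗ[k] V')
    (t : V ⊗[k] U) (h : Module.Dual k U) :
    contract k V' U (f.rTensor U t) h = f (contract k V U t h) := by
  induction t using TensorProduct.induction_on with
  | zero => simp
  | add s t hs ht => simp only [map_add, LinearMap.add_apply, hs, ht]
  | tmul x b => simp

theorem eq_zero_of_contract {t : V ⊗[k] U} (ht : ∀ h, contract k V U t h = 0) : t = 0 := by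
  classical
  let b := Module.Basis.ofVectorSpace k U
  apply (TensorProduct.equivFinsuppOfBasisRight (M := V) b).injective
  rw [map_zero]
  ext i
  -- The coefficient of `t` at a basis vector of `U` is its contraction with the coordinate
  -- functional.
  rw [Finsupp.zero_apply, ← ht (b.coord i)]
  clear ht
  induction t using TensorProduct.induction_on with
  | zero => simp
  | add s t hs ht => simp only [map_add, LinearMap.add_apply, Finsupp.add_apply, hs, ht]
  | tmul x c => simp

theorem rTensor_lTensor {V' U' : Type*} [AddCommGroup V'] [Module k V'] [AddCommGroup U']
    [Module k U'] (f : V →ₗ[k] V') (g : U →ₗ[k] U') (t : V ⊗[k] U) :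
    f.rTensor U' (g.lTensor V t) = g.lTensor V' (f.rTensor U t) :=
  (LinearMap.congr_fun (LinearMap.rTensor_comp_lTensor _ _ _) t).trans
    (LinearMap.congr_fun (LinearMap.lTensor_comp_rTensor _ _ _) t).symm

variable (U) in
/-- The image of `N ⊗ U` in `V ⊗ U`. -/
def tensorRange (N : Submodule k V) : Submodule k (V ⊗[k] U) :=
  LinearMap.range (N.subtype.rTensor U)

theorem tmul_mem_tensorRange {N : Submodule k V} {x : V} (hx : x ∈ N) (b : U) :
    x ⊗ₜ b ∈ tensorRange U N :=
  ⟨(⟨x, hx⟩ : N) ⊗ₜ b, by simp⟩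

theorem tensorRange_le {N : Submodule k V} {R : Submodule k (V ⊗[k] U)}
    (h : ∀ x ∈ N, ∀ b, x ⊗ₜ b ∈ R) : tensorRange U N ≤ R := by
  rintro _ ⟨t, rfl⟩
  induction t using TensorProduct.induction_on with
  | zero => simp
  | add s t hs ht => rw [map_add]; exact add_mem hs ht
  | tmul x b => simpa using h x x.2 b

theorem tensorRange_mono {N N' : Submodule k V} (h : N ≤ N') :
    tensorRange U N ≤ tensorRange U N' :=
  tensorRange_le fun _ hx b => tmul_mem_tensorRange (h hx) b

/-- The image of `t` in `(V / N) ⊗ U` has zero contractions, hence vanishes; right exactness of the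
tensor product then puts `t` in the image of `N ⊗ U`. This is how coactions are shown to restrict to
subspaces. -/
theorem mem_tensorRange {N : Submodule k V} {t : V ⊗[k] U}
    (ht : ∀ h, contract k V U t h ∈ N) : t ∈ tensorRange U N := by
  have h1 : N.mkQ.rTensor U t = 0 := by
    refine eq_zero_of_contract fun h => ?_
    rw [rTensor_contract]
    simpa using ht h
  exact (rTensor_exact U (LinearMap.exact_subtype_mkQ N) N.mkQ_surjective t).1 h1

theorem finite_range_contract (t : V ⊗[k] U) :
    FiniteDimensional k (LinearMap.range (contract k V U t)) := by
  suffices ∃ F : Submodule k V, FiniteDimensional k F ∧ LinearMap.range (contract k V U t) ≤ F by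
    obtain ⟨F, hF, hle⟩ := this
    exact Submodule.finiteDimensional_of_le hle
  induction t using TensorProduct.induction_on with
  | zero => exact ⟨⊥, inferInstance, by simp⟩
  | add s t hs ht =>
    obtain ⟨F, _, hF⟩ := hs
    obtain ⟨F', _, hF'⟩ := ht
    refine ⟨F ⊔ F', inferInstance, ?_⟩
    rintro _ ⟨h, rfl⟩
    rw [map_add, LinearMap.add_apply]
    exact add_mem (Submodule.mem_sup_left (hF ⟨h, rfl⟩)) (Submodule.mem_sup_right (hF' ⟨h, rfl⟩))
  | tmul x b =>
    refine ⟨k ∙ x, inferInstance, ?_⟩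
    rintro _ ⟨h, rfl⟩
    rw [contract_tmul]
    exact Submodule.smul_mem _ _ (Submodule.mem_span_singleton_self x)

end Contract

/-! ### Homogeneous components and graded subcomplexes -/

section Graded

variable {k : Type*} [Field k] {V W : Type*} [AddCommGroup V] [Module k V] [DGModule k V]
  [AddCommGroup W] [Module k W] [DGModule k W]

theorem proj_map {f : V →ₗ[k] W} {n : ℤ} (hf : HasDeg n f) (j : ℤ) (x : V) :
    proj (k := k) (j + n) (f x) = f (proj (k := k) j x) := by
  refine homog_induction (k := k)
    (p := fun x => proj (k := k) (j + n) (f x) = f (proj (k := k) j x)) (by simp) ?_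
    (fun a b ha hb => by simp only [map_add, ha, hb]) x
  intro i x hx
  by_cases h : i = j
  · subst h; rw [proj_same hx, proj_same (hf hx)]
  · rw [proj_ne hx h, proj_ne (hf hx) (by omega), map_zero]

theorem HasDeg.mem_of_injective {f : V →ₗ[k] W} (hf : HasDeg 0 f) (hi : Function.Injective f)
    {i : ℤ} {x : V} (hx : f x ∈ gr k W i) : x ∈ gr k V i := by
  refine mem_of_proj fun m hm => hi ?_
  rw [← proj_map hf, map_zero, proj_ne hx (by omega)]

theorem exists_sum_proj (x : V) : ∃ s : Finset ℤ, x = ∑ i ∈ s, proj (k := k) i x := by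
  -- Asking for the equality over every larger index set lets the sets of two summands be replaced
  -- by their union.
  suffices ∃ s : Finset ℤ, ∀ s', s ⊆ s' → x = ∑ i ∈ s', proj (k := k) i x by
    obtain ⟨s, hs⟩ := this
    exact ⟨s, hs s subset_rfl⟩
  classical
  refine homog_induction (k := k)
    (p := fun x : V => ∃ s : Finset ℤ, ∀ s', s ⊆ s' → x = ∑ i ∈ s', proj (k := k) i x)
    ⟨∅, by simp⟩ ?_ ?_ x
  · intro i x hx
    refine ⟨{i}, fun s hs => ?_⟩
    rw [Finset.sum_eq_single i, proj_same hx]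
    · exact fun j _ hj => proj_ne hx (Ne.symm hj)
    · intro h
      exact absurd (hs (Finset.mem_singleton_self i)) h
  · rintro x y ⟨s, hs⟩ ⟨s', hs'⟩
    refine ⟨s ∪ s', fun r hr => ?_⟩
    simp only [map_add, Finset.sum_add_distrib]
    rw [← hs r (Finset.union_subset_left hr), ← hs' r (Finset.union_subset_right hr)]

/-- A graded submodule stable under the differential is a complex. -/
abbrev submoduleDG (N : Submodule k V) (hp : ∀ j, ∀ x ∈ N, proj (k := k) j x ∈ N)
    (hd : ∀ x ∈ N, dif k V x ∈ N) : DGModule k N where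
  gr i := (gr k V i).comap N.subtype
  internal := by
    refine isInternal_of_proj _ ?_ (fun n => (proj (k := k) n).restrict (hp n)) ?_ ?_
    · rw [eq_top_iff]
      rintro ⟨x, hx⟩ -
      obtain ⟨s, hs⟩ := exists_sum_proj (k := k) x
      have : (⟨x, hx⟩ : N) = ∑ i ∈ s, ⟨proj (k := k) i x, hp i x hx⟩ := by
        apply Subtype.ext
        simpa using hs
      rw [this]
      exact sum_mem fun i _ => Submodule.mem_iSup_of_mem i (proj_mem (k := k) i x)
    · intro n x hx
      exact Subtype.ext (proj_same (k := k) hx)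
    · intro m n hmn x hx
      exact Subtype.ext (proj_ne (k := k) hx hmn)
  d := (dif k V).restrict hd
  d_mem := fun {i} {x} hx => DGModule.d_mem (k := k) (x := (x : V)) hx
  d_d x := Subtype.ext (DGModule.d_d (k := k) (x : V))

end Graded

/-! ### Local finiteness: dg-comodules are unions of finite dimensional dg-subcomodules -/

section Subcomodule

variable {k B : Type u} [Field k] [Ring B] [Algebra k B] [DGModule k B] [Coalgebra k B]

/-- `N` is a dg-subcomodule of `M`. -/
structure IsSubcomodule (M : DGComodule k B) (N : Submodule k M) : Prop where
  proj_mem : ∀ j, ∀ x ∈ N, proj (k := k) j x ∈ N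
  dif_mem : ∀ x ∈ N, dif k M x ∈ N
  coact_mem : ∀ x ∈ N, M.coact x ∈ tensorRange B N

theorem IsSubcomodule.sup {M : DGComodule k B} {N N' : Submodule k M} (h : IsSubcomodule M N)
    (h' : IsSubcomodule M N') : IsSubcomodule M (N ⊔ N') where
  proj_mem j x hx := by
    obtain ⟨y, hy, z, hz, rfl⟩ := Submodule.mem_sup.1 hx
    rw [map_add]
    exact Submodule.add_mem_sup (h.proj_mem j y hy) (h'.proj_mem j z hz)
  dif_mem x hx := by
    obtain ⟨y, hy, z, hz, rfl⟩ := Submodule.mem_sup.1 hx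
    rw [map_add]
    exact Submodule.add_mem_sup (h.dif_mem y hy) (h'.dif_mem z hz)
  coact_mem x hx := by
    obtain ⟨y, hy, z, hz, rfl⟩ := Submodule.mem_sup.1 hx
    rw [map_add]
    exact add_mem (tensorRange_mono le_sup_left (h.coact_mem y hy))
      (tensorRange_mono le_sup_right (h'.coact_mem z hz))

section

variable {M : DGComodule k B} {N : Submodule k M} (h : IsSubcomodule M N)

theorem rTensor_subtype_injective {V U : Type*} [AddCommGroup V] [Module k V] [AddCommGroup U]
    [Module k U] (N : Submodule k V) : Function.Injective (N.subtype.rTensor U) :=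
  Module.Flat.rTensor_preserves_injective_linearMap _ N.injective_subtype

/-- The coaction on a subcomodule. -/
def subCoact (h : IsSubcomodule M N) : N →ₗ[k] N ⊗[k] B :=
  (LinearEquiv.ofInjective (N.subtype.rTensor B) (rTensor_subtype_injective N)).symm.toLinearMap ∘ₗ
    (M.coact ∘ₗ N.subtype).codRestrict (tensorRange B N) fun x => h.coact_mem x x.2

/-- Characterizes the restricted coaction. Since `N ⊗ U → M ⊗ U` is injective over a field, each
comodule axiom for `N` is checked after this embedding, where it becomes the axiom for `M`. -/
theorem rTensor_subCoact (x : N) : N.subtype.rTensor B (subCoact h x) = M.coact x := by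
  have := LinearEquiv.apply_symm_apply
    (LinearEquiv.ofInjective (N.subtype.rTensor B) (rTensor_subtype_injective (U := B) N))
    ((M.coact ∘ₗ N.subtype).codRestrict (tensorRange B N) (fun x => h.coact_mem x x.2) x)
  exact congrArg Subtype.val this

/-- A dg-subcomodule as a dg-comodule. -/
def subcomodule (h : IsSubcomodule M N) : DGComodule k B :=
  letI := submoduleDG N h.proj_mem h.dif_mem
  have hs : IsChain N.subtype := ⟨fun i x hx => by rw [add_zero]; exact hx, fun _ => rfl⟩
  { carrier := N
    coact := subCoact h
    coact_chain := by
      refine ⟨fun i x hx => ?_, fun x => ?_⟩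
      · rw [add_zero]
        refine (hs.rTensor (W := B)).deg.mem_of_injective (rTensor_subtype_injective N) ?_
        rw [rTensor_subCoact]
        exact M.coact_chain.deg.zero_mem hx
      · apply rTensor_subtype_injective N
        rw [(hs.rTensor (W := B)).comm, rTensor_subCoact, rTensor_subCoact, ← M.coact_chain.comm]
        rfl
    coassoc := by
      intro x
      have hi : Function.Injective (N.subtype.rTensor (B ⊗[k] B)) := rTensor_subtype_injective N
      apply hi
      rw [rTensor_lTensor, rTensor_subCoact, ← M.coassoc, ← rTensor_subCoact h]
      generalize subCoact h x = t
      induction t using TensorProduct.induction_on with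
      | zero => simp
      | add s t hs ht => simp only [map_add, hs, ht]
      | tmul y b =>
        simp only [LinearMap.rTensor_tmul, Submodule.subtype_apply]
        rw [← rTensor_subCoact h]
        generalize subCoact h y = t
        induction t using TensorProduct.induction_on with
        | zero => simp
        | add s t hs ht => simp only [map_add, add_tmul, hs, ht]
        | tmul z c => simp
    counit := by
      intro x
      have hi : Function.Injective (N.subtype.rTensor k) := rTensor_subtype_injective N
      apply hi
      rw [rTensor_lTensor, rTensor_subCoact, M.counit]
      simp }

/-- The inclusion of a dg-subcomodule. -/
def subIncl (h : IsSubcomodule M N) : subcomodule h →ₗ[k] M := N.subtype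

theorem subIncl_mem (x : subcomodule h) : subIncl h x ∈ N :=
  Subtype.property (p := fun z => z ∈ N) x

theorem subIncl_injective : Function.Injective (subIncl h) := N.injective_subtype

theorem isChain_subIncl : IsChain (subIncl h) :=
  ⟨fun i x hx => by rw [add_zero]; exact hx, fun _ => rfl⟩

theorem isComodHom_subIncl : IsComodHom (subIncl h) :=
  LinearMap.ext fun x => (rTensor_subCoact h x).symm

/-- A finite dimensional dg-subcomodule. -/
abbrev subFD (h : IsSubcomodule M N) (hN : FiniteDimensional k N) : FDComodule k B where
  toDGComodule := subcomodule h
  finite := hN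

theorem rTensor_subIncl_injective {A : Type*} [AddCommGroup A] [Module k A] :
    Function.Injective ((subIncl h).rTensor A) :=
  Module.Flat.rTensor_preserves_injective_linearMap _ (subIncl_injective h)

/-- Corestriction of a linear map to a subcomodule containing the image. -/
def subCorestrict {M' : DGComodule k B} (ψ : M' →ₗ[k] M) (hN : ∀ x, ψ x ∈ N) :
    M' →ₗ[k] subcomodule h := ψ.codRestrict N hN

theorem subIncl_comp_subCorestrict {M' : DGComodule k B} (ψ : M' →ₗ[k] M) (hN : ∀ x, ψ x ∈ N) :
    subIncl h ∘ₗ subCorestrict h ψ hN = ψ := rfl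

theorem isComodHom_subCorestrict {M' : DGComodule k B} {ψ : M' →ₗ[k] M} (hψ : IsComodHom ψ)
    (hN : ∀ x, ψ x ∈ N) : IsComodHom (subCorestrict h ψ hN) := by
  refine LinearMap.ext fun x => ?_
  apply rTensor_subIncl_injective h
  have h1 := LinearMap.congr_fun hψ x
  have h2 := LinearMap.congr_fun (isComodHom_subIncl h) (subCorestrict h ψ hN x)
  simp only [LinearMap.comp_apply] at h1 h2 ⊢
  rw [← h2, ← LinearMap.comp_apply (LinearMap.rTensor B _) (LinearMap.rTensor B _),
    ← LinearMap.rTensor_comp, subIncl_comp_subCorestrict, ← h1]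
  rfl

theorem hasDeg_subCorestrict {M' : DGComodule k B} {ψ : M' →ₗ[k] M} {n : ℤ} (hψ : HasDeg n ψ)
    (hN : ∀ x, ψ x ∈ N) : HasDeg n (subCorestrict h ψ hN) :=
  fun _ _ hx => hψ hx

end

theorem coact_contract (M : DGComodule k B) (t : M ⊗[k] B) (h : Module.Dual k B) :
    M.coact (contract k M B t h) = contract k (M ⊗[k] B) B (M.coact.rTensor B t) h := by
  rw [rTensor_contract]

/-- By coassociativity, functionals on `B` act on `M` through the (unsigned) convolution product.
Hence the orbit of `x` under all functionals is stable under every further contraction. -/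
theorem contract_contract (M : DGComodule k B) (x : M) (g h : Module.Dual k B) :
    contract k M B (M.coact (contract k M B (M.coact x) h)) g =
      contract k M B (M.coact x)
        (LinearMap.mul' k k ∘ₗ TensorProduct.map g h ∘ₗ Coalgebra.comul) := by
  have h1 : ∀ t : (M ⊗[k] B) ⊗[k] B, contract k M B (contract k (M ⊗[k] B) B t h) g =
      contract k M (B ⊗[k] B) (TensorProduct.assoc k M B B t)
        (LinearMap.mul' k k ∘ₗ TensorProduct.map g h) := by
    intro t
    induction t using TensorProduct.induction_on with
    | zero => simp
    | add s t hs ht => simp only [map_add, LinearMap.add_apply, hs, ht]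
    | tmul s b =>
      induction s using TensorProduct.induction_on with
      | zero => simp
      | add s t hs ht => simp only [add_tmul, map_add, LinearMap.add_apply, hs, ht]
      | tmul y c => simp [smul_smul, mul_comm]
  have h2 : ∀ t : M ⊗[k] B, contract k M (B ⊗[k] B)
      ((Coalgebra.comul (R := k) (A := B)).lTensor M t)
        (LinearMap.mul' k k ∘ₗ TensorProduct.map g h) = contract k M B t
        (LinearMap.mul' k k ∘ₗ TensorProduct.map g h ∘ₗ Coalgebra.comul) := by
    intro t
    induction t using TensorProduct.induction_on with
    | zero => simp
    | add s t hs ht => simp only [map_add, LinearMap.add_apply, hs, ht]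
    | tmul y c => simp
  rw [coact_contract, h1, M.coassoc, h2]

/-- In total degree `i`, the part of `t` with left degree `j` has right degree `i - j`, so
projecting the result amounts to changing the functional. Therefore the orbit of a homogeneous
element is a graded subspace. -/
theorem proj_contract {M : DGComodule k B} {i : ℤ} {t : M ⊗[k] B} (ht : t ∈ gr k (M ⊗[k] B) i)
    (j : ℤ) (h : Module.Dual k B) :
    proj (k := k) j (contract k M B t h) =
      contract k M B t (h ∘ₗ proj (k := k) (i - j)) := by
  refine tensor_induction (p := fun t => proj (k := k) j (contract k M B t h) =
      contract k M B t (h ∘ₗ proj (k := k) (i - j))) (by simp)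
    (fun s t hs ht => by simp only [map_add, LinearMap.add_apply, hs, ht])
    (fun c t ht => by simp only [map_smul, LinearMap.smul_apply, ht]) ?_ ht
  intro p q x b hpq hx hb
  simp only [contract_tmul, map_smul, LinearMap.comp_apply]
  by_cases hp : p = j
  · rw [show i - j = q by omega, proj_same hb, ← hp, proj_same hx]
  · rw [proj_ne hx hp, proj_ne hb (show q ≠ i - j by omega)]
    simp

/-- The orbit `N₁` of `x` under contraction by functionals is finite dimensional, graded and stable
under the coaction, but need not be stable under `d`. The sum `N₁ + d N₁` is stable under `d`
because `d² = 0`, and under the coaction because the coaction is a cochain map. -/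
theorem exists_subcomodule_of_homogeneous (M : DGComodule k B) {i : ℤ} {x : M}
    (hx : x ∈ gr k M i) :
    ∃ N : Submodule k M, IsSubcomodule M N ∧ FiniteDimensional k N ∧ x ∈ N := by
  let N₁ := LinearMap.range (contract k M B (M.coact x))
  have hfin : FiniteDimensional k N₁ := finite_range_contract _
  have hp : ∀ j, ∀ y ∈ N₁, proj (k := k) j y ∈ N₁ := by
    rintro j _ ⟨h, rfl⟩
    rw [proj_contract (M.coact_chain.deg.zero_mem hx)]
    exact ⟨_, rfl⟩
  have hc : ∀ y ∈ N₁, M.coact y ∈ tensorRange B N₁ := by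
    rintro _ ⟨h, rfl⟩
    refine mem_tensorRange fun g => ?_
    rw [contract_contract]
    exact ⟨_, rfl⟩
  have hxN : x ∈ N₁ := by
    -- Contracting `γ(x)` with the counit returns `x`.
    refine ⟨Coalgebra.counit, ?_⟩
    have h1 : ∀ t : M ⊗[k] B, contract k M B t Coalgebra.counit =
        TensorProduct.rid k M ((Coalgebra.counit (R := k) (A := B)).lTensor M t) := by
      intro t
      induction t using TensorProduct.induction_on with
      | zero => simp
      | add s t hs ht => simp only [map_add, LinearMap.add_apply, hs, ht]
      | tmul y c => simp
    rw [h1, M.counit]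
    simp
  -- The Leibniz rule: `d (N₁ ⊗ B)` is contained in `d N₁ ⊗ B + N₁ ⊗ B`. It needs homogeneous left
  -- factors, which `hp` keeps inside `N₁`.
  have hd : ∀ t ∈ tensorRange B N₁, dif k (M ⊗[k] B) t ∈
      tensorRange B (N₁ ⊔ N₁.map (dif k M)) := by
    suffices tensorRange B N₁ ≤ (tensorRange B (N₁ ⊔ N₁.map (dif k M))).comap
      (dif k (M ⊗[k] B)) from this
    refine tensorRange_le fun y hy b => ?_
    obtain ⟨s, hs⟩ := exists_sum_proj (k := k) y
    rw [hs, sum_tmul]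
    refine sum_mem fun j _ => ?_
    rw [Submodule.mem_comap, dif_tmul (proj_mem j y)]
    refine add_mem (tmul_mem_tensorRange (Submodule.mem_sup_right
      (Submodule.mem_map_of_mem (hp j y hy))) _)
      (Submodule.smul_mem _ _ (tmul_mem_tensorRange (Submodule.mem_sup_left (hp j y hy)) _))
  refine ⟨N₁ ⊔ N₁.map (dif k M), ⟨?_, ?_, ?_⟩, inferInstance, Submodule.mem_sup_left hxN⟩
  · intro j y hy
    obtain ⟨w, hw, _, ⟨z, hz, rfl⟩, rfl⟩ := Submodule.mem_sup.1 hy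
    rw [map_add]
    refine Submodule.add_mem_sup (hp j w hw) (Submodule.mem_map.2
      ⟨proj (k := k) (j - 1) z, hp _ z hz, ?_⟩)
    -- The degree `j` part of `d z` is `d` of the degree `j - 1` part of `z`.
    rw [← proj_map dif_deg, sub_add_cancel]
  · intro y hy
    obtain ⟨w, hw, _, ⟨z, hz, rfl⟩, rfl⟩ := Submodule.mem_sup.1 hy
    rw [map_add, DGModule.d_d, add_zero]
    exact Submodule.mem_sup_right ⟨w, hw, rfl⟩
  · intro y hy
    obtain ⟨w, hw, _, ⟨z, hz, rfl⟩, rfl⟩ := Submodule.mem_sup.1 hy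
    rw [map_add, M.coact_chain.comm]
    exact add_mem (tensorRange_mono le_sup_left (hc w hw)) (hd _ (hc z hz))

/-- Every element of a dg-comodule lies in a finite dimensional dg-subcomodule. -/
theorem exists_subcomodule (M : DGComodule k B) (x : M) :
    ∃ N : Submodule k M, IsSubcomodule M N ∧ FiniteDimensional k N ∧ x ∈ N := by
  refine homog_induction (k := k) (p := fun x : M => ∃ N : Submodule k M, IsSubcomodule M N ∧
    FiniteDimensional k N ∧ x ∈ N)
    ?_ (fun i x hx => exists_subcomodule_of_homogeneous M hx) ?_ x
  · exact exists_subcomodule_of_homogeneous M (zero_mem (gr k M 0))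
  · rintro x y ⟨N, h, _, hx⟩ ⟨N', h', _, hy⟩
    exact ⟨N ⊔ N', h.sup h', inferInstance, Submodule.add_mem_sup hx hy⟩

theorem exists_subcomodule_ge (M : DGComodule k B) (P : Submodule k M) (hP : P.FG) :
    ∃ N : Submodule k M, IsSubcomodule M N ∧ FiniteDimensional k N ∧ P ≤ N := by
  induction P, hP using Submodule.fg_induction with
  | singleton x =>
    obtain ⟨N, h, hf, hx⟩ := exists_subcomodule M x
    exact ⟨N, h, hf, by simpa using hx⟩
  | sup P P' hP hP' h h' =>
    obtain ⟨N, h, _, hx⟩ := h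
    obtain ⟨N', h', _, hy⟩ := h'
    exact ⟨N ⊔ N', h.sup h', inferInstance, sup_le_sup hx hy⟩

theorem exists_subcomodule_tensor (M : DGComodule k B) {A : Type*} [AddCommGroup A] [Module k A]
    (t : M ⊗[k] A) : ∃ N : Submodule k M, IsSubcomodule M N ∧ FiniteDimensional k N ∧
      t ∈ tensorRange A N := by
  induction t using TensorProduct.induction_on with
  | zero =>
    obtain ⟨N, h, hf, _⟩ := exists_subcomodule M 0
    exact ⟨N, h, hf, zero_mem _⟩
  | add s t hs ht =>
    obtain ⟨N, h, _, hx⟩ := hs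
    obtain ⟨N', h', _, hy⟩ := ht
    exact ⟨N ⊔ N', h.sup h', inferInstance, add_mem (tensorRange_mono le_sup_left hx)
      (tensorRange_mono le_sup_right hy)⟩
  | tmul x a =>
    obtain ⟨N, h, hf, hx⟩ := exists_subcomodule M x
    exact ⟨N, h, hf, tmul_mem_tensorRange hx a⟩

theorem exists_subIncl_rTensor_eq (M : DGComodule k B) {A : Type*} [AddCommGroup A] [Module k A]
    (t : M ⊗[k] A) : ∃ (N : Submodule k M) (hN : IsSubcomodule M N), FiniteDimensional k N ∧
      ∃ s : subcomodule hN ⊗[k] A, (subIncl hN).rTensor A s = t := by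
  obtain ⟨N, hN, hf, s, hs⟩ := exists_subcomodule_tensor M t
  exact ⟨N, hN, hf, s, hs⟩

end Subcomodule

/-! ### Extension from finite dimensional comodules to all comodules -/

section Colim

variable {k B : Type u} [Field k] [Ring B] [Algebra k B] [DGModule k B] [Coalgebra k B]
variable {A : Type v} [Ring A] [Algebra k A] [DGModule k A]

/-- Each element of `M ⊗ A` comes from `N ⊗ A` for a finite dimensional dg-subcomodule `N`, where an
extension is prescribed by `ξ^N`. -/
theorem IsColimExtension.unique {ξ : FamF k B A} {ζ ζ' : Fam k B A} (h : IsColimExtension ξ ζ)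
    (h' : IsColimExtension ξ ζ') : ζ = ζ' := by
  funext M
  refine LinearMap.ext fun t => ?_
  obtain ⟨N, hN, hf, s, rfl⟩ := exists_subIncl_rTensor_eq M t
  have h1 := LinearMap.congr_fun (h M (subFD hN hf) (subIncl hN) (subIncl_injective hN)
    (isChain_subIncl hN) (isComodHom_subIncl hN)) s
  have h2 := LinearMap.congr_fun (h' M (subFD hN hf) (subIncl hN) (subIncl_injective hN)
    (isChain_subIncl hN) (isComodHom_subIncl hN)) s
  exact h1.trans h2.symm

/-- `limA` is a chosen extension, meaningful only when one exists; uniqueness then identifies the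
choice with any extension at hand. -/
theorem IsColimExtension.limA_eq {ξ : FamF k B A} {ζ : Fam k B A} (h : IsColimExtension ξ ζ) :
    limA ξ = ζ :=
  (Classical.epsilon_spec (p := IsColimExtension ξ) ⟨ζ, h⟩).unique h

/-- A finite dimensional comodule is a subcomodule of itself. -/
theorem IsColimExtension.res_eq {ξ : FamF k B A} {ζ : Fam k B A} (h : IsColimExtension ξ ζ) :
    res ζ = ξ := by
  funext M
  have := h M.toDGComodule M LinearMap.id Function.injective_id IsChain.id (by simp [IsComodHom])
  simpa [res] using this

theorem IsColimExtension.add {ξ ξ' : FamF k B A} {ζ ζ' : Fam k B A} (h : IsColimExtension ξ ζ)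
    (h' : IsColimExtension ξ' ζ') : IsColimExtension (ξ + ξ') (ζ + ζ') := by
  intro M N ι hi hc hι
  simp only [Pi.add_apply, LinearMap.add_comp, LinearMap.comp_add, h M N ι hi hc hι,
    h' M N ι hi hc hι]

theorem isColimExtension_zero : IsColimExtension (0 : FamF k B A) 0 := by
  intro M N ι _ _ _
  simp

end Colim

/-! ### Natural endomorphisms are represented by linear maps `B → A` -/

section Representation

variable {k B : Type u} [Field k] [Ring B] [Algebra k B] [DGModule k B] [Coalgebra k B]
variable {A : Type v} [Ring A] [Algebra k A] [DGModule k A]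

/-- Functionals on `M` separate the elements of `M ⊗ A`, and homogeneous ones suffice since they
span the dual. The restriction to homogeneous `e` matters because naturality is only assumed for
homogeneous morphisms. -/
theorem eq_of_dual {M : Type*} [AddCommGroup M] [Module k M] [DGModule k M] [Module.Finite k M]
    {t t' : M ⊗[k] A} (h : ∀ (j : ℤ) (e : Module.Dual k M), e ∈ gr k (Module.Dual k M) j →
      TensorProduct.lid k A (e.rTensor A t) = TensorProduct.lid k A (e.rTensor A t')) : t = t' := by
  have h1 : ∀ (e : Module.Dual k M), TensorProduct.lid k A (e.rTensor A (t - t')) = 0 := by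
    intro e
    refine homog_induction (k := k) (V := Module.Dual k M)
      (p := fun e => TensorProduct.lid k A (LinearMap.rTensor A e (t - t')) = 0) (by simp) ?_ ?_ e
    · intro j e he
      rw [map_sub, map_sub, h j e he, sub_self]
    · intro a b ha hb
      rw [LinearMap.rTensor_add, LinearMap.add_apply, map_add, ha, hb, add_zero]
  have h2 : ∀ (s : M ⊗[k] A) (e : Module.Dual k M),
      contract k A M (TensorProduct.comm k M A s) e = TensorProduct.lid k A (e.rTensor A s) := by
    intro s e
    induction s using TensorProduct.induction_on with
    | zero => simp
    | add s t hs ht => simp only [map_add, LinearMap.add_apply, hs, ht]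
    | tmul x b => simp
  rw [← sub_eq_zero]
  apply (TensorProduct.comm k M A).injective
  rw [map_zero]
  exact eq_zero_of_contract fun e => by rw [h2, h1]

/-- The matrix coefficient map `x ↦ h(x₀) x₁`. -/
def coeff (M : DGComodule k B) (h : Module.Dual k M) : M →ₗ[k] B :=
  (TensorProduct.lid k B).toLinearMap ∘ₗ h.rTensor B ∘ₗ M.coact

theorem counit_coeff (M : DGComodule k B) (h : Module.Dual k M) :
    Coalgebra.counit (R := k) (A := B) ∘ₗ coeff M h = h := by
  have h1 : Coalgebra.counit (R := k) (A := B) ∘ₗ (TensorProduct.lid k B).toLinearMap ∘ₗ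
      h.rTensor B = h ∘ₗ (TensorProduct.rid k M).toLinearMap ∘ₗ
        (Coalgebra.counit (R := k) (A := B)).lTensor M := by
    apply TensorProduct.ext'
    intro x b
    simp [mul_comm]
  ext x
  have h2 := LinearMap.congr_fun h1 (M.coact x)
  simp only [LinearMap.comp_apply, M.counit] at h2
  simp only [coeff, LinearMap.comp_apply, h2]
  simp

theorem hasDeg_coeff (M : DGComodule k B) [Module.Finite k M] {j : ℤ} {h : Module.Dual k M}
    (hh : h ∈ gr k (Module.Dual k M) j) : HasDeg j (coeff M h) := by
  intro i x hx
  simp only [coeff, LinearMap.comp_apply]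
  refine tensor_induction (p := fun t => (TensorProduct.lid k B).toLinearMap
    (h.rTensor B t) ∈ gr k B (i + j)) (by simp)
    (fun s t hs ht => by simpa using add_mem hs ht)
    (fun c t ht => by simpa using Submodule.smul_mem _ c ht) ?_ (M.coact_chain.deg.zero_mem hx)
  intro a b y β hab hy hβ
  rw [LinearMap.rTensor_tmul, LinearEquiv.coe_coe, lid_tmul]
  by_cases ha : a + j = 0
  · refine Submodule.smul_mem _ _ ?_
    rwa [show i + j = b by omega]
  · simp [dual_eval_zero hh hy ha]

variable [CDGHopfAlgebra k B]

variable (k B) in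
/-- The regular comodule `B`. -/
abbrev DGComodule.regular : DGComodule k B where
  carrier := B
  coact := Coalgebra.comul
  coact_chain := CDGHopfAlgebra.comul_chain
  coassoc x := Coalgebra.coassoc_apply x
  counit x := Coalgebra.lTensor_counit_comul x

/-- Coassociativity of `M`. The functional `h` need not be a cocycle, so `coeff M h` need not
commute with the differentials; naturality covers such morphisms as well, which makes the
reconstruction of `f` possible. -/
theorem isComodHom_coeff (M : DGComodule k B) (h : Module.Dual k M) :
    IsComodHom (M := M) (N := DGComodule.regular k B) (coeff M h) := by
  refine LinearMap.ext fun x => ?_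
  have h1 : Coalgebra.comul (R := k) (A := B) ∘ₗ (TensorProduct.lid k B).toLinearMap ∘ₗ
      h.rTensor B = (TensorProduct.lid k (B ⊗[k] B)).toLinearMap ∘ₗ h.rTensor (B ⊗[k] B) ∘ₗ
        (Coalgebra.comul (R := k) (A := B)).lTensor M := by
    apply TensorProduct.ext'
    intro x b
    simp
  have h2 := LinearMap.congr_fun h1 (M.coact x)
  simp only [LinearMap.comp_apply, ← M.coassoc] at h2
  simp only [LinearMap.comp_apply]
  refine h2.trans ?_
  generalize M.coact x = t
  induction t using TensorProduct.induction_on with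
  | zero => simp
  | add s t hs ht => simp only [map_add, hs, ht]
  | tmul y b =>
    simp only [LinearMap.rTensor_tmul, coeff, LinearMap.comp_apply]
    generalize M.coact y = t
    induction t using TensorProduct.induction_on with
    | zero => simp
    | add s t hs ht => simp only [map_add, add_tmul, hs, ht]
    | tmul z c => simp [← smul_tmul']

variable (k B A) in
/-- The map `b ⊗ a ↦ ε(b) a`. -/
def counitA : B ⊗[k] A →ₗ[k] A :=
  (TensorProduct.lid k A).toLinearMap ∘ₗ (Coalgebra.counit (R := k) (A := B)).rTensor A

omit [DGModule k A] [CDGHopfAlgebra k B] [DGModule k B] in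
@[simp] theorem counitA_tmul (b : B) (a : A) :
    counitA k B A (b ⊗ₜ a) = Coalgebra.counit (R := k) b • a := by
  simp [counitA]

theorem counit_eq_zero {i : ℤ} {b : B} (hb : b ∈ gr k B i) (hi : i ≠ 0) :
    Coalgebra.counit (R := k) b = 0 :=
  eq_zero_of_mem_gr_self hi ((CDGHopfAlgebra.counit_chain (k := k) (B := B)).deg.zero_mem hb)

theorem hasDeg_counitA : HasDeg 0 (counitA k B A) := by
  refine hasDeg_tensor fun i j b a hb ha => ?_
  rw [counitA_tmul]
  by_cases hi : i = 0
  · refine Submodule.smul_mem _ _ ?_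
    rwa [hi, zero_add, add_zero]
  · simp [counit_eq_zero hb hi]

omit [DGModule k A] in
theorem counitA_rmul (a : A) (t : B ⊗[k] A) :
    counitA k B A (rmul k B a t) = counitA k B A t * a := by
  induction t using TensorProduct.induction_on with
  | zero => simp
  | add s t hs ht => simp only [map_add, add_mul, hs, ht]
  | tmul x b => simp

/-- The Koszul sign of carrying `f` past the left factor is invisible, since the counit vanishes
outside degree `0`. -/
theorem counitA_lten {f : B →ₗ[k] A} {n : ℤ} (hf : HasDeg n f) (t : B ⊗[k] B) :
    counitA k B A (lten B f t) = f (counitA k B B t) := by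
  refine tensor_induction' (k := k) (p := fun t => counitA k B A (lten B f t) =
    f (counitA k B B t)) (by simp) (fun s t hs ht => by simp only [map_add, hs, ht]) ?_ t
  intro i j b c hb hc
  rw [lten_tmul hf hb, map_smul, counitA_tmul, counitA_tmul, map_smul]
  by_cases hi : i = 0
  · simp [hi]
  · simp [counit_eq_zero hb hi]

/-- Recovers `f` from its family by evaluation on the regular comodule; the construction of `f` from
an arbitrary family imitates this. -/
theorem counitA_convEnd {f : B →ₗ[k] A} {n : ℤ} (hf : HasDeg n f) (b : B) (a : A) :
    counitA k B A (convEnd f (DGComodule.regular k B) (b ⊗ₜ a)) = f b * a := by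
  have h : counitA k B B (Coalgebra.comul (R := k) b) = b := by simp [counitA]
  rw [convEnd_tmul, counitA_rmul, counitA_lten hf, h]

/-- The functional on a finite dimensional subcomodule of `B` attached to a family. -/
def repOn (ξ : FamF k B A) {N : Submodule k (DGComodule.regular k B)}
    (h : IsSubcomodule (DGComodule.regular k B) N) (hN : FiniteDimensional k N) :
    subcomodule h →ₗ[k] A :=
  counitA k B A ∘ₗ (subIncl h).rTensor A ∘ₗ qmap (ξ (subFD h hN))

/-- Naturality of `ξ` along the inclusion of `N` in `N'`, which has degree `0` and hence no sign. -/
theorem repOn_mono {ξ : FamF k B A} {n : ℤ} (hξ : ξ ∈ NatEndF k B A n)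
    {N N' : Submodule k (DGComodule.regular k B)}
    (h : IsSubcomodule (DGComodule.regular k B) N) (hN : FiniteDimensional k N)
    (h' : IsSubcomodule (DGComodule.regular k B) N') (hN' : FiniteDimensional k N')
    (hle : N ≤ N') (x : subcomodule h) (x' : subcomodule h') (hx : subIncl h x = subIncl h' x') :
    repOn ξ h hN x = repOn ξ h' hN' x' := by
  have hm : ∀ y, subIncl h y ∈ N' := fun y => hle (subIncl_mem h y)
  have key := hξ.2.2 (subFD h hN) (subFD h' hN') 0 (subCorestrict h' (subIncl h) hm)
    (hasDeg_subCorestrict h' (isChain_subIncl h).deg hm)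
    (isComodHom_subCorestrict h' (isComodHom_subIncl h) hm)
  rw [zero_mul, zpow_zero, one_smul] at key
  have h1 := LinearMap.congr_fun key (x ⊗ₜ 1)
  have h2 : subCorestrict h' (subIncl h) hm x = x' := subIncl_injective h' hx
  simp only [LinearMap.comp_apply, LinearMap.rTensor_tmul, h2] at h1
  simp only [repOn, LinearMap.comp_apply, qmap_apply, ← h1]
  rw [← LinearMap.comp_apply (LinearMap.rTensor A _) (LinearMap.rTensor A _),
    ← LinearMap.rTensor_comp, subIncl_comp_subCorestrict]

/-- Two finite dimensional subcomodules are compared inside their sum. This is the gluing condition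
for the functionals `repOn`. -/
theorem repOn_congr {ξ : FamF k B A} {n : ℤ} (hξ : ξ ∈ NatEndF k B A n)
    {N N' : Submodule k (DGComodule.regular k B)}
    (h : IsSubcomodule (DGComodule.regular k B) N) (hN : FiniteDimensional k N)
    (h' : IsSubcomodule (DGComodule.regular k B) N') (hN' : FiniteDimensional k N')
    (x : subcomodule h) (x' : subcomodule h') (hx : subIncl h x = subIncl h' x') :
    repOn ξ h hN x = repOn ξ h' hN' x' := by
  have hs : FiniteDimensional k (N ⊔ N' : Submodule k _) := inferInstance
  let y : subcomodule (h.sup h') :=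
    (⟨subIncl h x, Submodule.mem_sup_left (subIncl_mem h x)⟩ :
      (N ⊔ N' : Submodule k _))
  rw [repOn_mono hξ h hN (h.sup h') hs le_sup_left x y rfl,
    repOn_mono hξ h' hN' (h.sup h') hs le_sup_right x' y hx.symm]

variable [CDGAlgebra k A]

theorem exists_rep {ξ : FamF k B A} {n : ℤ} (hξ : ξ ∈ NatEndF k B A n) :
    ∃ f : B →ₗ[k] A, HasDeg n f ∧ ∀ (N : Submodule k (DGComodule.regular k B))
      (h : IsSubcomodule (DGComodule.regular k B) N) (hN : FiniteDimensional k N)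
      (x : subcomodule h), repOn ξ h hN x = f (subIncl h x) := by
  -- Each `b` gets its own subcomodule; by `repOn_congr` the value does not depend on the choice, so
  -- linearity may be tested in any common larger subcomodule.
  choose N h hN hx using exists_subcomodule (DGComodule.regular k B)
  let mk : ∀ b, subcomodule (h b) := fun b => (⟨b, hx b⟩ : N b)
  let f : B →ₗ[k] A :=
    { toFun := fun b => repOn ξ (h b) (hN b) (mk b)
      map_add' := by
        intro b c
        have hb := hN b
        have hc := hN c
        have hs : FiniteDimensional k (N b ⊔ N c : Submodule k _) := inferInstance
        let y : subcomodule ((h b).sup (h c)) :=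
          (⟨b, Submodule.mem_sup_left (hx b)⟩ : (N b ⊔ N c : Submodule k _))
        let z : subcomodule ((h b).sup (h c)) :=
          (⟨c, Submodule.mem_sup_right (hx c)⟩ : (N b ⊔ N c : Submodule k _))
        rw [repOn_congr hξ (h b) (hN b) ((h b).sup (h c)) hs (mk b) y rfl,
          repOn_congr hξ (h c) (hN c) ((h b).sup (h c)) hs (mk c) z rfl,
          repOn_congr hξ (h (b + c)) (hN (b + c)) ((h b).sup (h c)) hs (mk (b + c)) (y + z) rfl,
          map_add]
      map_smul' := by
        intro r b
        rw [repOn_congr hξ (h (r • b)) (hN (r • b)) (h b) (hN b) (mk (r • b)) (r • mk b) rfl,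
          map_smul, RingHom.id_apply] }
  refine ⟨f, fun i b hb => ?_, fun N' h' hN' x => repOn_congr hξ h' hN' _ _ x _ rfl⟩
  have h1 : mk b ∈ gr k (subcomodule (h b)) i := hb
  have h2 : mk b ⊗ₜ[k] (1 : A) ∈ gr k (subcomodule (h b) ⊗[k] A) i :=
    mem_tensor h1 CDGAlgebra.one_mem (add_zero i)
  exact hasDeg_counitA.zero_mem ((isChain_subIncl (h b)).rTensor.deg.zero_mem
    (by simpa using hξ.1 (subFD (h b) (hN b)) h2))

/-- A Yoneda argument. For a homogeneous functional `e` on `M`, the counit composed with `coeff M e`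
is `e`, so `e` applied to `ξ^M (x ⊗ 1)` equals, up to the naturality sign, `f` applied to `coeff M e
x`. The family of `f` obeys the same formula with the same sign, and the functionals `e` separate.
-/
theorem exists_eq_res_convEnd {ξ : FamF k B A} {n : ℤ} (hξ : ξ ∈ NatEndF k B A n) :
    ∃ f : B →ₗ[k] A, HasDeg n f ∧ ξ = res (convEnd f) := by
  obtain ⟨f, hf, hfN⟩ := exists_rep hξ
  refine ⟨f, hf, ?_⟩
  funext M
  refine (hξ.2.1 M).ext (isALinear_convEnd f M.toDGComodule) fun x => eq_of_dual fun j e he => ?_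
  -- The regular comodule may be infinite dimensional, where `ξ` is not defined; the morphism is
  -- therefore corestricted to a finite dimensional subcomodule containing its image.
  obtain ⟨N, hN, hfin, hle⟩ := exists_subcomodule_ge (DGComodule.regular k B)
    (LinearMap.range (coeff M.toDGComodule e)) (by
      rw [LinearMap.range_eq_map]; exact Module.Finite.fg_top.map _)
  have hm : ∀ y, coeff M.toDGComodule e y ∈ N := fun y => hle ⟨y, rfl⟩
  have h0 : ∀ t : M.toDGComodule ⊗[k] A, TensorProduct.lid k A (e.rTensor A t) =
      counitA k B A ((coeff M.toDGComodule e).rTensor A t) := by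
    intro t
    simp only [counitA, LinearMap.comp_apply, LinearEquiv.coe_coe]
    rw [← LinearMap.comp_apply (LinearMap.rTensor A _) (LinearMap.rTensor A _),
      ← LinearMap.rTensor_comp, counit_coeff]
  have h1 := LinearMap.congr_fun (hξ.2.2 M (subFD hN hfin) j
    (subCorestrict hN (coeff M.toDGComodule e) hm) (hasDeg_subCorestrict hN (hasDeg_coeff _ he) hm)
    (isComodHom_subCorestrict hN (isComodHom_coeff _ e) hm)) (x ⊗ₜ 1)
  have h2 := LinearMap.congr_fun (convEnd_natural hf (hasDeg_coeff _ he)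
    (isComodHom_coeff M.toDGComodule e)) (x ⊗ₜ 1)
  have h3 := hfN N hN hfin (subCorestrict hN (coeff M.toDGComodule e) hm x)
  simp only [LinearMap.comp_apply, LinearMap.smul_apply, LinearMap.rTensor_tmul] at h1 h2
  rw [h0, h0]
  refine Eq.trans ?_ (congrArg (counitA k B A) h2).symm
  have h4 : (coeff M.toDGComodule e).rTensor A (ξ M (x ⊗ₜ 1)) = (subIncl hN).rTensor A
      ((subCorestrict hN (coeff M.toDGComodule e) hm).rTensor A (ξ M (x ⊗ₜ 1))) := by
    rw [← LinearMap.comp_apply (LinearMap.rTensor A _) (LinearMap.rTensor A _),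
      ← LinearMap.rTensor_comp, subIncl_comp_subCorestrict]
  rw [h4, h1, map_smul, map_smul, map_smul, counitA_convEnd hf, mul_one]
  congr 1
  simp only [repOn, LinearMap.comp_apply, qmap_apply] at h3
  exact h3

/-- Both `η` and `convEnd f` extend the restriction of `η`, so they coincide. -/
theorem exists_eq_convEnd {η : Fam k B A} {n : ℤ} (hη : η ∈ NatEnd k B A n) :
    ∃ f : B →ₗ[k] A, HasDeg n f ∧ η = convEnd f := by
  obtain ⟨f, hf, h⟩ := exists_eq_res_convEnd (res_mem_natEndF hη)
  refine ⟨f, hf, (isColimExtension_res hη).unique ?_⟩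
  rw [h]
  exact isColimExtension_res (convEnd_mem_natEnd hf)

end Representation

/-! ### Tensor products over `A` and the dual of an endomorphism, on elements -/

section TensorA

variable {k : Type*} [Field k]
variable {M N M' N' V W X Y : Type*} [AddCommGroup M] [Module k M] [DGModule k M]
  [AddCommGroup N] [Module k N] [DGModule k N] [AddCommGroup M'] [Module k M'] [DGModule k M']
  [AddCommGroup N'] [Module k N'] [DGModule k N']
  [AddCommGroup V] [Module k V] [DGModule k V] [AddCommGroup W] [Module k W] [DGModule k W]
  [AddCommGroup X] [Module k X] [DGModule k X] [AddCommGroup Y] [Module k Y] [DGModule k Y]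
variable {A : Type*} [Ring A] [Algebra k A] [DGModule k A] [CDGAlgebra k A]

theorem HasDeg.comp {g : W →ₗ[k] X} {f : V →ₗ[k] W} {m n : ℤ} (hg : HasDeg m g)
    (hf : HasDeg n f) : HasDeg (n + m) (g ∘ₗ f) := fun i x hx => by
  rw [← add_assoc]
  exact hg (hf hx)

theorem hasDeg_rTensor {f : V →ₗ[k] W} {n : ℤ} (hf : HasDeg n f) : HasDeg n (f.rTensor X) :=
  hasDeg_tensor fun i j x y hx hy => mem_tensor (hf hx) hy (by ring)

theorem hasDeg_qmap {φ : M ⊗[k] A →ₗ[k] N ⊗[k] A} {n : ℤ} (hφ : HasDeg n φ) :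
    HasDeg n (qmap φ) := fun i x hx => by
  rw [qmap_apply]
  exact hφ (mem_tensor hx CDGAlgebra.one_mem (add_zero i))

theorem tensorA_eq (φ : M ⊗[k] A →ₗ[k] N ⊗[k] A) (φ' : M' ⊗[k] A →ₗ[k] N' ⊗[k] A) :
    tensorA φ φ' = mulSwap k A N N' ∘ₗ (qmap φ).rTensor (N' ⊗[k] A) ∘ₗ lten M φ' ∘ₗ
      (TensorProduct.assoc k M M' A).toLinearMap := rfl

theorem tensorA_apply (φ : M ⊗[k] A →ₗ[k] N ⊗[k] A) (φ' : M' ⊗[k] A →ₗ[k] N' ⊗[k] A)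
    (t : (M ⊗[k] M') ⊗[k] A) : tensorA φ φ' t = mulSwap k A N N'
      ((qmap φ).rTensor (N' ⊗[k] A) (lten M φ' (TensorProduct.assoc k M M' A t))) := by
  rw [tensorA_eq, LinearMap.comp_apply, LinearMap.comp_apply, LinearMap.comp_apply,
    LinearEquiv.coe_coe]

theorem hasDeg_tensorA {φ : M ⊗[k] A →ₗ[k] N ⊗[k] A} {φ' : M' ⊗[k] A →ₗ[k] N' ⊗[k] A} {n n' : ℤ}
    (hφ : HasDeg n φ) (hφ' : HasDeg n' φ') : HasDeg (n + n') (tensorA φ φ') := by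
  intro i t ht
  have h1 : TensorProduct.assoc k M M' A t ∈ gr k (M ⊗[k] (M' ⊗[k] A)) i :=
    IsChain.assoc.deg.zero_mem ht
  have h2 := hasDeg_lten (X := M) hφ' h1
  have h3 := hasDeg_rTensor (X := N' ⊗[k] A) (hasDeg_qmap hφ) h2
  rw [show i + (n + n') = i + n' + n by ring, tensorA_apply]
  exact IsChain.mulSwap.deg.zero_mem h3

theorem tensorA_tmul (φ : M ⊗[k] A →ₗ[k] N ⊗[k] A) {φ' : M' ⊗[k] A →ₗ[k] N' ⊗[k] A} {n i : ℤ}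
    (hφ' : HasDeg n φ') {x : M} (hx : x ∈ gr k M i) (y : M') (a : A) :
    tensorA φ φ' ((x ⊗ₜ y) ⊗ₜ a) =
      (-1 : k) ^ (n * i) • mulSwap k A N N' (φ (x ⊗ₜ 1) ⊗ₜ φ' (y ⊗ₜ a)) := by
  rw [tensorA_apply, assoc_tmul, lten_tmul hφ' hx, map_smul, map_smul, LinearMap.rTensor_tmul,
    qmap_apply]

theorem tensorA_tmul_zero (φ : M ⊗[k] A →ₗ[k] N ⊗[k] A) {φ' : M' ⊗[k] A →ₗ[k] N' ⊗[k] A}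
    (hφ' : HasDeg 0 φ') (x : M) (y : M') (a : A) :
    tensorA φ φ' ((x ⊗ₜ y) ⊗ₜ a) = mulSwap k A N N' (φ (x ⊗ₜ 1) ⊗ₜ φ' (y ⊗ₜ a)) := by
  rw [tensorA_apply, assoc_tmul, lten_eq_lTensor hφ', LinearMap.lTensor_tmul,
    LinearMap.rTensor_tmul, qmap_apply]

theorem mulSwap_one (x : M) (t : N ⊗[k] A) :
    mulSwap k A M N ((x ⊗ₜ 1) ⊗ₜ t) = (TensorProduct.assoc k M N A).symm (x ⊗ₜ t) := by
  refine tensor_induction' (k := k) (p := fun t => mulSwap k A M N ((x ⊗ₜ 1) ⊗ₜ t) =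
    (TensorProduct.assoc k M N A).symm (x ⊗ₜ t)) (by simp)
    (fun s t hs ht => by simp only [tmul_add, map_add, hs, ht]) ?_ t
  intro i j y a hy ha
  rw [mulSwap_tmul _ _ CDGAlgebra.one_mem hy]
  simp

theorem hasDeg_id : HasDeg 0 (LinearMap.id : V →ₗ[k] V) := IsChain.id.deg

/-- `y ⊗ x ↦ ev(z ⊗ y) x`. -/
def evalLeft (ev : Y ⊗[k] M →ₗ[k] k) (y : Y) : M ⊗[k] Y →ₗ[k] Y :=
  (TensorProduct.lid k Y).toLinearMap ∘ₗ (ev ∘ₗ TensorProduct.mk k Y M y).rTensor Y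

@[simp] theorem evalLeft_tmul (ev : Y ⊗[k] M →ₗ[k] k) (y x : Y) (e : M) :
    evalLeft ev y (e ⊗ₜ x) = ev (y ⊗ₜ e) • x := by
  simp [evalLeft]

theorem dualEnd_eq (ev : Y ⊗[k] M →ₗ[k] k) (cv : k →ₗ[k] M ⊗[k] Y)
    (φ : M ⊗[k] A →ₗ[k] M ⊗[k] A) : dualEnd ev cv φ =
    (TensorProduct.lid k Y).toLinearMap.rTensor A ∘ₗ
      tensorA (ev.rTensor A) (LinearMap.id : Y ⊗[k] A →ₗ[k] Y ⊗[k] A) ∘ₗ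
      (TensorProduct.assoc k Y M Y).symm.toLinearMap.rTensor A ∘ₗ
      tensorA (LinearMap.id : Y ⊗[k] A →ₗ[k] Y ⊗[k] A)
        (tensorA φ (LinearMap.id : Y ⊗[k] A →ₗ[k] Y ⊗[k] A)) ∘ₗ
      tensorA (LinearMap.id : Y ⊗[k] A →ₗ[k] Y ⊗[k] A) (cv.rTensor A) ∘ₗ
      (TensorProduct.rid k Y).symm.toLinearMap.rTensor A := rfl

/-- The only sign is that of carrying `ψ` past `y`: the coevaluation has degree `0`, and so does the
unit of `A` accompanying `y`. -/
theorem tensorA_id_coev {cv : k →ₗ[k] V} (hcv : HasDeg 0 cv) {ψ : V ⊗[k] A →ₗ[k] V ⊗[k] A}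
    {n i : ℤ} (hψ : HasDeg n ψ) {y : Y} (hy : y ∈ gr k Y i) (a : A) :
    tensorA (LinearMap.id : Y ⊗[k] A →ₗ[k] Y ⊗[k] A) ψ
      (tensorA (LinearMap.id : Y ⊗[k] A →ₗ[k] Y ⊗[k] A) (cv.rTensor A)
        ((TensorProduct.rid k Y).symm.toLinearMap.rTensor A (y ⊗ₜ a))) =
      (-1 : k) ^ (n * i) • (TensorProduct.assoc k Y V A).symm (y ⊗ₜ ψ (cv 1 ⊗ₜ a)) := by
  have h2 : HasDeg 0 (cv.rTensor A) := hasDeg_rTensor hcv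
  rw [LinearMap.rTensor_tmul, LinearEquiv.coe_coe, TensorProduct.rid_symm_apply,
    tensorA_tmul_zero _ h2, LinearMap.id_apply, mulSwap_one, LinearMap.rTensor_tmul,
    assoc_symm_tmul, tensorA_tmul _ hψ hy, LinearMap.id_apply, mulSwap_one]

theorem tensorA_eval (ev : Y ⊗[k] M →ₗ[k] k) (y : Y) (t : (M ⊗[k] Y) ⊗[k] A) :
    (TensorProduct.lid k Y).toLinearMap.rTensor A
      (tensorA (ev.rTensor A) (LinearMap.id : Y ⊗[k] A →ₗ[k] Y ⊗[k] A)
      ((TensorProduct.assoc k Y M Y).symm.toLinearMap.rTensor A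
      ((TensorProduct.assoc k Y (M ⊗[k] Y) A).symm (y ⊗ₜ t)))) = (evalLeft ev y).rTensor A t := by
  induction t using TensorProduct.induction_on with
  | zero => simp
  | add s t hs ht => simp only [tmul_add, map_add, hs, ht]
  | tmul w a =>
    induction w using TensorProduct.induction_on with
    | zero => simp
    | add s t hs ht => simp only [add_tmul, tmul_add, map_add, hs, ht]
    | tmul e x =>
      simp [tensorA_tmul_zero _ (hasDeg_id (V := Y ⊗[k] A)), mulSwap_one]

theorem hasDeg_tensorA_id {φ : M ⊗[k] A →ₗ[k] M ⊗[k] A} {n : ℤ} (hφ : HasDeg n φ) :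
    HasDeg n (tensorA φ (LinearMap.id : Y ⊗[k] A →ₗ[k] Y ⊗[k] A)) := by
  simpa using hasDeg_tensorA hφ (hasDeg_id (V := Y ⊗[k] A))

/-- Collapses the six-fold composite: insert `cv 1`, apply `φ` to its first leg, and pair the
outcome with `y`. The sign comes from `φ` passing `y`. -/
theorem dualEnd_tmul {ev : Y ⊗[k] M →ₗ[k] k} {cv : k →ₗ[k] M ⊗[k] Y} (hcv : HasDeg 0 cv)
    {φ : M ⊗[k] A →ₗ[k] M ⊗[k] A} {n i : ℤ} (hφ : HasDeg n φ) {y : Y} (hy : y ∈ gr k Y i) (a : A) :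
    dualEnd ev cv φ (y ⊗ₜ a) = (-1 : k) ^ (n * i) • (evalLeft ev y).rTensor A
      (tensorA φ (LinearMap.id : Y ⊗[k] A →ₗ[k] Y ⊗[k] A) (cv 1 ⊗ₜ a)) := by
  have h := tensorA_id_coev hcv (hasDeg_tensorA_id (Y := Y) hφ) hy a
  rw [dualEnd_eq, LinearMap.comp_apply, LinearMap.comp_apply, LinearMap.comp_apply,
    LinearMap.comp_apply, LinearMap.comp_apply, h,
    LinearMap.map_smul, LinearMap.map_smul, LinearMap.map_smul, tensorA_eval]

end TensorA

/-! ### The operation `ς` on represented families -/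

section Antipode

variable {k B : Type u} [Field k] [Ring B] [Algebra k B] [DGModule k B] [Coalgebra k B]
  [CDGHopfAlgebra k B]
variable {A : Type v} [Ring A] [Algebra k A] [DGModule k A] [CDGAlgebra k A]

/-- The coaction of `B^*` is `b ↦ ∑ ± b₂ ⊗ ς(b₁)`. The counit kills the first factor unless it has
degree `0`, where the sign is trivial, and the counit axiom leaves `ς(b)`. -/
theorem counitA_starCoact (b : B) :
    counitA k B B (DGComodule.starCoact k B b) = antipode k B b := by
  have h1 : counitA k B B ∘ₗ (tau k B B).toLinearMap ∘ₗ (antipode k B).rTensor B =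
      antipode k B ∘ₗ (TensorProduct.rid k B).toLinearMap ∘ₗ
        (Coalgebra.counit (R := k) (A := B)).lTensor B := by
    refine tensor_ext fun i j x y hx hy => ?_
    simp only [LinearMap.comp_apply, LinearMap.rTensor_tmul, LinearEquiv.coe_coe,
      tau_tmul ((antipode_chain (k := k) (B := B)).deg.zero_mem hx) hy, map_smul, counitA_tmul, LinearMap.lTensor_tmul,
      rid_tmul]
    by_cases hj : j = 0
    · simp [hj]
    · simp [counit_eq_zero hy hj]
  have h2 := LinearMap.congr_fun h1 (Coalgebra.comul (R := k) b)
  simp only [LinearMap.comp_apply, Coalgebra.lTensor_counit_comul] at h2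
  simp only [DGComodule.starCoact, LinearMap.comp_apply, h2]
  simp

theorem sigma_apply (η : Fam k B A) (M : DGComodule k B) (x : M) (a : A) :
    sigma η M (x ⊗ₜ a) = (counitA k B A).lTensor M (lten M (η (DGComodule.star k B))
      (TensorProduct.assoc k M B A (M.coact x ⊗ₜ a))) := by
  have h : (TensorProduct.rid k M).toLinearMap.rTensor A ∘ₗ
      ((Coalgebra.counit (R := k) (A := B)).lTensor M).rTensor A ∘ₗ
      (TensorProduct.assoc k M B A).symm.toLinearMap = (counitA k B A).lTensor M := by
    apply TensorProduct.ext
    ext x b a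
    simp [smul_tmul]
  rw [← h]
  simp [sigma]

theorem sigma_add (η η' : Fam k B A) : sigma (η + η') = sigma η + sigma η' := by
  funext M
  apply TensorProduct.ext'
  intro x a
  simp [sigma_apply, lten_add]

theorem hasDeg_comp_antipode {f : B →ₗ[k] A} {n : ℤ} (hf : HasDeg n f) :
    HasDeg n (f ∘ₗ antipode k B) :=
  fun _ _ hx => hf (HasDeg.zero_mem (antipode_chain (k := k) (B := B)).deg hx)

/-- Evaluating the family on `B^*` and applying the counit replaces `f(b)` by `f(ς(b))`, by
`counitA_starCoact`. -/
theorem sigma_convEnd {f : B →ₗ[k] A} {n : ℤ} (hf : HasDeg n f) :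
    sigma (convEnd f) = convEnd (f ∘ₗ antipode k B) := by
  funext M
  apply TensorProduct.ext'
  intro x a
  have hη : HasDeg n (convEnd f (DGComodule.star k B)) :=
    (convEnd_mem_natEnd hf).1 (DGComodule.star k B)
  have hf' := hasDeg_comp_antipode hf
  rw [sigma_apply, convEnd_tmul]
  refine tensor_induction' (k := k) (p := fun t => (counitA k B A).lTensor M
    (lten M (convEnd f (DGComodule.star k B)) (TensorProduct.assoc k M B A (t ⊗ₜ a))) =
    rmul k M a (lten M (f ∘ₗ antipode k B) t)) (by simp)
    (fun s t hs ht => by simp only [add_tmul, map_add, hs, ht]) ?_ (M.coact x)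
  intro i j y b hy hb
  rw [assoc_tmul, lten_tmul hη hy, lten_tmul hf' hy, map_smul, map_smul, LinearMap.lTensor_tmul,
    rmul_tmul, convEnd_tmul, counitA_rmul, counitA_lten hf]
  congr 3
  exact congrArg f (counitA_starCoact (k := k) b)

/-- The coevaluation `τ ∘ cv` corresponds to the identity. -/
theorem tau_coevaluation (M : Type*) [AddCommGroup M] [Module k M] [DGModule k M]
    [Module.Finite k M] :
    tau k M (Module.Dual k M) (coevaluation k M 1) = homDual k M M LinearMap.id := by
  simp only [homDual, LinearEquiv.trans_apply]
  congr 1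
  -- The basis behind `coevaluation` need not be homogeneous, so the signs of `τ` cannot be read off
  -- term by term. The element is instead identified through the unsigned isomorphism, to which
  -- `homDual` applies the same `τ`.
  have h : (dualTensorHomEquiv k M M).symm LinearMap.id =
      TensorProduct.comm k M (Module.Dual k M) (coevaluation k M 1) := by
    rw [LinearEquiv.symm_apply_eq]
    ext x
    simpa [coevaluation_apply_one, Finsupp.linearCombination_apply] using
      ((Module.Basis.ofVectorSpace k M).sum_repr x).symm
  rw [h, TensorProduct.comm_comm]

end Antipode

/-! ### Signs in the duality formula -/

section DualFormula

variable {k : Type*} [Field k]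
variable {M D U : Type*} [AddCommGroup M] [Module k M] [DGModule k M]
  [AddCommGroup D] [Module k D] [DGModule k D] [AddCommGroup U] [Module k U] [DGModule k U]
variable {A : Type*} [Ring A] [Algebra k A] [DGModule k A] [CDGAlgebra k A]

theorem comp_tau_tmul (c : D ⊗[k] M →ₗ[k] k) {i j : ℤ} {y : M} {e : D} (hy : y ∈ gr k M i)
    (he : e ∈ gr k D j) :
    (c ∘ₗ (tau k M D).toLinearMap) (y ⊗ₜ e) = (-1 : k) ^ (i * j) * c (e ⊗ₜ y) := by
  rw [LinearMap.comp_apply, LinearEquiv.coe_coe, tau_tmul hy he, LinearMap.map_smul, smul_eq_mul]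

theorem hasDeg_of_one {cv : k →ₗ[k] M} (h : cv 1 ∈ gr k M 0) : HasDeg 0 cv := by
  intro i c hc
  by_cases hi : i = 0
  · have h' : cv c = c • cv 1 := by
      rw [← LinearMap.map_smul, smul_eq_mul, mul_one]
    rw [h', hi]
    exact Submodule.smul_mem _ _ h
  · rw [eq_zero_of_mem_gr_self hi hc, map_zero]
    exact zero_mem _

/-- Left, for `e` of degree `p` and `u` of degree `j - p`, the signs come from: `φ` past `y` (degree
`-p`), `f` past `e`, `f(u)` past `x` (degree `-j`), and the `τ` in the evaluation. Right, the last
factor is the sign of the pairing `P`. The exponents differ by `-j(j + 1) - 2nj`, which is even. -/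
theorem dual_sign (n j p : ℤ) :
    (-1 : k) ^ (n * -p) * ((-1) ^ (n * p) * ((-1) ^ ((j - p + n) * -j) * (-1) ^ (-p * p))) =
      (-1) ^ (j + n * j) * (-1) ^ (p * (j - p)) := by
  simp only [← zpow_add₀ (show (-1 : k) ≠ 0 by simp)]
  apply neg_one_zpow_eq
  obtain ⟨r, hr⟩ := Int.even_mul_succ_self j
  exact ⟨-r - n * j, by linear_combination -hr⟩

variable {b : D →ₗ[k] M →ₗ[k] k} {ev : M ⊗[k] D →ₗ[k] k}

/-- The total sign depends only on `n` and on the degree `j` of `w`, not on how `w` splits into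
tensors. The formula therefore applies to an unexpanded coaction `w`. The space `D` stands for the
dual, entering only through the pairing `b` and its signed extension `P`. -/
theorem evalLeft_mulSwap_lten
    (hb : ∀ i j e y, e ∈ gr k D j → y ∈ gr k M i → i + j ≠ 0 → b e y = 0)
    (hev : ∀ i j e y, e ∈ gr k D j → y ∈ gr k M i → ev (y ⊗ₜ e) = (-1 : k) ^ (i * j) * b e y)
    {P : D ⊗[k] U →ₗ[k] M →ₗ[k] U}
    (hP : ∀ i j e u y, e ∈ gr k D i → u ∈ gr k U j →
      P (e ⊗ₜ u) y = (-1 : k) ^ (i * j) • b e y • u)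
    {f : U →ₗ[k] A} {n i j : ℤ} (hf : HasDeg n f) {y x : M}
    (hy : y ∈ gr k M i) (hx : x ∈ gr k M (-j)) (a : A) {w : D ⊗[k] U}
    (hw : w ∈ gr k (D ⊗[k] U) j) :
    (-1 : k) ^ (n * i) • (evalLeft ev y).rTensor A
      (mulSwap k A D M (lten D f w ⊗ₜ (x ⊗ₜ a))) =
    (-1 : k) ^ (j + n * j) • (x ⊗ₜ[k] (f (P w y) * a)) := by
  refine tensor_induction (p := fun w => (-1 : k) ^ (n * i) • (evalLeft ev y).rTensor A
      (mulSwap k A D M (lten D f w ⊗ₜ (x ⊗ₜ a))) =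
    (-1 : k) ^ (j + n * j) • (x ⊗ₜ[k] (f (P w y) * a))) (by simp)
    (fun s t hs ht => by
      simp only [map_add, add_tmul, smul_add, hs, ht, LinearMap.add_apply, add_mul, tmul_add])
    (fun c t ht => by
      simp only [map_smul, ← smul_tmul', LinearMap.smul_apply, smul_mul_assoc, tmul_smul]
      rw [smul_comm, ht, smul_comm]) ?_ hw
  intro p q e u hpq he hu
  rw [lten_tmul hf he, ← smul_tmul', LinearMap.map_smul, mulSwap_tmul _ _ (hf hu) hx,
    LinearMap.map_smul, LinearMap.map_smul, LinearMap.rTensor_tmul, evalLeft_tmul,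
    hev i p e y he hy, hP p q e u y he hu]
  -- Unless the degrees of `e` and `y` cancel, the pairing vanishes and both sides are zero.
  by_cases hi : i + p = 0
  · simp only [map_smul, smul_mul_assoc, tmul_smul, ← smul_tmul', smul_smul]
    congr 1
    obtain rfl : i = -p := by omega
    obtain rfl : q = j - p := by omega
    linear_combination b e y * dual_sign (k := k) n j p
  · simp [hb i p e y he hy hi]

/-- Under the pairing, `e ⊗ x` is a rank one endomorphism of `M`; the formula describes its
extension to `M ⊗ U`. -/
theorem rTensor_pair {P : D ⊗[k] M →ₗ[k] M →ₗ[k] M}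
    (hP : ∀ i j e u y, e ∈ gr k D i → u ∈ gr k M j →
      P (e ⊗ₜ u) y = (-1 : k) ^ (i * j) • b e y • u) {e : D} {x : M} {p q : ℤ}
    (he : e ∈ gr k D p) (hx : x ∈ gr k M q) (t : M ⊗[k] U) :
    (P (e ⊗ₜ x)).rTensor U t =
      (-1 : k) ^ (p * q) • (x ⊗ₜ[k] TensorProduct.lid k U ((b e).rTensor U t)) := by
  induction t using TensorProduct.induction_on with
  | zero => simp
  | add s t hs ht => simp only [map_add, tmul_add, smul_add, hs, ht]
  | tmul y u =>
    rw [LinearMap.rTensor_tmul, hP p q e x y he hx, ← smul_tmul', LinearMap.rTensor_tmul,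
      TensorProduct.lid_tmul, smul_tmul]

end DualFormula

/-! ### The operation `S` on represented families -/

section SFormula

variable {k B : Type u} [Field k] [Ring B] [Algebra k B] [DGModule k B] [Coalgebra k B]
  [CDGHopfAlgebra k B]
variable {A : Type v} [Ring A] [Algebra k A] [DGModule k A] [CDGAlgebra k A]

/-- Stated for any degree `0` element `c` in place of the coevaluation, so that it is linear in `c`
and can be verified on tensors `e ⊗ x`. The hypothesis `hD`, that `D` carries the contragredient
coaction, is where the antipode enters. -/
theorem evalLeft_tensorA_convEnd {f : B →ₗ[k] A} {n i : ℤ} (hf : HasDeg n f)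
    (M D : DGComodule k B) {b : D →ₗ[k] M →ₗ[k] k} {ev : M ⊗[k] D →ₗ[k] k}
    (hb : ∀ i j e y, e ∈ gr k D j → y ∈ gr k M i → i + j ≠ 0 → b e y = 0)
    (hev : ∀ i j e y, e ∈ gr k D j → y ∈ gr k M i → ev (y ⊗ₜ e) = (-1 : k) ^ (i * j) * b e y)
    {P : D ⊗[k] B →ₗ[k] M →ₗ[k] B}
    (hP : ∀ i j e u y, e ∈ gr k D i → u ∈ gr k B j →
      P (e ⊗ₜ u) y = (-1 : k) ^ (i * j) • b e y • u)
    {P' : D ⊗[k] M →ₗ[k] M →ₗ[k] M}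
    (hP' : ∀ i j e u y, e ∈ gr k D i → u ∈ gr k M j →
      P' (e ⊗ₜ u) y = (-1 : k) ^ (i * j) • b e y • u)
    (hD : ∀ e y, P (D.coact e) y =
      TensorProduct.lid k B (TensorProduct.map (b e) (antipode k B) (M.coact y)))
    {y : M} (hy : y ∈ gr k M i) (a : A) {c : D ⊗[k] M} (hc : c ∈ gr k (D ⊗[k] M) 0) :
    (-1 : k) ^ (n * i) • (evalLeft ev y).rTensor A
      (tensorA (convEnd f D) (LinearMap.id : M ⊗[k] A →ₗ[k] M ⊗[k] A) (c ⊗ₜ a)) =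
    rmul k M a (lten M (f ∘ₗ antipode k B) ((P' c).rTensor B (M.coact y))) := by
  refine tensor_induction (p := fun c =>
    (-1 : k) ^ (n * i) • (evalLeft ev y).rTensor A
      (tensorA (convEnd f D) (LinearMap.id : M ⊗[k] A →ₗ[k] M ⊗[k] A) (c ⊗ₜ a)) =
    rmul k M a (lten M (f ∘ₗ antipode k B) ((P' c).rTensor B (M.coact y))))
    (by simp) (fun s t hs ht => by
      simp only [map_add, add_tmul, smul_add, hs, ht, LinearMap.rTensor_add, LinearMap.add_apply])
    (fun c t ht => by
      simp only [map_smul, ← smul_tmul', LinearMap.rTensor_smul, LinearMap.smul_apply]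
      rw [smul_comm, ht]) ?_ hc
  intro p q e x hpq he hx
  -- Total degree `0` is what makes the leftover sign `(-1)^(p(p+1))` trivial.
  obtain rfl : q = -p := by omega
  have h1 : D.coact e ∈ gr k (D ⊗[k] B) p := D.coact_chain.deg.zero_mem he
  have h2 : convEnd f D (e ⊗ₜ 1) = lten D f (D.coact e) := by
    rw [convEnd_tmul, rmul_one]
  have h3 : TensorProduct.lid k B (TensorProduct.map (b e) (antipode k B) (M.coact y)) =
      antipode k B (TensorProduct.lid k B ((b e).rTensor B (M.coact y))) := by
    generalize M.coact y = t
    induction t using TensorProduct.induction_on with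
    | zero => simp
    | add s t hs ht => simp only [map_add, hs, ht]
    | tmul z c => simp
  rw [tensorA_tmul_zero _ hasDeg_id, h2, LinearMap.id_apply,
    evalLeft_mulSwap_lten hb hev hP hf hy hx a h1, hD, rTensor_pair hP' he hx,
    LinearMap.map_smul, LinearMap.map_smul, lten_tmul (hasDeg_comp_antipode hf) hx,
    LinearMap.map_smul, rmul_tmul, smul_smul, ← zpow_add₀ (by simp), h3, LinearMap.comp_apply]
  congr 1
  apply neg_one_zpow_eq
  obtain ⟨r, hr⟩ := Int.even_mul_succ_self p
  exact ⟨r + n * p, by linear_combination hr⟩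

theorem dualEnd_convEnd {f : B →ₗ[k] A} {n : ℤ} (hf : HasDeg n f)
    (M D : DGComodule k B) {b : D →ₗ[k] M →ₗ[k] k} {ev : M ⊗[k] D →ₗ[k] k} {cv : k →ₗ[k] D ⊗[k] M}
    (hb : ∀ i j e y, e ∈ gr k D j → y ∈ gr k M i → i + j ≠ 0 → b e y = 0)
    (hev : ∀ i j e y, e ∈ gr k D j → y ∈ gr k M i → ev (y ⊗ₜ e) = (-1 : k) ^ (i * j) * b e y)
    {P : D ⊗[k] B →ₗ[k] M →ₗ[k] B}
    (hP : ∀ i j e u y, e ∈ gr k D i → u ∈ gr k B j →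
      P (e ⊗ₜ u) y = (-1 : k) ^ (i * j) • b e y • u)
    {P' : D ⊗[k] M →ₗ[k] M →ₗ[k] M}
    (hP' : ∀ i j e u y, e ∈ gr k D i → u ∈ gr k M j →
      P' (e ⊗ₜ u) y = (-1 : k) ^ (i * j) • b e y • u)
    (hD : ∀ e y, P (D.coact e) y =
      TensorProduct.lid k B (TensorProduct.map (b e) (antipode k B) (M.coact y)))
    (hcv : cv 1 ∈ gr k (D ⊗[k] M) 0) (hc : P' (cv 1) = LinearMap.id) :
    dualEnd ev cv (convEnd f D) = convEnd (f ∘ₗ antipode k B) M := by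
  refine tensor_ext fun i j y a hy _ => ?_
  rw [dualEnd_tmul (hasDeg_of_one hcv) ((convEnd_mem_natEnd hf).1 D) hy a,
    evalLeft_tensorA_convEnd hf M D hb hev hP hP' hD hy a hcv, hc, LinearMap.rTensor_id,
    LinearMap.id_apply, convEnd_tmul]

/-- The general formula with `D` the dual comodule of `M`: the pairing is evaluation, `P` and `P'`
are instances of `pair`, and the coevaluation corresponds to the identity of `M`. -/
theorem S_res_convEnd {f : B →ₗ[k] A} {n : ℤ} (hf : HasDeg n f) :
    S (res (convEnd f)) = res (convEnd (f ∘ₗ antipode k B)) := by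
  funext M
  have hcv : tau k M.toDGComodule (Module.Dual k M.toDGComodule)
      (coevaluation k M.toDGComodule 1) = homDual k _ _ LinearMap.id := tau_coevaluation _
  refine dualEnd_convEnd hf M.toDGComodule M.toDGComodule.dual
    (b := (LinearMap.id : Module.Dual k M.toDGComodule →ₗ[k] M.toDGComodule →ₗ[k] k))
    (fun i j e y he hy hi => dual_eval_zero he hy hi) ?_
    (P := pair k M.toDGComodule B) (fun i j e u y he hu => pair_tmul he hu y)
    (P' := pair k M.toDGComodule M.toDGComodule) (fun i j e u y he hu => pair_tmul he hu y)
    (fun e y => LinearMap.congr_fun (DGComodule.pair_dualCoact M.toDGComodule e) y) ?_ ?_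
  · intro i j e y he hy
    exact (comp_tau_tmul (contractLeft k M.toDGComodule) hy he).trans
      (by rw [contractLeft_apply]; rfl)
  · rw [LinearMap.comp_apply, LinearEquiv.coe_coe, hcv]
    exact homDual_mem hasDeg_id
  · rw [LinearMap.comp_apply, LinearEquiv.coe_coe, hcv]
    exact (homDual k _ _).symm_apply_apply _

end SFormula

/-! ### Interchange law and naturality for tensor products over `A` -/

section Functoriality

variable {k : Type*} [Field k]
variable {M N P M' N' P' V W V' W' : Type*} [AddCommGroup M] [Module k M] [DGModule k M]
  [AddCommGroup N] [Module k N] [DGModule k N] [AddCommGroup P] [Module k P] [DGModule k P]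
  [AddCommGroup M'] [Module k M'] [DGModule k M']
  [AddCommGroup N'] [Module k N'] [DGModule k N'] [AddCommGroup P'] [Module k P'] [DGModule k P']
  [AddCommGroup V] [Module k V] [DGModule k V] [AddCommGroup W] [Module k W] [DGModule k W]
  [AddCommGroup V'] [Module k V'] [DGModule k V'] [AddCommGroup W'] [Module k W'] [DGModule k W']
variable {A : Type*} [Ring A] [Algebra k A] [DGModule k A] [CDGAlgebra k A]

/-- `mulSwap` is the projection to the tensor product over the graded commutative algebra `A`, so it
is balanced, with the sign that turns a left action on `W ⊗ A` into a right one. -/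
theorem mulSwap_rmul {i l : ℤ} {b : A} (hb : b ∈ gr k A i) (s : V ⊗[k] A) {t : W ⊗[k] A}
    (ht : t ∈ gr k (W ⊗[k] A) l) :
    mulSwap k A V W (rmul k V b s ⊗ₜ t) =
      (-1 : k) ^ (i * l) • mulSwap k A V W (s ⊗ₜ rmul k W b t) := by
  refine tensor_induction' (k := k) (p := fun s => mulSwap k A V W (rmul k V b s ⊗ₜ t) =
    (-1 : k) ^ (i * l) • mulSwap k A V W (s ⊗ₜ rmul k W b t)) (by simp)
    (fun s t hs ht => by simp only [map_add, add_tmul, smul_add, hs, ht]) ?_ s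
  intro o p v a _ ha
  refine tensor_induction (p := fun t => mulSwap k A V W (rmul k V b (v ⊗ₜ a) ⊗ₜ t) =
    (-1 : k) ^ (i * l) • mulSwap k A V W ((v ⊗ₜ a) ⊗ₜ rmul k W b t)) (by simp)
    (fun s t hs ht => by simp only [map_add, tmul_add, smul_add, hs, ht])
    (fun c t ht => by
      simp only [map_smul, tmul_smul]
      rw [smul_comm, ht]) ?_ ht
  intro q r w c hqr hw hc
  rw [rmul_tmul, rmul_tmul, mulSwap_tmul _ _ (CDGAlgebra.mul_mem ha hb) hw, mulSwap_tmul _ _ ha hw,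
    mul_assoc, CDGAlgebra.mul_comm (k := k) hb hc, mul_smul_comm, tmul_smul, smul_smul, smul_smul,
    ← zpow_add₀ (by simp), ← zpow_add₀ (by simp), ← hqr]
  congr 1
  exact neg_one_zpow_eq ⟨0, by ring⟩

/-- Shows that `tensorA` is the map induced on tensor products over `A`: the definition only
evaluates `φ` on `x ⊗ 1`, and linearity together with balancedness covers general elements. -/
theorem tensorA_mulSwap {φ : M ⊗[k] A →ₗ[k] N ⊗[k] A} {φ' : M' ⊗[k] A →ₗ[k] N' ⊗[k] A}
    (hφ : IsALinear φ) (hφ' : IsALinear φ') (h0 : HasDeg 0 φ') (s : M ⊗[k] A) (t : M' ⊗[k] A) :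
    tensorA φ φ' (mulSwap k A M M' (s ⊗ₜ t)) = mulSwap k A N N' (φ s ⊗ₜ φ' t) := by
  refine tensor_induction' (k := k) (p := fun s => tensorA φ φ' (mulSwap k A M M' (s ⊗ₜ t)) =
    mulSwap k A N N' (φ s ⊗ₜ φ' t)) (by simp)
    (fun s t hs ht => by simp only [map_add, add_tmul, hs, ht]) ?_ s
  intro i j x b hx hb
  refine tensor_induction' (k := k) (p := fun t => tensorA φ φ' (mulSwap k A M M'
    ((x ⊗ₜ b) ⊗ₜ t)) = mulSwap k A N N' (φ (x ⊗ₜ b) ⊗ₜ φ' t)) (by simp)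
    (fun s t hs ht => by simp only [map_add, tmul_add, hs, ht]) ?_ t
  intro q r y c hy hc
  have h1 : x ⊗ₜ[k] b = rmul k M b (x ⊗ₜ 1) := by rw [rmul_tmul, one_mul]
  rw [mulSwap_tmul _ _ hb hy, LinearMap.map_smul, tensorA_tmul_zero _ h0, h1,
    isALinear_iff.1 hφ, mulSwap_rmul hb _ (h0.zero_mem (mem_tensor hy hc rfl)),
    ← isALinear_iff.1 hφ', rmul_tmul, CDGAlgebra.mul_comm (k := k) hb hc, tmul_smul,
    LinearMap.map_smul, tmul_smul, LinearMap.map_smul, smul_smul, ← zpow_add₀ (by simp)]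
  congr 1
  exact neg_one_zpow_eq ⟨0, by ring⟩

theorem tensorA_comp {φ : N ⊗[k] A →ₗ[k] P ⊗[k] A} {φ' : N' ⊗[k] A →ₗ[k] P' ⊗[k] A}
    {ψ : M ⊗[k] A →ₗ[k] N ⊗[k] A} {ψ' : M' ⊗[k] A →ₗ[k] N' ⊗[k] A}
    (hφ : IsALinear φ) (hφ' : IsALinear φ') (h0 : HasDeg 0 φ') (h0' : HasDeg 0 ψ') :
    tensorA φ φ' ∘ₗ tensorA ψ ψ' = tensorA (φ ∘ₗ ψ) (φ' ∘ₗ ψ') := by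
  have h : HasDeg 0 (φ' ∘ₗ ψ') := by simpa using h0.comp h0'
  refine TensorProduct.ext' fun w a => ?_
  rw [LinearMap.comp_apply]
  induction w using TensorProduct.induction_on with
  | zero => rw [zero_tmul, map_zero, map_zero, map_zero]
  | add s t hs ht => rw [add_tmul, map_add, map_add, map_add, hs, ht]
  | tmul x y =>
    rw [tensorA_tmul_zero _ h0', tensorA_tmul_zero _ h, tensorA_mulSwap hφ hφ' h0,
      LinearMap.comp_apply, LinearMap.comp_apply]

theorem tensorA_id : tensorA (LinearMap.id : M ⊗[k] A →ₗ[k] M ⊗[k] A)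
    (LinearMap.id : N ⊗[k] A →ₗ[k] N ⊗[k] A) = LinearMap.id := by
  refine TensorProduct.ext' fun w a => ?_
  rw [LinearMap.id_apply]
  induction w using TensorProduct.induction_on with
  | zero => rw [zero_tmul, map_zero]
  | add s t hs ht => rw [add_tmul, map_add, hs, ht]
  | tmul x y =>
    rw [tensorA_tmul_zero _ hasDeg_id, LinearMap.id_apply, LinearMap.id_apply, mulSwap_one,
      assoc_symm_tmul]

theorem mulSwap_map {ι : M →ₗ[k] N} {ι' : M' →ₗ[k] N'} (h : HasDeg 0 ι')
    (s : M ⊗[k] A) (t : M' ⊗[k] A) :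
    mulSwap k A N N' (ι.rTensor A s ⊗ₜ ι'.rTensor A t) =
      (TensorProduct.map ι ι').rTensor A (mulSwap k A M M' (s ⊗ₜ t)) := by
  refine tensor_induction' (k := k) (p := fun s => mulSwap k A N N'
    (ι.rTensor A s ⊗ₜ ι'.rTensor A t) = (TensorProduct.map ι ι').rTensor A
      (mulSwap k A M M' (s ⊗ₜ t))) (by simp)
    (fun s t hs ht => by simp only [map_add, add_tmul, hs, ht]) ?_ s
  intro i j x b hx hb
  refine tensor_induction' (k := k) (p := fun t => mulSwap k A N N'
    (ι.rTensor A (x ⊗ₜ b) ⊗ₜ ι'.rTensor A t) = (TensorProduct.map ι ι').rTensor A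
      (mulSwap k A M M' ((x ⊗ₜ b) ⊗ₜ t))) (by simp)
    (fun s t hs ht => by simp only [map_add, tmul_add, hs, ht]) ?_ t
  intro q r y c hy hc
  rw [LinearMap.rTensor_tmul, LinearMap.rTensor_tmul, mulSwap_tmul _ _ hb (h.zero_mem hy),
    mulSwap_tmul _ _ hb hy, LinearMap.map_smul, LinearMap.rTensor_tmul, map_tmul]

theorem tensorA_natural {ι : M →ₗ[k] N} {ι' : M' →ₗ[k] N'} (h : HasDeg 0 ι')
    {φ : M ⊗[k] A →ₗ[k] M ⊗[k] A} {φ' : M' ⊗[k] A →ₗ[k] M' ⊗[k] A}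
    {ψ : N ⊗[k] A →ₗ[k] N ⊗[k] A} {ψ' : N' ⊗[k] A →ₗ[k] N' ⊗[k] A}
    (hφ : HasDeg 0 φ') (hψ : HasDeg 0 ψ') (h1 : ψ ∘ₗ ι.rTensor A = ι.rTensor A ∘ₗ φ)
    (h2 : ψ' ∘ₗ ι'.rTensor A = ι'.rTensor A ∘ₗ φ') (x : M) (y : M') (a : A) :
    tensorA ψ ψ' ((ι x ⊗ₜ ι' y) ⊗ₜ a) =
      (TensorProduct.map ι ι').rTensor A (tensorA φ φ' ((x ⊗ₜ y) ⊗ₜ a)) := by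
  have h1' := LinearMap.congr_fun h1 (x ⊗ₜ 1)
  have h2' := LinearMap.congr_fun h2 (y ⊗ₜ a)
  rw [LinearMap.comp_apply, LinearMap.comp_apply, LinearMap.rTensor_tmul] at h1' h2'
  rw [tensorA_tmul_zero _ hψ, tensorA_tmul_zero _ hφ, h1', h2', mulSwap_map h]

end Functoriality

/-! ### Tensor products and the multiplication as comodule morphisms -/

section Comodules

variable {k B : Type u} [Field k] [Ring B] [Algebra k B] [DGModule k B] [Coalgebra k B]
  [CDGHopfAlgebra k B]

theorem isComodHom_map {M M' N N' : DGComodule k B} {ι : M →ₗ[k] N} {ι' : M' →ₗ[k] N'}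
    (h : HasDeg 0 ι') (hι : IsComodHom ι) (hι' : IsComodHom ι') :
    IsComodHom (M := M.tensor M') (N := N.tensor N') (TensorProduct.map ι ι') := by
  refine TensorProduct.ext' fun x y => ?_
  have h1 := LinearMap.congr_fun hι x
  have h2 := LinearMap.congr_fun hι' y
  rw [LinearMap.comp_apply, LinearMap.comp_apply] at h1 h2
  have h3 := mulSwap_map (ι := ι) h (M.coact x) (M'.coact y)
  rw [← h1, ← h2] at h3
  simpa [DGComodule.tensorCoact] using h3

theorem isComodHom_mul : IsComodHom (M := (DGComodule.regular k B).tensor (DGComodule.regular k B))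
    (N := DGComodule.regular k B) (LinearMap.mul' k B) := by
  refine TensorProduct.ext' fun x y => ?_
  -- The product of `B ⊗ B` is the tensor product coaction's multiplication followed by `m ⊗ 𝕀`, so
  -- multiplicativity of the coproduct is exactly the morphism condition.
  have h1 : mulTensor k B = (LinearMap.mul' k B).rTensor B ∘ₗ mulSwap k B B B := by
    rw [mulTensor, mulSwap, ← LinearMap.comp_assoc, LinearMap.rTensor_comp_lTensor]
  have h2 := LinearMap.congr_fun h1 (Coalgebra.comul (R := k) x ⊗ₜ Coalgebra.comul (R := k) y)
  rw [← CDGHopfAlgebra.comul_mul] at h2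
  simpa [DGComodule.tensorCoact] using h2

end Comodules

/-! ### Tensor-compatible families, algebra maps and inverses -/

section TensorEnd

variable {k B : Type u} [Field k] [Ring B] [Algebra k B] [DGModule k B] [Coalgebra k B]
  [CDGHopfAlgebra k B]
variable {A : Type v} [Ring A] [Algebra k A] [DGModule k A] [CDGAlgebra k A]

/-- The sign in `mulSwap` exchanges a factor in `A` with one in `B`; the counit removes it by
vanishing off degree `0`. -/
theorem counitA_mulSwap (s t : B ⊗[k] A) :
    counitA k B A ((LinearMap.mul' k B).rTensor A (mulSwap k A B B (s ⊗ₜ t))) =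
      counitA k B A s * counitA k B A t := by
  refine tensor_induction' (k := k) (p := fun s => counitA k B A ((LinearMap.mul' k B).rTensor A
    (mulSwap k A B B (s ⊗ₜ t))) = counitA k B A s * counitA k B A t) (by simp)
    (fun s t hs ht => by simp only [map_add, add_tmul, add_mul, hs, ht]) ?_ s
  intro i j b a hb ha
  refine tensor_induction' (k := k) (p := fun t => counitA k B A ((LinearMap.mul' k B).rTensor A
    (mulSwap k A B B ((b ⊗ₜ a) ⊗ₜ t))) = counitA k B A (b ⊗ₜ a) * counitA k B A t) (by simp)
    (fun s t hs ht => by simp only [map_add, tmul_add, mul_add, hs, ht]) ?_ t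
  intro q r c a' hc _
  rw [mulSwap_tmul _ _ ha hc, LinearMap.map_smul, LinearMap.map_smul, LinearMap.rTensor_tmul,
    LinearMap.mul'_apply, counitA_tmul, counitA_tmul, counitA_tmul, CDGHopfAlgebra.counit_mul]
  by_cases hq : q = 0
  · simp [hq, smul_smul, mul_comm]
  · simp [counit_eq_zero hc hq]

theorem map_one_of_mem {f : B →ₗ[k] A} (hf : HasDeg 0 f) (h : convEnd f ∈ Z0EndTensor k B A) :
    f 1 = 1 := by
  have h1 := LinearMap.congr_fun h.2.2.1 ((1 : k) ⊗ₜ (1 : A))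
  rw [convEnd_tmul, rmul_one, lten_eq_lTensor hf] at h1
  have h2 := congrArg (TensorProduct.lid k A) h1
  simpa using h2

/-- Naturality along the product `B ⊗ B → B`, combined with tensor compatibility on `B ⊗ B`,
evaluated at `b ⊗ c ⊗ 1` and followed by the counit. -/
theorem map_mul_of_mem {f : B →ₗ[k] A} (hf : HasDeg 0 f) (h : convEnd f ∈ Z0EndTensor k B A)
    (b c : B) : f (b * c) = f b * f c := by
  have hm : HasDeg 0 (LinearMap.mul' k B) := IsChain.mul'.deg
  have h1 := LinearMap.congr_fun (convEnd_natural hf hm isComodHom_mul) ((b ⊗ₜ c) ⊗ₜ 1)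
  rw [h.2.2.2, mul_zero, zpow_zero, one_smul, LinearMap.comp_apply, LinearMap.comp_apply,
    tensorA_tmul_zero _ ((convEnd_mem_natEnd hf).1 _), LinearMap.rTensor_tmul,
    LinearMap.mul'_apply] at h1
  have h2 := congrArg (counitA k B A) h1
  rw [counitA_mulSwap, counitA_convEnd hf, counitA_convEnd hf, counitA_convEnd hf, mul_one, mul_one,
    mul_one] at h2
  exact h2.symm

/-- A multiplicative `f` can be pulled out of the convolution, leaving the antipode identity of `B`.
-/
theorem conv_antipode_right {f : B →ₗ[k] A} (h1 : f 1 = 1) (hm : ∀ b c, f (b * c) = f b * f c) :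
    conv f (f ∘ₗ antipode k B) = Algebra.linearMap k A ∘ₗ Coalgebra.counit := by
  have h : LinearMap.mul' k A ∘ₗ TensorProduct.map f (f ∘ₗ antipode k B) =
      f ∘ₗ LinearMap.mul' k B ∘ₗ (antipode k B).lTensor B := by
    apply TensorProduct.ext'
    intro b c
    simp [hm]
  ext b
  have h2 := LinearMap.congr_fun h (Coalgebra.comul (R := k) b)
  simp only [LinearMap.comp_apply, CDGHopfAlgebra.mul_antipode_right] at h2
  simp only [conv, LinearMap.comp_apply, h2]
  simp [Algebra.algebraMap_eq_smul_one, h1]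

theorem conv_antipode_left {f : B →ₗ[k] A} (h1 : f 1 = 1) (hm : ∀ b c, f (b * c) = f b * f c) :
    conv (f ∘ₗ antipode k B) f = Algebra.linearMap k A ∘ₗ Coalgebra.counit := by
  have h : LinearMap.mul' k A ∘ₗ TensorProduct.map (f ∘ₗ antipode k B) f =
      f ∘ₗ LinearMap.mul' k B ∘ₗ (antipode k B).rTensor B := by
    apply TensorProduct.ext'
    intro b c
    simp [hm]
  ext b
  have h2 := LinearMap.congr_fun h (Coalgebra.comul (R := k) b)
  simp only [LinearMap.comp_apply, CDGHopfAlgebra.mul_antipode_left] at h2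
  simp only [conv, LinearMap.comp_apply, h2]
  simp [Algebra.algebraMap_eq_smul_one, h1]

theorem hasDeg_unit_counit : HasDeg 0 (Algebra.linearMap k A ∘ₗ Coalgebra.counit (R := k) (A := B)) := by
  intro i b hb
  by_cases hi : i = 0
  · rw [LinearMap.comp_apply, Algebra.linearMap_apply, Algebra.algebraMap_eq_smul_one, hi]
    exact Submodule.smul_mem _ _ CDGAlgebra.one_mem
  · rw [LinearMap.comp_apply, counit_eq_zero hb hi, map_zero]
    exact zero_mem _

theorem convEnd_comp_antipode {f : B →ₗ[k] A} (hf : HasDeg 0 f)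
    (h : convEnd f ∈ Z0EndTensor k B A) (M : DGComodule k B) :
    convEnd f M ∘ₗ convEnd (f ∘ₗ antipode k B) M = LinearMap.id := by
  have hc := conv_antipode_right (map_one_of_mem hf h) (map_mul_of_mem hf h)
  have h0 : HasDeg 0 (conv f (f ∘ₗ antipode k B)) := by
    rw [hc]; exact hasDeg_unit_counit
  rw [convEnd_comp hf (hasDeg_comp_antipode hf) h0, convEnd_counit h0 hc]

theorem convEnd_antipode_comp {f : B →ₗ[k] A} (hf : HasDeg 0 f)
    (h : convEnd f ∈ Z0EndTensor k B A) (M : DGComodule k B) :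
    convEnd (f ∘ₗ antipode k B) M ∘ₗ convEnd f M = LinearMap.id := by
  have hc := conv_antipode_left (map_one_of_mem hf h) (map_mul_of_mem hf h)
  have h0 : HasDeg 0 (conv (f ∘ₗ antipode k B) f) := by
    rw [hc]; exact hasDeg_unit_counit
  rw [convEnd_comp (hasDeg_comp_antipode hf) hf h0, convEnd_counit h0 hc]

/-- All conditions pass to inverses: commuting with `d` by conjugation, tensor compatibility because
`tensorA (θ M) (θ N)` is a right inverse of `η` on `M ⊗ N`. No multiplicativity of the antipode and
no chain condition on `f` has to be established. -/
theorem Z0EndTensor.of_inverse {η θ : Fam k B A} (hη : η ∈ Z0EndTensor k B A)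
    (hθ : θ ∈ NatEnd k B A 0) (h : ∀ M, η M ∘ₗ θ M = LinearMap.id)
    (h' : ∀ M, θ M ∘ₗ η M = LinearMap.id) : θ ∈ Z0EndTensor k B A := by
  obtain ⟨hn, hd, hu, ht⟩ := hη
  refine ⟨hθ, fun M => ?_, ?_, fun M N => ?_⟩
  · have h1 : ∀ t, η M (θ M t) = t := LinearMap.congr_fun (h M)
    have h2 : ∀ t, θ M (η M t) = t := LinearMap.congr_fun (h' M)
    ext1
    refine LinearMap.ext fun x => LinearMap.ext fun a => ?_
    have h3 := LinearMap.congr_fun (hd M) (θ M (x ⊗ₜ a))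
    rw [LinearMap.sub_apply, LinearMap.comp_apply, LinearMap.comp_apply, h1, LinearMap.zero_apply,
      sub_eq_zero] at h3
    simp only [TensorProduct.AlgebraTensorModule.curry_apply, LinearMap.restrictScalars_self,
      TensorProduct.curry_apply, LinearMap.sub_apply, LinearMap.comp_apply, LinearMap.zero_apply]
    rw [h3, h2, sub_self]
  · have := h' (DGComodule.unit k B)
    rwa [hu, LinearMap.comp_id] at this
  · have h1 : η (M.tensor N) ∘ₗ tensorA (θ M) (θ N) = LinearMap.id := by
      rw [ht, tensorA_comp (hn.2.1 M) (hn.2.1 N) (hn.1 N) (hθ.1 N), h, h, tensorA_id]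
    have h2 : θ (M.tensor N) ∘ₗ (η (M.tensor N) ∘ₗ tensorA (θ M) (θ N)) =
      θ (M.tensor N) := by rw [h1, LinearMap.comp_id]
    rw [← h2, ← LinearMap.comp_assoc, h', LinearMap.id_comp]

theorem Z0EndTensor.antipode {f : B →ₗ[k] A} (hf : HasDeg 0 f)
    (h : convEnd f ∈ Z0EndTensor k B A) : convEnd (f ∘ₗ antipode k B) ∈ Z0EndTensor k B A :=
  Z0EndTensor.of_inverse h (convEnd_mem_natEnd (hasDeg_comp_antipode hf))
    (convEnd_comp_antipode hf h) (convEnd_antipode_comp hf h)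

theorem res_mem_Z0EndTensorF {η : Fam k B A} (hη : η ∈ Z0EndTensor k B A) :
    res η ∈ Z0EndTensorF k B A :=
  ⟨res_mem_natEndF hη.1, fun M => hη.2.1 M.toDGComodule, hη.2.2.1,
    fun M N => hη.2.2.2 M.toDGComodule N.toDGComodule⟩

/-- The conditions can be tested on elements, and these lie in finite dimensional dg-subcomodules.
The passage to all comodules is needed because `map_mul_of_mem` evaluates the family on the possibly
infinite dimensional `B` and `B ⊗ B`. -/
theorem mem_Z0EndTensor_of_res {η : Fam k B A} (hn : η ∈ NatEnd k B A 0)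
    (h : res η ∈ Z0EndTensorF k B A) : η ∈ Z0EndTensor k B A := by
  refine ⟨hn, fun M => LinearMap.ext fun t => ?_, h.2.2.1, fun M N => ?_⟩
  · obtain ⟨N, hN, hf, s, rfl⟩ := exists_subIncl_rTensor_eq M t
    have h1 := LinearMap.congr_fun (h.2.1 (subFD hN hf)) s
    have h2 : ∀ s, η M ((subIncl hN).rTensor A s) = (subIncl hN).rTensor A (η (subcomodule hN) s) :=
      LinearMap.congr_fun (isColimExtension_res hn M (subFD hN hf) (subIncl hN)
        (subIncl_injective hN) (isChain_subIncl hN) (isComodHom_subIncl hN))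
    have h3 := (isChain_subIncl hN).rTensor (W := A)
    have h4 : η M (dif k (M ⊗[k] A) ((subIncl hN).rTensor A s)) =
        dif k (M ⊗[k] A) (η M ((subIncl hN).rTensor A s)) := by
      rw [← h3.comm, h2, h2, ← h3.comm]
      exact congrArg _ (sub_eq_zero.1 h1).symm
    exact sub_eq_zero.2 h4.symm
  · refine TensorProduct.ext' fun w a => ?_
    induction w using TensorProduct.induction_on with
    | zero => rw [zero_tmul, map_zero, map_zero]
    | add s t hs ht => rw [add_tmul, map_add, map_add, hs, ht]
    | tmul x y =>
      obtain ⟨P, hP, hPf, hx⟩ := exists_subcomodule M x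
      obtain ⟨Q, hQ, hQf, hy⟩ := exists_subcomodule N y
      obtain ⟨x', rfl⟩ : ∃ x', subIncl hP x' = x := ⟨(⟨x, hx⟩ : P), rfl⟩
      obtain ⟨y', rfl⟩ : ∃ y', subIncl hQ y' = y := ⟨(⟨y, hy⟩ : Q), rfl⟩
      have hc : HasDeg 0 (TensorProduct.map (subIncl hP) (subIncl hQ)) :=
        ((isChain_subIncl hP).map (isChain_subIncl hQ)).deg
      -- Naturality along `P ⊗ Q → M ⊗ N` moves the claim to the finite dimensional `P ⊗ Q`, where
      -- it is assumed.
      have h1 := LinearMap.congr_fun (hn.2.2 ((subcomodule hP).tensor (subcomodule hQ))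
        (M.tensor N) 0 (TensorProduct.map (subIncl hP) (subIncl hQ)) hc
        (isComodHom_map (isChain_subIncl hQ).deg (isComodHom_subIncl hP)
          (isComodHom_subIncl hQ))) ((x' ⊗ₜ y') ⊗ₜ a)
      rw [zero_mul, zpow_zero, one_smul, LinearMap.comp_apply, LinearMap.comp_apply,
        LinearMap.rTensor_tmul, map_tmul] at h1
      have h2 : η ((subcomodule hP).tensor (subcomodule hQ)) =
        tensorA (η (subcomodule hP)) (η (subcomodule hQ)) :=
        h.2.2.2 (subFD hP hPf) (subFD hQ hQf)
      rw [← h1, h2]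
      exact (tensorA_natural (isChain_subIncl hQ).deg (hn.1 _) (hn.1 _)
        (isColimExtension_res hn M (subFD hP hPf) (subIncl hP)
          (subIncl_injective hP) (isChain_subIncl hP) (isComodHom_subIncl hP))
        (isColimExtension_res hn N (subFD hQ hQf) (subIncl hQ)
          (subIncl_injective hQ) (isChain_subIncl hQ) (isComodHom_subIncl hQ)) x' y' a).symm

theorem exists_of_mem_Z0EndTensorF {ξ : FamF k B A} (hξ : ξ ∈ Z0EndTensorF k B A) :
    ∃ f : B →ₗ[k] A, HasDeg 0 f ∧ convEnd f ∈ Z0EndTensor k B A ∧ ξ = res (convEnd f) := by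
  obtain ⟨f, hf, rfl⟩ := exists_eq_res_convEnd hξ.1
  exact ⟨f, hf, mem_Z0EndTensor_of_res (convEnd_mem_natEnd hf) hξ, rfl⟩

theorem S_mem_Z0EndTensorF {ξ : FamF k B A} (hξ : ξ ∈ Z0EndTensorF k B A) :
    S ξ ∈ Z0EndTensorF k B A := by
  obtain ⟨f, hf, h, rfl⟩ := exists_of_mem_Z0EndTensorF hξ
  rw [S_res_convEnd hf]
  exact res_mem_Z0EndTensorF (Z0EndTensor.antipode hf h)

theorem S_comp {ξ : FamF k B A} (hξ : ξ ∈ Z0EndTensorF k B A) (M : FDComodule k B) :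
    S ξ M ∘ₗ ξ M = LinearMap.id := by
  obtain ⟨f, hf, h, rfl⟩ := exists_of_mem_Z0EndTensorF hξ
  rw [S_res_convEnd hf]
  exact convEnd_antipode_comp hf h M.toDGComodule

theorem comp_mem_Z0EndTensorF {ξ ξ' : FamF k B A} (h : ξ ∈ Z0EndTensorF k B A)
    (h' : ξ' ∈ Z0EndTensorF k B A) : (fun M => ξ M ∘ₗ ξ' M) ∈ Z0EndTensorF k B A := by
  refine ⟨⟨fun M => by simpa using (h.1.1 M).comp (h'.1.1 M),
    fun M => (h.1.2.1 M).comp (h'.1.2.1 M), fun M N m ψ hψ hc => ?_⟩, fun M => ?_, ?_, fun M N => ?_⟩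
  · have h1 := h.1.2.2 M N m ψ hψ hc
    have h2 := h'.1.2.2 M N m ψ hψ hc
    rw [mul_zero, zpow_zero, one_smul] at h1 h2 ⊢
    rw [← LinearMap.comp_assoc, h1, LinearMap.comp_assoc, h2, LinearMap.comp_assoc]
  · have h1 := sub_eq_zero.1 (h.2.1 M)
    have h2 := sub_eq_zero.1 (h'.2.1 M)
    rw [sub_eq_zero, ← LinearMap.comp_assoc, h1, LinearMap.comp_assoc, h2, LinearMap.comp_assoc]
  · show ξ _ ∘ₗ ξ' _ = _
    rw [h.2.2.1, h'.2.2.1, LinearMap.comp_id]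
  · show ξ _ ∘ₗ ξ' _ = _
    rw [h.2.2.2, h'.2.2.2, tensorA_comp (h.1.2.1 M) (h.1.2.1 N) (h.1.1 N) (h'.1.1 N)]

theorem id_mem_Z0EndTensorF : (fun _ => LinearMap.id) ∈ Z0EndTensorF k B A := by
  refine ⟨⟨fun M => hasDeg_id, fun M => isALinear_id, fun M N m ψ _ _ => ?_⟩, fun M => ?_, rfl,
    fun M N => tensorA_id.symm⟩
  · rw [mul_zero, zpow_zero, one_smul, LinearMap.comp_id, LinearMap.id_comp]
  · rw [LinearMap.comp_id, LinearMap.id_comp, sub_self]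

variable (k B A) in
/-- The group `Z⁰End_⊗(ω_f ⊗ A)` under composition. -/
abbrev groupZ0EndTensorF : Group (Z0EndTensorF k B A) :=
  { mul := fun ξ ξ' => ⟨fun M => ξ.1 M ∘ₗ ξ'.1 M, comp_mem_Z0EndTensorF ξ.2 ξ'.2⟩
    one := ⟨fun _ => LinearMap.id, id_mem_Z0EndTensorF⟩
    inv := fun ξ => ⟨S ξ.1, S_mem_Z0EndTensorF ξ.2⟩
    mul_assoc := fun ξ ξ' ξ'' =>
      Subtype.ext (funext fun M => LinearMap.comp_assoc (ξ''.1 M) (ξ'.1 M) (ξ.1 M))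
    one_mul := fun ξ => Subtype.ext (funext fun M => LinearMap.id_comp (ξ.1 M))
    mul_one := fun ξ => Subtype.ext (funext fun M => LinearMap.comp_id (ξ.1 M))
    inv_mul_cancel := fun ξ => Subtype.ext (funext fun M => S_comp ξ.2 M) }

end TensorEnd

/-! ### Additivity of the dual of an endomorphism -/

section TensorSums

variable {k : Type u} [Field k] {A : Type v} [Ring A] [Algebra k A] [DGModule k A] [CDGAlgebra k A]
variable {M Y V : Type*} [AddCommGroup M] [Module k M] [DGModule k M] [AddCommGroup Y] [Module k Y]
  [DGModule k Y] [AddCommGroup V] [Module k V] [DGModule k V]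

theorem comp_lten_add_comp {X V W P Q : Type*} [AddCommGroup X] [Module k X] [DGModule k X]
    [AddCommGroup V] [Module k V] [DGModule k V] [AddCommGroup W] [Module k W] [DGModule k W]
    [AddCommMonoid P] [Module k P] [AddCommMonoid Q] [Module k Q]
    (F : X ⊗[k] W →ₗ[k] P) (R : Q →ₗ[k] X ⊗[k] V) (φ ψ : V →ₗ[k] W) :
    F ∘ₗ lten X (φ + ψ) ∘ₗ R = F ∘ₗ lten X φ ∘ₗ R + F ∘ₗ lten X ψ ∘ₗ R := by
  rw [lten_add, LinearMap.add_comp, LinearMap.comp_add]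

theorem comp_rTensor_add_comp {X V W P Q : Type*} [AddCommMonoid X] [Module k X]
    [AddCommMonoid V] [Module k V] [AddCommMonoid W] [Module k W]
    [AddCommMonoid P] [Module k P] [AddCommMonoid Q] [Module k Q]
    (F : W ⊗[k] X →ₗ[k] P) (R : Q →ₗ[k] V ⊗[k] X) {χ φ ψ : V →ₗ[k] W} (h : χ = φ + ψ) :
    F ∘ₗ χ.rTensor X ∘ₗ R = F ∘ₗ φ.rTensor X ∘ₗ R + F ∘ₗ ψ.rTensor X ∘ₗ R := by
  rw [h, LinearMap.rTensor_add, LinearMap.add_comp, LinearMap.comp_add]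

theorem comp_six {P Q R T U W Z : Type*} [AddCommMonoid P] [Module k P] [AddCommMonoid Q]
    [Module k Q] [AddCommMonoid R] [Module k R] [AddCommMonoid T] [Module k T] [AddCommMonoid U]
    [Module k U] [AddCommMonoid W] [Module k W] [AddCommMonoid Z] [Module k Z] (a : W →ₗ[k] Z)
    (b : U →ₗ[k] W) (c : T →ₗ[k] U) (m : R →ₗ[k] T) (d : Q →ₗ[k] R) (e : P →ₗ[k] Q) :
    a ∘ₗ b ∘ₗ c ∘ₗ m ∘ₗ d ∘ₗ e = (a ∘ₗ b ∘ₗ c) ∘ₗ m ∘ₗ (d ∘ₗ e) := rfl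

theorem qmap_add (φ ψ : M ⊗[k] A →ₗ[k] M ⊗[k] A) : qmap (φ + ψ) = qmap φ + qmap ψ := rfl

theorem tensorA_add_right {M N M' N' : Type*} [AddCommGroup M] [Module k M] [DGModule k M]
    [AddCommGroup N] [Module k N] [DGModule k N] [AddCommGroup M'] [Module k M'] [DGModule k M']
    [AddCommGroup N'] [Module k N'] [DGModule k N']
    (φ : M ⊗[k] A →ₗ[k] N ⊗[k] A) (φ' ψ' : M' ⊗[k] A →ₗ[k] N' ⊗[k] A) :
    tensorA φ (φ' + ψ') = tensorA φ φ' + tensorA φ ψ' :=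
  comp_lten_add_comp (mulSwap k A N N' ∘ₗ (qmap φ).rTensor (N' ⊗[k] A))
    (TensorProduct.assoc k M M' A).toLinearMap φ' ψ'

theorem tensorA_add_id (φ ψ : M ⊗[k] A →ₗ[k] M ⊗[k] A) :
    tensorA (φ + ψ) (LinearMap.id : Y ⊗[k] A →ₗ[k] Y ⊗[k] A) =
      tensorA φ LinearMap.id + tensorA ψ LinearMap.id :=
  comp_rTensor_add_comp (mulSwap k A M Y)
    (lten M LinearMap.id ∘ₗ (TensorProduct.assoc k M Y A).toLinearMap) (qmap_add φ ψ)

theorem comp_tensorA_add_comp (F : (Y ⊗[k] V) ⊗[k] A →ₗ[k] Y ⊗[k] A)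
    (G : Y ⊗[k] A →ₗ[k] (Y ⊗[k] V) ⊗[k] A) {χ φ ψ : V ⊗[k] A →ₗ[k] V ⊗[k] A} (h : χ = φ + ψ) :
    F ∘ₗ tensorA (LinearMap.id : Y ⊗[k] A →ₗ[k] Y ⊗[k] A) χ ∘ₗ G =
    F ∘ₗ tensorA (LinearMap.id : Y ⊗[k] A →ₗ[k] Y ⊗[k] A) φ ∘ₗ G +
    F ∘ₗ tensorA (LinearMap.id : Y ⊗[k] A →ₗ[k] Y ⊗[k] A) ψ ∘ₗ G := by
  rw [h, tensorA_add_right, LinearMap.add_comp, LinearMap.comp_add]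

/-- The case of a tensor product; applying `comp_tensorA_add_comp` directly in `dualEnd_add` makes
the comparison of the module structures on iterated tensor products expensive. -/
theorem comp_tensorA_add_comp' (F : (Y ⊗[k] (M ⊗[k] Y)) ⊗[k] A →ₗ[k] Y ⊗[k] A)
    (G : Y ⊗[k] A →ₗ[k] (Y ⊗[k] (M ⊗[k] Y)) ⊗[k] A)
    {χ φ ψ : (M ⊗[k] Y) ⊗[k] A →ₗ[k] (M ⊗[k] Y) ⊗[k] A} (h : χ = φ + ψ) :
    F ∘ₗ tensorA (LinearMap.id : Y ⊗[k] A →ₗ[k] Y ⊗[k] A) χ ∘ₗ G =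
    F ∘ₗ tensorA (LinearMap.id : Y ⊗[k] A →ₗ[k] Y ⊗[k] A) φ ∘ₗ G +
    F ∘ₗ tensorA (LinearMap.id : Y ⊗[k] A →ₗ[k] Y ⊗[k] A) ψ ∘ₗ G :=
  comp_tensorA_add_comp F G h

theorem dualEnd_eq_comp (ev : Y ⊗[k] M →ₗ[k] k) (cv : k →ₗ[k] M ⊗[k] Y)
    (φ : M ⊗[k] A →ₗ[k] M ⊗[k] A) : dualEnd ev cv φ =
    ((TensorProduct.lid k Y).toLinearMap.rTensor A ∘ₗ
      tensorA (ev.rTensor A) (LinearMap.id : Y ⊗[k] A →ₗ[k] Y ⊗[k] A) ∘ₗ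
      (TensorProduct.assoc k Y M Y).symm.toLinearMap.rTensor A) ∘ₗ
      tensorA (LinearMap.id : Y ⊗[k] A →ₗ[k] Y ⊗[k] A)
        (tensorA φ (LinearMap.id : Y ⊗[k] A →ₗ[k] Y ⊗[k] A)) ∘ₗ
      (tensorA (LinearMap.id : Y ⊗[k] A →ₗ[k] Y ⊗[k] A) (cv.rTensor A) ∘ₗ
      (TensorProduct.rid k Y).symm.toLinearMap.rTensor A) :=
  (dualEnd_eq ev cv φ).trans (comp_six _ _ _ _ _ _)

/-- The endomorphism occurs exactly once in the composite, in a slot where composition and `tensorA`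
are additive. Needed because the explicit formula for `S` covers homogeneous families only. -/
theorem dualEnd_add (ev : Y ⊗[k] M →ₗ[k] k) (cv : k →ₗ[k] M ⊗[k] Y)
    (φ ψ : M ⊗[k] A →ₗ[k] M ⊗[k] A) :
    dualEnd ev cv (φ + ψ) = dualEnd ev cv φ + dualEnd ev cv ψ :=
  (dualEnd_eq_comp ev cv (φ + ψ)).trans
    ((comp_tensorA_add_comp' _ _ (tensorA_add_id φ ψ)).trans
      (congrArg₂ (· + ·) (dualEnd_eq_comp ev cv φ).symm (dualEnd_eq_comp ev cv ψ).symm))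

end TensorSums

/-! ### From homogeneous families to finite sums -/

section Sums

variable {k B : Type u} [Field k] [Ring B] [Algebra k B] [DGModule k B] [Coalgebra k B]
  [CDGHopfAlgebra k B]
variable {A : Type v} [Ring A] [Algebra k A] [DGModule k A] [CDGAlgebra k A]

theorem S_add (ξ ξ' : FamF k B A) : S (ξ + ξ') = S ξ + S ξ' :=
  funext fun _ => dualEnd_add _ _ _ _

theorem S_mem_natEndF {n : ℤ} {ξ : FamF k B A} (hξ : ξ ∈ NatEndF k B A n) :
    S ξ ∈ NatEndF k B A n := by
  obtain ⟨f, hf, rfl⟩ := exists_eq_res_convEnd hξ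
  rw [S_res_convEnd hf]
  exact res_mem_natEndF (convEnd_mem_natEnd (hasDeg_comp_antipode hf))

theorem S_mem_endFunctorF {ξ : FamF k B A} (hξ : ξ ∈ EndFunctorF k B A) :
    S ξ ∈ EndFunctorF k B A := by
  refine Submodule.iSup_induction _ (motive := fun ξ => S ξ ∈ EndFunctorF k B A) hξ
    (fun n ξ h => Submodule.mem_iSup_of_mem n (S_mem_natEndF h)) ?_ (fun ξ ξ' h h' => ?_)
  -- The zero family is homogeneous of degree `0`, so the value of `S` at zero need not be computed.
  · exact Submodule.mem_iSup_of_mem 0 (S_mem_natEndF (zero_mem _))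
  · rw [S_add]
    exact add_mem h h'

theorem exists_colimExtension {ξ : FamF k B A} (hξ : ξ ∈ EndFunctorF k B A) :
    ∃ ζ, IsColimExtension ξ ζ ∧ ζ ∈ EndFunctor k B A := by
  refine Submodule.iSup_induction _
    (motive := fun ξ => ∃ ζ, IsColimExtension ξ ζ ∧ ζ ∈ EndFunctor k B A) hξ
    (fun n ξ h => ?_) ⟨0, isColimExtension_zero, zero_mem _⟩ ?_
  · obtain ⟨f, hf, rfl⟩ := exists_eq_res_convEnd h
    exact ⟨convEnd f, isColimExtension_res (convEnd_mem_natEnd hf),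
      Submodule.mem_iSup_of_mem n (convEnd_mem_natEnd hf)⟩
  · rintro ξ ξ' ⟨ζ, h, hm⟩ ⟨ζ', h', hm'⟩
    exact ⟨ζ + ζ', h.add h', add_mem hm hm'⟩

theorem res_mem_endFunctorF {η : Fam k B A} (hη : η ∈ EndFunctor k B A) :
    res η ∈ EndFunctorF k B A ∧ IsColimExtension (res η) η := by
  refine Submodule.iSup_induction _
    (motive := fun η => res η ∈ EndFunctorF k B A ∧ IsColimExtension (res η) η) hη
    (fun n η h => ⟨Submodule.mem_iSup_of_mem n (res_mem_natEndF h), isColimExtension_res h⟩)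
    ⟨zero_mem _, isColimExtension_zero⟩ ?_
  rintro η η' ⟨h1, h2⟩ ⟨h1', h2'⟩
  exact ⟨add_mem h1 h1', h2.add h2'⟩

/-- For homogeneous `η` represented by `f`, both operations are represented by `f ∘ antipode`; both
are additive, so the statement passes to sums. -/
theorem isColimExtension_sigma {η : Fam k B A} (hη : η ∈ EndFunctor k B A) :
    IsColimExtension (S (res η)) (sigma η) := by
  have key : ∀ {n : ℤ} {η : Fam k B A}, η ∈ NatEnd k B A n →
      IsColimExtension (S (res η)) (sigma η) := by
    intro n η h
    obtain ⟨f, hf, rfl⟩ := exists_eq_convEnd h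
    rw [S_res_convEnd hf, sigma_convEnd hf]
    exact isColimExtension_res (convEnd_mem_natEnd (hasDeg_comp_antipode hf))
  refine Submodule.iSup_induction _
    (motive := fun η => IsColimExtension (S (res η)) (sigma η)) hη (fun n η h => key h)
    (key (zero_mem (NatEnd k B A 0))) (fun η η' h h' => ?_)
  rw [sigma_add]
  exact (S_add (res η) (res η')).symm ▸ h.add h'

end Sums

end DG

end

/-! ### The theorem -/

theorem mainTheorem8 {k : Type u} [Field k] [CharZero k]
    {B : Type u} [Ring B] [Algebra k B] [DG.DGModule k B] [Coalgebra k B] [DG.CDGHopfAlgebra k B]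
    {A : Type v} [Ring A] [Algebra k A] [DG.DGModule k A] [DG.CDGAlgebra k A] :
    (∀ (n : ℤ) (ξ : DG.FamF k B A), ξ ∈ DG.NatEndF k B A n → DG.S ξ ∈ DG.NatEndF k B A n) ∧
    (∀ ξ : DG.FamF k B A, ξ ∈ DG.EndFunctorF k B A → DG.S ξ ∈ DG.EndFunctorF k B A) ∧
    (∀ ξ : DG.FamF k B A, ξ ∈ DG.Z0EndTensorF k B A → DG.S ξ ∈ DG.Z0EndTensorF k B A) ∧
    (∃ G : Group (DG.Z0EndTensorF k B A),
      (∀ (ξ ξ' : DG.Z0EndTensorF k B A) (M : DG.FDComodule k B),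
        (G.mul ξ ξ').1 M = ξ.1 M ∘ₗ ξ'.1 M) ∧
      (∀ M : DG.FDComodule k B, G.one.1 M = LinearMap.id) ∧
      (∀ ξ : DG.Z0EndTensorF k B A, (G.inv ξ).1 = DG.S ξ.1)) ∧
    (∀ ξ : DG.FamF k B A, ξ ∈ DG.EndFunctorF k B A →
      (∃! ζ : DG.Fam k B A, DG.IsColimExtension ξ ζ) ∧ DG.IsColimExtension ξ (DG.limA ξ) ∧
      DG.limA ξ ∈ DG.EndFunctor k B A ∧ DG.res (DG.limA ξ) = ξ) ∧
    (∀ η : DG.Fam k B A, η ∈ DG.EndFunctor k B A →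
      DG.res η ∈ DG.EndFunctorF k B A ∧ DG.limA (DG.res η) = η) ∧
    (∀ η : DG.Fam k B A, η ∈ DG.EndFunctor k B A → DG.sigma η = DG.limA (DG.S (DG.res η))) ∧
    (∀ η : DG.Fam k B A, η ∈ DG.Z0EndTensor k B A →
      DG.res η ∈ DG.Z0EndTensorF k B A ∧ DG.sigma η ∈ DG.Z0EndTensor k B A ∧
      ∀ M : DG.DGComodule k B, DG.sigma η M ∘ₗ η M = LinearMap.id ∧
        η M ∘ₗ DG.sigma η M = LinearMap.id) := by
  refine ⟨fun n ξ h => DG.S_mem_natEndF h, fun ξ h => DG.S_mem_endFunctorF h,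
    fun ξ h => DG.S_mem_Z0EndTensorF h,
    ⟨DG.groupZ0EndTensorF k B A, fun _ _ _ => rfl, fun _ => rfl, fun _ => rfl⟩,
    fun ξ h => ?_, fun η h => ?_, fun η h => (DG.isColimExtension_sigma h).limA_eq.symm,
    fun η h => ?_⟩
  · obtain ⟨ζ, hζ, hm⟩ := DG.exists_colimExtension h
    rw [hζ.limA_eq]
    exact ⟨⟨ζ, hζ, fun ζ' h' => h'.unique hζ⟩, hζ, hm, hζ.res_eq⟩
  · obtain ⟨h1, h2⟩ := DG.res_mem_endFunctorF h
    exact ⟨h1, h2.limA_eq⟩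
  · obtain ⟨f, hf, rfl⟩ := DG.exists_eq_convEnd h.1
    rw [DG.sigma_convEnd hf]
    exact ⟨DG.res_mem_Z0EndTensorF h, DG.Z0EndTensor.antipode hf h,
      fun M => ⟨DG.convEnd_antipode_comp hf h M, DG.convEnd_comp_antipode hf h M⟩⟩
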